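/- Let $\Lambda^2\subset\mathbb{R}^4_{x,p}$ be a smooth Lagrangian manifold contained in a level set $\{F(x,|p|)=\mathrm{const}\}$, where $F$ is a smooth function defined in a neighbourhood of the points $(x,|p|)$, $(x,p)\in\Lambda^2$. Let $(\tau,\psi)$ be eikonal coordinates on an open subset of $\Lambda^2$: $\Lambda^2$ is given there by $x=X(\tau,\psi)$, $p=P(\tau,\psi)$, $(\tau,\psi)\in\Omega$, and $d\tau=\langle P,dX\rangle$. Let $(\tau^*,\psi^*)\in\Omega$ be a focal point, that is, $\det(X_\tau,X_\psi)=0$ there, and let an asterisk denote values at $(\tau^*,\psi^*)$; assume that $\partial F/\partial|p|\neq0$ at $(X^*,|P^*|)$. Put $x^*=X^*$ and let $\tau=\tau(x,\psi)$ be a smooth solution of $\langle P(\tau,\psi),x-X(\tau,\psi)\rangle=0$ in a neighbourhood $W$ of $(x^*,\psi^*)$ with $\tau(x^*,\psi^*)=\tau^*$. For a smooth complex-valued compactly supported amplitude $A(\tau,\psi)$ and $h>0$ put $$\mathcal I(x,h)=\Bigl(\frac{i}{2\pi h}\Bigr)^{1/2}\int_{(x,\psi)\in W}\Bigl[e^{\frac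 ih\tau}A(\tau,\psi)\,|\det(P,P_\psi)|^{1/2}\Bigr]_{\tau=\tau(x,\psi)}d\psi,\qquad \arg i=\frac{\pi}{2},$$ and let $$\mathrm{Ai}(y)=\frac1\pi\int_0^\infty\cos\Bigl(\frac{\eta^3}{3}+y\eta\Bigr)d\eta,\qquad \mathrm P^{\pm}(y,v)=\frac1{2\pi}\int_{-\infty}^{\infty}e^{i(y\eta+v\eta^2\pm\eta^4)}\,d\eta$$ (convergent improper integrals). Then there is a neighbourhood $N$ of $(\tau^*,\psi^*)$ such that for every $A$ with $\operatorname{supp}A\subset N$ and every $C>0$ the following holds as $h\to+0$, uniformly in $x$ with $|x-x^*|\le Ch^{5/6}$ (the integral $\mathcal I$ being absolutely convergent there for small $h$). (a) (Fold.) If $X^*_{\psi\psi}\ne0$, then, with $c=\langle P^*_\psi,X^*_{\psi\psi}\rangle$ and $\sqrt[3]{c}$ the real cube root, $$\mathcal I=\frac{e^{i\pi/4}\,2^{5/6}\sqrt{\pi|P^*||P^*_\psi|}}{|c|^{1/3}h^{1/6}}\,A(\tau^*,\psi^*)\,e^{\frac ih(\tau^*+\langle P^*,x-X^*\rangle)}\,\mathrm{Ai}\Bigl(-\frac{2^{1/3}\langle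 P^*_\psi,x-X^*\rangle}{h^{2/3}\sqrt[3]{c}}\Bigr)+O(h^{1/6}).$$ (b) (Cusp.) If $X^*_{\psi\psi}=0$ and $X^*_{\psi\psi\psi}\ne0$, then, with $c=\langle P^*_\psi,X^*_{\psi\psi\psi}\rangle$, $$\mathcal I=\frac{2\sqrt{\pi}\,e^{i\pi/4}\sqrt[4]{6}\sqrt{|P^*||P^*_\psi|}}{|c|^{1/4}h^{1/4}}\,A(\tau^*,\psi^*)\,e^{\frac ih(\tau^*+\langle P^*,x-X^*\rangle)}\,\mathrm P^{\pm}\Bigl(\sqrt[4]{\frac{24}{h^3|c|}}\,\langle P^*_\psi,x-X^*\rangle,\ \sqrt{\frac{6}{h|c|}}\,\langle P^*_{\psi\psi},x-X^*\rangle\Bigr)+O(1),$$ where $\mathrm P^-$ is taken if $c>0$ and $\mathrm P^+$ if $c<0$. -/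

import Mathlib

open Set Filter Topology MeasureTheory
open scoped ContDiff

noncomputable section

namespace Caustic

/-- The Euclidean plane; it serves both as configuration space `ℝ²ₓ` and as momentum space `ℝ²ₚ`. -/
abbrev Plane : Type := EuclideanSpace ℝ (Fin 2)

/-- The determinant of the `2 × 2` matrix with columns `u`, `v`. -/
def det2 (u v : Plane) : ℝ := u 0 * v 1 - u 1 * v 0

/-- Partial derivative with respect to the first coordinate `τ` of a map of `(τ, ψ)`. -/
def dtau (G : ℝ × ℝ → Plane) (a : ℝ × ℝ) : Plane := deriv (fun t => G (t, a.2)) a.1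

/-- Partial derivative with respect to the second coordinate `ψ` of a map of `(τ, ψ)`. -/
def dpsi (G : ℝ × ℝ → Plane) (a : ℝ × ℝ) : Plane := deriv (fun s => G (a.1, s)) a.2

/-- `x = X(a)`, `p = P(a)`, `a ∈ Ω`, is a local coordinate system on the subset `L` of the phase
space (points of the phase space are pairs `(x, p)`): a smooth immersion of the open set `Ω ⊆ ℝ²`
which is a homeomorphism onto a relatively open subset of `L`. -/
structure IsCoordinateSystem (L : Set (Plane × Plane)) (Ω : Set (ℝ × ℝ))
    (X P : ℝ × ℝ → Plane) : Prop where
  isOpen : IsOpen Ω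
  smooth_X : ContDiffOn ℝ ∞ X Ω
  smooth_P : ContDiffOn ℝ ∞ P Ω
  immersion : ∀ a ∈ Ω, ∀ v : ℝ × ℝ, fderiv ℝ X a v = 0 → fderiv ℝ P a v = 0 → v = 0
  injOn : InjOn (fun a => (X a, P a)) Ω
  image_open : ∀ V ⊆ Ω, IsOpen V →
    ∃ O : Set (Plane × Plane), IsOpen O ∧ (fun a => (X a, P a)) '' V = L ∩ O

/-- `L` is a (smooth, embedded) two-dimensional Lagrangian manifold in the phase space `ℝ⁴`:
near each of its points it has a local coordinate system, in which the restriction of the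
symplectic form `dp ∧ dx` vanishes. -/
def IsLagrangianSurface (L : Set (Plane × Plane)) : Prop :=
  ∀ q ∈ L, ∃ (Ω : Set (ℝ × ℝ)) (X P : ℝ × ℝ → Plane), IsCoordinateSystem L Ω X P ∧
    (∃ a ∈ Ω, (X a, P a) = q) ∧
    ∀ a ∈ Ω, ∀ v w : ℝ × ℝ,
      inner ℝ (fderiv ℝ P a v) (fderiv ℝ X a w) = inner ℝ (fderiv ℝ P a w) (fderiv ℝ X a v)

/-- Eikonal coordinates `(τ, ψ)` on an open piece of `L`: local coordinates whose first member is
an eikonal, that is, solves the Pfaff equation `dτ = P dX`. -/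
structure IsEikonalCoordinateSystem (L : Set (Plane × Plane)) (Ω : Set (ℝ × ℝ))
    (X P : ℝ × ℝ → Plane) : Prop extends IsCoordinateSystem L Ω X P where
  pfaff : ∀ a ∈ Ω, ∀ v : ℝ × ℝ, inner ℝ (P a) (fderiv ℝ X a v) = v.1

/-- The point with coordinates `a` is focal: the projection of the manifold to the configuration
space is degenerate there, that is, the Jacobian `det (X_τ, X_ψ)` vanishes. -/
def IsFocal (X : ℝ × ℝ → Plane) (a : ℝ × ℝ) : Prop := det2 (dtau X a) (dpsi X a) = 0

/-- `T = τ(x, ψ)` is the smooth function which the equation `⟨P(τ, ψ), x - X(τ, ψ)⟩ = 0` defines on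
an open neighbourhood `W` of `(x*, ψ*)`, with `τ(x*, ψ*) = τ*`; here `a = (τ*, ψ*)`,
`x* = X(τ*, ψ*)`. -/
structure IsPhaseFunction (Ω : Set (ℝ × ℝ)) (X P : ℝ × ℝ → Plane) (a : ℝ × ℝ)
    (W : Set (Plane × ℝ)) (T : Plane × ℝ → ℝ) : Prop where
  isOpen : IsOpen W
  base_mem : (X a, a.2) ∈ W
  smooth : ContDiffOn ℝ ∞ T W
  base_eq : T (X a, a.2) = a.1
  maps : ∀ w ∈ W, (T w, w.2) ∈ Ω
  eqn : ∀ w ∈ W, inner ℝ (P (T w, w.2)) (w.1 - X (T w, w.2)) = 0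

/-- The integrand `e^{iτ/h} A(τ, ψ) |det (P, P_ψ)|^{1/2}` at `τ = τ(x, ψ)`. -/
def singularIntegrand (P : ℝ × ℝ → Plane) (T : Plane × ℝ → ℝ) (A : ℝ × ℝ → ℂ)
    (h : ℝ) (x : Plane) (ψ : ℝ) : ℂ :=
  Complex.exp (Complex.I / h * T (x, ψ)) * A (T (x, ψ), ψ) *
    (√|det2 (P (T (x, ψ), ψ)) (dpsi P (T (x, ψ), ψ))| : ℝ)

/-- The integral of the singular chart (the power of `i / (2πh)` is the principal one,
`arg i = π / 2`); for given `x`, the integrand is defined for `(x, ψ) ∈ W`. -/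
def singularIntegral (P : ℝ × ℝ → Plane) (W : Set (Plane × ℝ)) (T : Plane × ℝ → ℝ)
    (A : ℝ × ℝ → ℂ) (h : ℝ) (x : Plane) : ℂ :=
  (Complex.I / (2 * Real.pi * h : ℝ)) ^ (1 / 2 : ℂ) *
    ∫ ψ in {ψ : ℝ | (x, ψ) ∈ W}, singularIntegrand P T A h x ψ

/-- The real cube root, odd in its argument. -/
def cbrt (c : ℝ) : ℝ := SignType.sign c * |c| ^ (1 / 3 : ℝ)

/-- The truncated integral `(1/π) ∫₀ᴿ cos (η³/3 + yη) dη`. -/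
def airyTrunc (y R : ℝ) : ℝ :=
  1 / Real.pi * ∫ η in (0 : ℝ)..R, Real.cos (η ^ 3 / 3 + y * η)

/-- The Airy function, the improper integral `(1/π) ∫₀^∞ cos (η³/3 + yη) dη`. -/
def airyAi (y : ℝ) : ℝ := limUnder atTop (airyTrunc y)

/-- The truncated integral `(1/2π) ∫_{R₁}^{R₂} exp (i(yη + vη² + sη⁴)) dη`, `R = (R₁, R₂)`. -/
def pearceyTrunc (s y v : ℝ) (R : ℝ × ℝ) : ℂ :=
  1 / (2 * Real.pi) * ∫ η in R.1..R.2,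
    Complex.exp (Complex.I * (y * η + v * η ^ 2 + s * η ^ 4 : ℝ))

/-- The Pearcey functions, the improper integrals
`P^±(y, v) = (1/2π) ∫_{-∞}^∞ exp (i(yη + vη² ± η⁴)) dη`; `s = 1` for `P⁺` and `s = -1` for `P⁻`. -/
def pearcey (s y v : ℝ) : ℂ := limUnder (atBot ×ˢ atTop) (pearceyTrunc s y v)

/-- The leading term at a fold: `p0 = P*`, `p1 = P*_ψ`, `c = ⟨P*_ψ, X*_{ψψ}⟩`, `z = x - X*`, and
`A0 = A(τ*, ψ*)`. -/
def foldTerm (p0 p1 : Plane) (c τ0 : ℝ) (A0 : ℂ) (h : ℝ) (z : Plane) : ℂ :=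
  Complex.exp (Complex.I * (Real.pi / 4)) *
    (2 ^ (5 / 6 : ℝ) * √(Real.pi * ‖p0‖ * ‖p1‖) / (|c| ^ (1 / 3 : ℝ) * h ^ (1 / 6 : ℝ)) : ℝ) *
    A0 * Complex.exp (Complex.I / h * (τ0 + inner ℝ p0 z : ℝ)) *
    (airyAi (-(2 ^ (1 / 3 : ℝ) * inner ℝ p1 z / (h ^ (2 / 3 : ℝ) * cbrt c))) : ℝ)

/-- The leading term at a cusp: `p0 = P*`, `p1 = P*_ψ`, `p2 = P*_{ψψ}`, `c = ⟨P*_ψ, X*_{ψψψ}⟩`,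
`z = x - X*`, and `A0 = A(τ*, ψ*)`. The phase of the integral has fourth derivative `-c`, whence
`P⁻` for `c > 0` and `P⁺` for `c < 0`. -/
def cuspTerm (p0 p1 p2 : Plane) (c τ0 : ℝ) (A0 : ℂ) (h : ℝ) (z : Plane) : ℂ :=
  Complex.exp (Complex.I * (Real.pi / 4)) *
    (2 * √Real.pi * 6 ^ (1 / 4 : ℝ) * √(‖p0‖ * ‖p1‖) /
      (|c| ^ (1 / 4 : ℝ) * h ^ (1 / 4 : ℝ)) : ℝ) *
    A0 * Complex.exp (Complex.I / h * (τ0 + inner ℝ p0 z : ℝ)) *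
    pearcey (if 0 < c then -1 else 1)
      ((24 / (h ^ 3 * |c|)) ^ (1 / 4 : ℝ) * inner ℝ p1 z)
      (√(6 / (h * |c|)) * inner ℝ p2 z)

/-- The integral of the singular chart near the focal point `a = (τ*, ψ*)` equals `main A h z`,
`z = x - x*`, up to `O(h^r)`, uniformly in every `O(h^{5/6})`-neighbourhood of `x* = X(τ*, ψ*)`,
as `h → +0`, for all smooth amplitudes supported sufficiently near `a`. -/
def HasCausticAsymptotics (X P : ℝ × ℝ → Plane) (a : ℝ × ℝ) (W : Set (Plane × ℝ))
    (T : Plane × ℝ → ℝ) (main : ℂ → ℝ → Plane → ℂ) (r : ℝ) : Prop :=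
  ∃ N ∈ 𝓝 a, ∀ A : ℝ × ℝ → ℂ, ContDiff ℝ ∞ A → HasCompactSupport A → tsupport A ⊆ N →
    ∀ C : ℝ, 0 < C → ∃ K h₀ : ℝ, 0 < h₀ ∧ ∀ h : ℝ, 0 < h → h < h₀ →
      ∀ x : Plane, ‖x - X a‖ ≤ C * h ^ (5 / 6 : ℝ) →
        IntegrableOn (singularIntegrand P T A h x) {ψ : ℝ | (x, ψ) ∈ W} ∧
        ‖singularIntegral P W T A h x - main (A a) h (x - X a)‖ ≤ K * h ^ r

end Caustic

end

open Caustic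

namespace Caustic

/-! Put m = 0 at a fold, m = 1 at a cusp, h = ε^(m+3), z = x - x*, θ = ψ - ψ*.

Geometry. At the focal point X_ψ is parallel to X_τ, while ⟨P, X_τ⟩ = 1 and ⟨P, X_ψ⟩ = 0, so X_ψ =
0; the immersion property then gives P_ψ ≠ 0. Differentiating F(X, |P|) = const in ψ gives P ⟂ P_ψ.
Differentiating ⟨P, X_ψ⟩ = 0 shows that the first nonvanishing ψ-derivative of X, of order m + 2, is
orthogonal to P; since P and P_ψ span the plane, its product c with P_ψ is nonzero. Expanding ⟨P, x
- X⟩ = 0 yields the phase τ* + ⟨P*, z⟩ + ⟨P*_ψ, z⟩ θ - c θ^(m+3)/(m+3)! plus an error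
(`exists_abs_phase_sub_le`).

Scaling. Put θ = ±μεη. Since |z| ≤ C h^(5/6) ≤ C ε^(m+2), the phase divided by h is, up to a
constant, yη + vη² + ση^(m+3) + O(ε) for bounded η, with y bounded. Any v = O(ε) is admissible, so
the second argument of the Pearcey function lies within the error and the quadratic term of the
phase need not be found.

Analysis. The rescaled integral runs over η of order up to 1/ε, and must be replaced by the improper
model integral with error O(ε) (`exists_norm_integral_sub_le`). On a bounded interval this is
direct. Beyond it both integrals are integrated by parts twice: the remaining amplitude decays like
η^(-2m-6), while the phase error grows like εη^(m+4), so the product is at most of size ε η^(-2). A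
single integration by parts would leave a nonintegrable bound εη.

The result is με times the two half-line model integrals with error O(ε²); the factor h^(-1/2) turns
this into h^(2/(m+3) - 1/2), that is h^(1/6) at a fold and h^0 at a cusp. -/

/-! ### Jets and double integration by parts. -/

/-- `f 0, …, f m` are the successive derivatives of `f 0` on `s`. -/
def IsJet {E : Type*} [NormedAddCommGroup E] [NormedSpace ℝ E] (f : ℕ → ℝ → E) (m : ℕ)
    (s : Set ℝ) : Prop :=
  ∀ k < m, ∀ η ∈ s, HasDerivAt (f k) (f (k + 1) η) η

/-- The boundary term of two integrations by parts in `∫ e^{iS} b`. -/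
noncomputable def ibpPrim (S : ℕ → ℝ → ℝ) (b : ℕ → ℝ → ℂ) (η : ℝ) : ℂ :=
  Complex.exp (Complex.I * S 0 η) *
    (-Complex.I * b 0 η / S 1 η + b 1 η / (S 1 η : ℂ) ^ 2 - b 0 η * S 2 η / (S 1 η : ℂ) ^ 3)

/-- The amplitude left by two integrations by parts in `∫ e^{iS} b`. -/
noncomputable def ibpRem (S : ℕ → ℝ → ℝ) (b : ℕ → ℝ → ℂ) (η : ℝ) : ℂ :=
  b 2 η / (S 1 η : ℂ) ^ 2 - 3 * b 1 η * S 2 η / (S 1 η : ℂ) ^ 3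
    - b 0 η * S 3 η / (S 1 η : ℂ) ^ 3 + 3 * b 0 η * (S 2 η : ℂ) ^ 2 / (S 1 η : ℂ) ^ 4

/-- Each integration by parts writes e^{iS} as (e^{iS})'/(iS'). Carrying out both at once in an
explicit primitive leaves a single algebraic identity to check. -/
theorem hasDerivAt_ibpPrim {S : ℕ → ℝ → ℝ} {b : ℕ → ℝ → ℂ} {η : ℝ} (hS : IsJet S 3 {η})
    (hb : IsJet b 2 {η}) (h1 : S 1 η ≠ 0) :
    HasDerivAt (ibpPrim S b) (Complex.exp (Complex.I * S 0 η) * b 0 η +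
      Complex.exp (Complex.I * S 0 η) * ibpRem S b η) η := by
  have s0 := (hS 0 (by norm_num) η rfl).ofReal_comp
  have s1 := (hS 1 (by norm_num) η rfl).ofReal_comp
  have s2 := (hS 2 (by norm_num) η rfl).ofReal_comp
  have b0 := hb 0 (by norm_num) η rfl
  have b1 := hb 1 (by norm_num) η rfl
  have h1' : (S 1 η : ℂ) ≠ 0 := by exact_mod_cast h1
  have e := (s0.const_mul Complex.I).cexp
  have q1 := (b0.const_mul (-Complex.I)).fun_div s1 h1'
  have q2 := b1.fun_div (s1.fun_pow 2) (pow_ne_zero 2 h1')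
  have q3 := (b0.fun_mul s2).fun_div (s1.fun_pow 3) (pow_ne_zero 3 h1')
  have := e.fun_mul ((q1.fun_add q2).fun_sub q3)
  refine this.congr_deriv ?_
  simp only [ibpRem]
  have hI : Complex.I ^ 2 = -1 := Complex.I_sq
  push_cast
  field_simp
  ring_nf
  simp only [hI]
  ring

theorem IsJet.mono {E : Type*} [NormedAddCommGroup E] [NormedSpace ℝ E] {f : ℕ → ℝ → E} {m m' : ℕ}
    {s s' : Set ℝ} (h : IsJet f m s) (hm : m' ≤ m) (hs : s' ⊆ s) : IsJet f m' s' :=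
  fun k hk η hη => h k (hk.trans_le hm) η (hs hη)

theorem IsJet.continuousOn {E : Type*} [NormedAddCommGroup E] [NormedSpace ℝ E] {f : ℕ → ℝ → E}
    {m : ℕ} {s : Set ℝ} (h : IsJet f m s) {k : ℕ} (hk : k < m) : ContinuousOn (f k) s :=
  fun η hη => (h k hk η hη).continuousAt.continuousWithinAt

theorem continuousOn_exp_mul_ibpRem {S : ℕ → ℝ → ℝ} {b : ℕ → ℝ → ℂ} {s : Set ℝ} (hS : IsJet S 4 s)
    (hb : IsJet b 3 s) (h1 : ∀ η ∈ s, S 1 η ≠ 0) :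
    ContinuousOn (fun η => Complex.exp (Complex.I * S 0 η) * ibpRem S b η) s := by
  have hs : ∀ k < 4, ContinuousOn (fun η => (S k η : ℂ)) s := fun k hk =>
    Complex.continuous_ofReal.comp_continuousOn (hS.continuousOn hk)
  have s0 := hs 0 (by norm_num)
  have s1 := hs 1 (by norm_num)
  have s2 := hs 2 (by norm_num)
  have s3 := hs 3 (by norm_num)
  have b0 := hb.continuousOn (k := 0) (by norm_num)
  have b1 := hb.continuousOn (k := 1) (by norm_num)
  have b2 := hb.continuousOn (k := 2) (by norm_num)
  have h1' : ∀ n : ℕ, ∀ η ∈ s, (S 1 η : ℂ) ^ n ≠ 0 := fun n η hη =>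
    pow_ne_zero n (by exact_mod_cast h1 η hη)
  unfold ibpRem
  refine ContinuousOn.mul (by fun_prop) ?_
  refine ContinuousOn.add (ContinuousOn.sub (ContinuousOn.sub ?_ ?_) ?_) ?_
  all_goals exact ContinuousOn.div (by fun_prop) (by fun_prop) (h1' _)

theorem continuousOn_exp_mul {S : ℕ → ℝ → ℝ} {b : ℕ → ℝ → ℂ} {s : Set ℝ} (hS : IsJet S 4 s)
    (hb : IsJet b 3 s) :
    ContinuousOn (fun η => Complex.exp (Complex.I * S 0 η) * b 0 η) s := by
  have s0 : ContinuousOn (fun η => (S 0 η : ℂ)) s :=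
    Complex.continuous_ofReal.comp_continuousOn (hS.continuousOn (by norm_num))
  have b0 := hb.continuousOn (k := 0) (by norm_num)
  fun_prop

theorem integral_exp_mul_eq {S : ℕ → ℝ → ℝ} {b : ℕ → ℝ → ℂ} {M B : ℝ} (hMB : M ≤ B)
    (hS : IsJet S 4 (Icc M B)) (hb : IsJet b 3 (Icc M B)) (h1 : ∀ η ∈ Icc M B, S 1 η ≠ 0) :
    ∫ η in M..B, Complex.exp (Complex.I * S 0 η) * b 0 η =
      ibpPrim S b B - ibpPrim S b M -
        ∫ η in M..B, Complex.exp (Complex.I * S 0 η) * ibpRem S b η := by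
  have i1 : IntervalIntegrable (fun η => Complex.exp (Complex.I * S 0 η) * b 0 η) volume M B :=
    ContinuousOn.intervalIntegrable (by rw [uIcc_of_le hMB]; exact continuousOn_exp_mul hS hb)
  have i2 : IntervalIntegrable (fun η => Complex.exp (Complex.I * S 0 η) * ibpRem S b η)
      volume M B :=
    ContinuousOn.intervalIntegrable
      (by rw [uIcc_of_le hMB]; exact continuousOn_exp_mul_ibpRem hS hb h1)
  have := intervalIntegral.integral_eq_sub_of_hasDerivAt (f := ibpPrim S b)
    (fun η hη => by
      rw [uIcc_of_le hMB] at hη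
      exact hasDerivAt_ibpPrim (hS.mono (by norm_num) (by simpa using hη))
        (hb.mono (by norm_num) (by simpa using hη)) (h1 η hη)) (i1.add i2)
  rw [← this, ← intervalIntegral.integral_sub (i1.add i2) i2]
  simp

/-! ### Rescaled derivatives. -/

/-- The first three derivatives of a phase and two derivatives of an amplitude, rescaled to
size one for a phase which grows like `η ^ (m + 3)`. -/
noncomputable def scaledJet (m : ℕ) (S : ℕ → ℝ → ℝ) (b : ℕ → ℝ → ℂ) (η : ℝ) : ℝ × ℝ × ℝ × ℂ × ℂ × ℂ :=
  (η ^ (m + 2) / S 1 η, S 2 η / η ^ (m + 1), S 3 η / η ^ m, b 0 η, η * b 1 η, (η : ℂ) ^ 2 * b 2 η)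

/-- `ibpRem` in terms of the rescaled derivatives. -/
noncomputable def scaledRem (u : ℝ × ℝ × ℝ × ℂ × ℂ × ℂ) : ℂ :=
  u.2.2.2.2.2 * (u.1 : ℂ) ^ 2 - 3 * u.2.2.2.2.1 * u.2.1 * (u.1 : ℂ) ^ 3
    - u.2.2.2.1 * u.2.2.1 * (u.1 : ℂ) ^ 3 + 3 * u.2.2.2.1 * (u.2.1 : ℂ) ^ 2 * (u.1 : ℂ) ^ 4

/-- The amplitude in `ibpPrim` in terms of the rescaled derivatives. -/
noncomputable def scaledPrim (v : ℝ × ℝ × ℝ × ℝ × ℂ × ℂ × ℂ) : ℂ :=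
  -Complex.I * v.2.2.2.2.1 * v.2.1 +
    v.1 * (v.2.2.2.2.2.1 * (v.2.1 : ℂ) ^ 2 - v.2.2.2.2.1 * v.2.2.1 * (v.2.1 : ℂ) ^ 3)

theorem contDiff_scaledRem : ContDiff ℝ 1 scaledRem := by
  unfold scaledRem
  have h : ContDiff ℝ 1 (fun x : ℝ => (x : ℂ)) := Complex.ofRealCLM.contDiff
  fun_prop

theorem contDiff_scaledPrim : ContDiff ℝ 1 scaledPrim := by
  unfold scaledPrim
  have h : ContDiff ℝ 1 (fun x : ℝ => (x : ℂ)) := Complex.ofRealCLM.contDiff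
  fun_prop

/-- Every term of `ibpRem` has the same weight when each differentiation costs one power of η. Using
η^(m+2)/S' rather than its inverse makes `scaledRem` a polynomial, hence Lipschitz on bounded sets.
-/
theorem ibpRem_eq_scaledRem (m : ℕ) (S : ℕ → ℝ → ℝ) (b : ℕ → ℝ → ℂ) {η : ℝ} (hη : 0 < η)
    (h1 : S 1 η ≠ 0) :
    ibpRem S b η = ((η ^ (2 * m + 6) : ℝ) : ℂ)⁻¹ * scaledRem (scaledJet m S b η) := by
  have h1' : (S 1 η : ℂ) ≠ 0 := by exact_mod_cast h1
  have h' : (η : ℂ) ≠ 0 := by exact_mod_cast hη.ne'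
  simp only [ibpRem, scaledRem, scaledJet]
  push_cast
  field_simp
  ring

/-- The boundary terms of the second integration are smaller by η^(-m-3); this factor is passed as
an extra coordinate so that `scaledPrim` is a fixed polynomial. -/
theorem ibpPrim_eq_scaledPrim (m : ℕ) (S : ℕ → ℝ → ℝ) (b : ℕ → ℝ → ℂ) {η : ℝ} (hη : 0 < η)
    (h1 : S 1 η ≠ 0) :
    ibpPrim S b η = Complex.exp (Complex.I * S 0 η) * (((η ^ (m + 2) : ℝ) : ℂ)⁻¹ *
      scaledPrim ((η ^ (m + 3))⁻¹, scaledJet m S b η)) := by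
  have h1' : (S 1 η : ℂ) ≠ 0 := by exact_mod_cast h1
  have h' : (η : ℂ) ≠ 0 := by exact_mod_cast hη.ne'
  simp only [ibpPrim, scaledPrim, scaledJet]
  push_cast
  field_simp
  ring

/-- This turns closeness of rescaled jets into closeness of `scaledRem` and `scaledPrim`, with
constants depending only on the size of the jets. -/
theorem exists_bound_lipschitz_of_contDiff {V : Type*} [NormedAddCommGroup V] [NormedSpace ℝ V]
    [ProperSpace V] {Q : V → ℂ} (hQ : ContDiff ℝ 1 Q) (R : ℝ) :
    ∃ L : ℝ, 0 ≤ L ∧ (∀ u u', ‖u‖ ≤ R → ‖u'‖ ≤ R → ‖Q u - Q u'‖ ≤ L * ‖u - u'‖) ∧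
      ∀ u, ‖u‖ ≤ R → ‖Q u‖ ≤ L := by
  obtain ⟨L₁, hL₁⟩ := hQ.contDiffOn.exists_lipschitzOnWith one_ne_zero
    (convex_closedBall (0 : V) R) (isCompact_closedBall (0 : V) R)
  obtain ⟨L₂, hL₂⟩ := (isCompact_closedBall (0 : V) R).exists_bound_of_continuousOn
    hQ.continuous.continuousOn
  refine ⟨max L₁ L₂, le_max_of_le_left L₁.2, fun u u' hu hu' => ?_, fun u hu => ?_⟩
  · have := hL₁.norm_sub_le (x := u) (y := u') (by simpa using hu) (by simpa using hu')
    exact this.trans (mul_le_mul_of_nonneg_right (le_max_left _ _) (norm_nonneg _))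
  · exact (hL₂ u (by simpa using hu)).trans (le_max_right _ _)

/-! ### Comparison of an oscillatory integral with its model. -/

/-- A phase which together with its derivatives behaves like `η ^ (m + 3)` for large `η`. -/
structure IsModelPhase (m : ℕ) (κ K M : ℝ) (S₀ : ℕ → ℝ → ℝ) : Prop where
  κ_pos : 0 < κ
  K_nonneg : 0 ≤ K
  one_le : 1 ≤ M
  jet : IsJet S₀ 4 univ
  bound : ∀ k ≤ 3, ∀ η ≥ 1, |S₀ k η| ≤ K * η ^ (m + 3 - k)
  lower : ∀ η ≥ M, κ * η ^ (m + 2) ≤ |S₀ 1 η|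

/-- On `[0, B]`, `B ∼ ε⁻¹`, the phase `S` and the amplitude `b` are `ε`-close to the model phase
`S₀` and the constant `b₀`, and the amplitude vanishes at `B`. -/
structure IsNearModel (m : ℕ) (κ K M ε B : ℝ) (S S₀ : ℕ → ℝ → ℝ) (b : ℕ → ℝ → ℂ) (b₀ : ℂ) :
    Prop where
  ε_pos : 0 < ε
  le_B : M ≤ B
  εB_le : ε * B ≤ K
  le_εB : 1 ≤ K * ε * B
  jetS : IsJet S 4 (Icc 0 B)
  jetb : IsJet b 3 (Icc 0 B)
  phase : ∀ k ≤ 3, ∀ η ∈ Icc 0 B, |S k η - S₀ k η| ≤ K * ε * (1 + η) ^ (m + 4 - k)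
  lower : ∀ η ∈ Icc M B, κ * η ^ (m + 2) ≤ |S 1 η|
  amp0 : ∀ η ∈ Icc 0 B, ‖b 0 η - b₀‖ ≤ K * ε * (1 + η)
  amp1 : ∀ η ∈ Icc 0 B, ‖b 1 η‖ ≤ K * ε
  amp2 : ∀ η ∈ Icc 0 B, ‖b 2 η‖ ≤ K * ε ^ 2
  amp : ‖b₀‖ ≤ K
  end0 : b 0 B = 0
  end1 : b 1 B = 0

/-- The jet of a constant amplitude. -/
noncomputable def constJet (b₀ : ℂ) (k : ℕ) (_ : ℝ) : ℂ := if k = 0 then b₀ else 0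

theorem isJet_constJet (b₀ : ℂ) (m : ℕ) (s : Set ℝ) : IsJet (constJet b₀) m s := by
  intro k _ η _
  have := hasDerivAt_const η (if k = 0 then b₀ else 0)
  rwa [show (0 : ℂ) = constJet b₀ (k + 1) η by simp [constJet]] at this

theorem IsModelPhase.norm_scaledJet_le {m : ℕ} {κ K M : ℝ} {S₀ : ℕ → ℝ → ℝ}
    (h : IsModelPhase m κ K M S₀) {b₀ : ℂ} (hb : ‖b₀‖ ≤ K) {η : ℝ} (hη : M ≤ η) :
    ‖scaledJet m S₀ (constJet b₀) η‖ ≤ 1 / κ + K := by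
  have h1 : 1 ≤ η := h.one_le.trans hη
  have h0 : 0 < η := by linarith
  have hκ := h.κ_pos
  have hK := h.K_nonneg
  have hl := h.lower η hη
  have hS : 0 < |S₀ 1 η| := lt_of_lt_of_le (by positivity) hl
  have k2 : |S₀ 2 η| ≤ K * η ^ (m + 1) := h.bound 2 (by norm_num) η h1
  have k3 : |S₀ 3 η| ≤ K * η ^ m := h.bound 3 (by norm_num) η h1
  have i : 0 ≤ 1 / κ := by positivity
  simp only [scaledJet, constJet, Prod.norm_def, sup_le_iff]
  refine ⟨?_, ?_, ?_, ?_, ?_, ?_⟩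
  · rw [norm_div, Real.norm_eq_abs, Real.norm_eq_abs, abs_of_pos (by positivity), div_le_iff₀ hS]
    have : 1 / κ * (κ * η ^ (m + 2)) ≤ 1 / κ * |S₀ 1 η| := by gcongr
    have e : 1 / κ * (κ * η ^ (m + 2)) = η ^ (m + 2) := by field_simp
    nlinarith
  · rw [norm_div, Real.norm_eq_abs, Real.norm_eq_abs, abs_of_pos (a := η ^ _) (by positivity),
      div_le_iff₀ (by positivity)]
    have : 0 ≤ 1 / κ * η ^ (m + 1) := by positivity
    linarith
  · rw [norm_div, Real.norm_eq_abs, Real.norm_eq_abs, abs_of_pos (a := η ^ _) (by positivity),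
      div_le_iff₀ (by positivity)]
    have : 0 ≤ 1 / κ * η ^ m := by positivity
    linarith
  · simp only [if_true]; linarith
  · simp only [one_ne_zero, if_false, mul_zero, norm_zero]; linarith
  · simp only [OfNat.ofNat_ne_zero, if_false, mul_zero, norm_zero]; linarith

/-- The relative error is of order εη: each derivative of the phase is off by a factor εη of its own
size, and each derivative of the amplitude brings a power of ε. -/
theorem IsNearModel.norm_scaledJet_sub_le {m : ℕ} {κ K M ε B : ℝ} {S S₀ : ℕ → ℝ → ℝ}
    {b : ℕ → ℝ → ℂ} {b₀ : ℂ} (h₀ : IsModelPhase m κ K M S₀)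
    (h : IsNearModel m κ K M ε B S S₀ b b₀) {η : ℝ} (hη : η ∈ Icc M B) :
    ‖scaledJet m S b η - scaledJet m S₀ (constJet b₀) η‖ ≤
      (2 ^ (m + 4) * K + 2 ^ (m + 4) * K / κ ^ 2 + 2 * K + K ^ 2) * (ε * η) := by
  have h1 : 1 ≤ η := h₀.one_le.trans hη.1
  have h0 : 0 < η := by linarith
  have hκ := h₀.κ_pos
  have hK := h₀.K_nonneg
  have hε := h.ε_pos
  have hl₀ := h₀.lower η hη.1
  have hl := h.lower η hη
  have hS₀ : 0 < |S₀ 1 η| := lt_of_lt_of_le (by positivity) hl₀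
  have hS : 0 < |S 1 η| := lt_of_lt_of_le (by positivity) hl
  have hη' : η ∈ Icc 0 B := ⟨h0.le, hη.2⟩
  have key : ∀ j, j ≤ m + 3 → (1 + η) ^ (j + 1) ≤ 2 ^ (m + 4) * (η * η ^ j) := by
    intro j hj
    calc (1 + η) ^ (j + 1) ≤ (2 * η) ^ (j + 1) := by gcongr; linarith
      _ = 2 ^ (j + 1) * (η * η ^ j) := by rw [mul_pow]; ring
      _ ≤ _ := mul_le_mul_of_nonneg_right (pow_le_pow_right₀ one_le_two (by omega)) (by positivity)
  have k1 : |S 1 η - S₀ 1 η| ≤ 2 ^ (m + 4) * K * (ε * η) * η ^ (m + 2) := by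
    have := h.phase 1 (by norm_num) η hη'
    have e := key (m + 2) (by omega)
    calc _ ≤ K * ε * (1 + η) ^ (m + 3) := this
      _ ≤ K * ε * (2 ^ (m + 4) * (η * η ^ (m + 2))) := by gcongr
      _ = _ := by ring
  have k2 : |S 2 η - S₀ 2 η| ≤ 2 ^ (m + 4) * K * (ε * η) * η ^ (m + 1) := by
    have := h.phase 2 (by norm_num) η hη'
    have e := key (m + 1) (by omega)
    calc _ ≤ K * ε * (1 + η) ^ (m + 2) := this
      _ ≤ K * ε * (2 ^ (m + 4) * (η * η ^ (m + 1))) := by gcongr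
      _ = _ := by ring
  have k3 : |S 3 η - S₀ 3 η| ≤ 2 ^ (m + 4) * K * (ε * η) * η ^ m := by
    have := h.phase 3 (by norm_num) η hη'
    have e := key m (by omega)
    calc _ ≤ K * ε * (1 + η) ^ (m + 1) := this
      _ ≤ K * ε * (2 ^ (m + 4) * (η * η ^ m)) := by gcongr
      _ = _ := by ring
  have p : 0 ≤ ε * η := by positivity
  have t1 : 0 ≤ 2 ^ (m + 4) * K := by positivity
  have t2 : 0 ≤ 2 ^ (m + 4) * K / κ ^ 2 := by positivity
  have t4 : 0 ≤ K ^ 2 := by positivity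
  have mono : ∀ {r c : ℝ}, r ≤ c * (ε * η) → c ≤ (2 ^ (m + 4) * K + 2 ^ (m + 4) * K / κ ^ 2 +
      2 * K + K ^ 2) → r ≤ (2 ^ (m + 4) * K + 2 ^ (m + 4) * K / κ ^ 2 + 2 * K + K ^ 2) * (ε * η) :=
    fun h1 h2 => h1.trans (mul_le_mul_of_nonneg_right h2 p)
  simp only [scaledJet, constJet, Prod.mk_sub_mk, Prod.norm_def, sup_le_iff]
  refine ⟨?_, ?_, ?_, ?_, ?_, ?_⟩
  -- A difference of reciprocals: both denominators are at least κη^(m+2), whence κ^(-2).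
  · refine mono (c := 2 ^ (m + 4) * K / κ ^ 2) ?_ (by linarith)
    have e : η ^ (m + 2) / S 1 η - η ^ (m + 2) / S₀ 1 η =
        η ^ (m + 2) * (S₀ 1 η - S 1 η) / (S 1 η * S₀ 1 η) := by
      have := abs_pos.1 hS; have := abs_pos.1 hS₀
      field_simp
    rw [e, norm_div, norm_mul, norm_mul, Real.norm_eq_abs, Real.norm_eq_abs, Real.norm_eq_abs,
      Real.norm_eq_abs, abs_of_pos (a := η ^ _) (by positivity), div_le_iff₀ (by positivity),
      abs_sub_comm]
    calc η ^ (m + 2) * |S 1 η - S₀ 1 η| ≤ η ^ (m + 2) * (2 ^ (m + 4) * K * (ε * η) * η ^ (m + 2)) := by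
          gcongr
      _ = 2 ^ (m + 4) * K / κ ^ 2 * (ε * η) * ((κ * η ^ (m + 2)) * (κ * η ^ (m + 2))) := by
          field_simp
      _ ≤ _ := by gcongr
  · refine mono (c := 2 ^ (m + 4) * K) ?_ (by linarith)
    rw [← sub_div, norm_div, Real.norm_eq_abs, Real.norm_eq_abs, abs_of_pos (a := η ^ _)
      (by positivity), div_le_iff₀ (by positivity)]
    exact k2
  · refine mono (c := 2 ^ (m + 4) * K) ?_ (by linarith)
    rw [← sub_div, norm_div, Real.norm_eq_abs, Real.norm_eq_abs, abs_of_pos (a := η ^ _)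
      (by positivity), div_le_iff₀ (by positivity)]
    exact k3
  · refine mono (c := 2 * K) ?_ (by linarith)
    have := h.amp0 η hη'
    simp only [if_true]
    calc _ ≤ K * ε * (1 + η) := this
      _ ≤ K * ε * (2 * η) := by gcongr; linarith
      _ = _ := by ring
  · refine mono (c := K) ?_ (by linarith)
    have := h.amp1 η hη'
    simp only [one_ne_zero, if_false, mul_zero, sub_zero, norm_mul, Complex.norm_real,
      Real.norm_eq_abs, abs_of_pos h0]
    calc η * ‖b 1 η‖ ≤ η * (K * ε) := by gcongr
      _ = _ := by ring
  -- The bound is quadratic in εη; one factor is absorbed by εη ≤ εB ≤ K.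
  · refine mono (c := K ^ 2) ?_ (by linarith)
    have := h.amp2 η hη'
    have e := h.εB_le
    simp only [OfNat.ofNat_ne_zero, if_false, mul_zero, sub_zero, norm_mul, norm_pow,
      Complex.norm_real, Real.norm_eq_abs, abs_of_pos h0]
    calc η ^ 2 * ‖b 2 η‖ ≤ η ^ 2 * (K * ε ^ 2) := by gcongr
      _ = K * (ε * η) * (ε * η) := by ring
      _ ≤ K * (ε * B) * (ε * η) := by gcongr; exact hη.2
      _ ≤ K * K * (ε * η) := by gcongr
      _ = _ := by ring

theorem norm_exp_I_mul_sub_le (s t : ℝ) :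
    ‖Complex.exp (Complex.I * s) - Complex.exp (Complex.I * t)‖ ≤ |s - t| := by
  have e : Complex.exp (Complex.I * s) - Complex.exp (Complex.I * t) =
      Complex.exp (Complex.I * t) * (Complex.exp (Complex.I * (s - t : ℝ)) - 1) := by
    rw [mul_sub, ← Complex.exp_add]; push_cast; ring_nf
  rw [e, norm_mul, Complex.norm_exp_I_mul_ofReal, one_mul]
  exact Real.norm_exp_I_mul_ofReal_sub_one_le

theorem norm_exp_I_mul_mul_sub_le (s t : ℝ) (p q : ℂ) :
    ‖Complex.exp (Complex.I * s) * p - Complex.exp (Complex.I * t) * q‖ ≤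
      |s - t| * ‖q‖ + ‖p - q‖ := by
  have e : Complex.exp (Complex.I * s) * p - Complex.exp (Complex.I * t) * q =
      (Complex.exp (Complex.I * s) - Complex.exp (Complex.I * t)) * q
        + Complex.exp (Complex.I * s) * (p - q) := by ring
  rw [e]
  refine (norm_add_le _ _).trans ?_
  rw [norm_mul, norm_mul, Complex.norm_exp_I_mul_ofReal, one_mul]
  gcongr
  exact norm_exp_I_mul_sub_le s t

theorem integral_inv_sq_le {α β : ℝ} (hα : 1 ≤ α) (hαβ : α ≤ β) :
    (∫ η in α..β, (η ^ 2)⁻¹) ≤ 1 := by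
  have e : ∀ η ∈ uIcc α β, HasDerivAt (fun η : ℝ => -η⁻¹) ((η ^ 2)⁻¹) η := by
    intro η hη
    rw [uIcc_of_le hαβ] at hη
    simpa using (hasDerivAt_inv (by linarith [hη.1] : η ≠ 0)).fun_neg
  rw [intervalIntegral.integral_eq_sub_of_hasDerivAt e]
  · have : 0 ≤ β⁻¹ := by have : 0 ≤ β := by linarith
                         positivity
    have : α⁻¹ ≤ 1 := inv_le_one_of_one_le₀ hα
    linarith
  · refine ContinuousOn.intervalIntegrable (ContinuousOn.inv₀ (by fun_prop) ?_)
    intro η hη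
    rw [uIcc_of_le hαβ] at hη
    have : 0 < η := by linarith [hη.1]
    positivity

theorem norm_integral_le_of_norm_le_inv_sq {f : ℝ → ℂ} {α β c : ℝ} (hα : 1 ≤ α) (hαβ : α ≤ β)
    (hc : 0 ≤ c) (hf : ∀ η ∈ Icc α β, ‖f η‖ ≤ c * (η ^ 2)⁻¹) : ‖∫ η in α..β, f η‖ ≤ c := by
  have hi : IntervalIntegrable (fun η : ℝ => c * (η ^ 2)⁻¹) volume α β := by
    refine ContinuousOn.intervalIntegrable (ContinuousOn.mul (by fun_prop)
      (ContinuousOn.inv₀ (by fun_prop) ?_))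
    intro η hη
    rw [uIcc_of_le hαβ] at hη
    have : 0 < η := by linarith [hη.1]
    positivity
  refine (intervalIntegral.norm_integral_le_of_norm_le hαβ
    (Eventually.of_forall fun η hη => hf η ⟨hη.1.le, hη.2⟩) hi).trans ?_
  rw [intervalIntegral.integral_const_mul]
  exact mul_le_of_le_one_right hc (integral_inv_sq_le hα hαβ)

theorem IsModelPhase.mono {m : ℕ} {κ K K' M : ℝ} {S₀ : ℕ → ℝ → ℝ} (h : IsModelPhase m κ K M S₀)
    (hK : K ≤ K') : IsModelPhase m κ K' M S₀ where
  κ_pos := h.κ_pos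
  K_nonneg := h.K_nonneg.trans hK
  one_le := h.one_le
  jet := h.jet
  bound := fun k hk η hη => (h.bound k hk η hη).trans
    (mul_le_mul_of_nonneg_right hK (pow_nonneg (by linarith) _))
  lower := h.lower

theorem IsModelPhase.ne_zero {m : ℕ} {κ K M : ℝ} {S₀ : ℕ → ℝ → ℝ} (h : IsModelPhase m κ K M S₀)
    {η : ℝ} (hη : M ≤ η) : S₀ 1 η ≠ 0 := by
  have : 0 < η := by linarith [h.one_le]
  have := h.κ_pos
  exact abs_pos.1 (lt_of_lt_of_le (by positivity) (h.lower η hη))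

theorem IsNearModel.ne_zero {m : ℕ} {κ K M ε B : ℝ} {S S₀ : ℕ → ℝ → ℝ}
    {b : ℕ → ℝ → ℂ} {b₀ : ℂ} (h₀ : IsModelPhase m κ K M S₀)
    (h : IsNearModel m κ K M ε B S S₀ b b₀) {η : ℝ} (hη : η ∈ Icc M B) : S 1 η ≠ 0 := by
  have : 0 < η := by linarith [h₀.one_le, hη.1]
  have := h₀.κ_pos
  exact abs_pos.1 (lt_of_lt_of_le (by positivity) (h.lower η hη))

theorem inv_pow_le_inv_sq {η : ℝ} (hη : 1 ≤ η) {j : ℕ} (hj : 2 ≤ j) :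
    (η ^ j)⁻¹ ≤ (η ^ 2)⁻¹ :=
  inv_anti₀ (by positivity) (pow_le_pow_right₀ hη hj)

theorem norm_prodMk_le_max {V : Type*} [NormedAddCommGroup V] {t R : ℝ} {u : V} (h0 : 0 ≤ t)
    (h1 : t ≤ 1) (hu : ‖u‖ ≤ R) (hR : 1 ≤ R) : ‖(t, u)‖ ≤ R := by
  rw [Prod.norm_def]
  refine max_le ?_ hu
  simp only [Real.norm_eq_abs, abs_of_nonneg h0]
  linarith

/-- The rescaled jet of a model stays in a fixed ball, so `L` depends on m, κ, K only and is uniform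
over models. -/
theorem exists_norm_ibp_le (m : ℕ) (κ K : ℝ) :
    ∃ L : ℝ, 0 ≤ L ∧ ∀ (M : ℝ) (S₀ : ℕ → ℝ → ℝ) (b₀ : ℂ), IsModelPhase m κ K M S₀ → ‖b₀‖ ≤ K →
      ∀ η ≥ M, ‖ibpRem S₀ (constJet b₀) η‖ ≤ L * (η ^ (2 * m + 6))⁻¹ ∧
        ‖ibpPrim S₀ (constJet b₀) η‖ ≤ L * (η ^ (m + 2))⁻¹ := by
  obtain ⟨L₁, hL₁, -, h₁⟩ := exists_bound_lipschitz_of_contDiff contDiff_scaledRem (1 / κ + K)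
  obtain ⟨L₂, hL₂, -, h₂⟩ :=
    exists_bound_lipschitz_of_contDiff contDiff_scaledPrim (1 / κ + K + 1)
  refine ⟨L₁ + L₂, by positivity, fun M S₀ b₀ h hb η hη => ?_⟩
  have h1 : 1 ≤ η := h.one_le.trans hη
  have h0 : 0 < η := by linarith
  have hκ := h.κ_pos
  have hK := h.K_nonneg
  have hu := h.norm_scaledJet_le hb hη
  have hne := h.ne_zero hη
  constructor
  · rw [ibpRem_eq_scaledRem m _ _ h0 hne, norm_mul, norm_inv, Complex.norm_real, Real.norm_eq_abs,
      abs_of_pos (by positivity), mul_comm]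
    gcongr
    exact (h₁ _ hu).trans (by linarith)
  · rw [ibpPrim_eq_scaledPrim m _ _ h0 hne, norm_mul, norm_mul, norm_inv, Complex.norm_real,
      Real.norm_eq_abs, abs_of_pos (by positivity), mul_comm, Complex.norm_exp_I_mul_ofReal, mul_one,
      mul_comm]
    gcongr
    have hp : 0 ≤ 1 / κ := by positivity
    refine (h₂ _ (norm_prodMk_le_max (by positivity) ?_ (hu.trans (by linarith))
      (by linarith))).trans (by linarith)
    exact inv_le_one_of_one_le₀ (one_le_pow₀ h1)

/-- Convergence of the improper integral of a model phase. -/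
theorem IsModelPhase.exists_tendsto {m : ℕ} {κ K M : ℝ} {S₀ : ℕ → ℝ → ℝ}
    (h : IsModelPhase m κ K M S₀) :
    ∃ J : ℂ, Tendsto (fun R : ℝ => ∫ η in (0 : ℝ)..R, Complex.exp (Complex.I * S₀ 0 η)) atTop
      (𝓝 J) := by
  have h' := h.mono (le_max_left K 1)
  obtain ⟨L, hL, hb⟩ := exists_norm_ibp_le m κ (max K 1)
  have hb := hb M S₀ 1 h' (by simp)
  have hM := h.one_le
  have hjet : ∀ s, IsJet S₀ 4 s := fun s => h.jet.mono le_rfl (subset_univ s)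
  have hcst : ∀ s, IsJet (constJet 1) 3 s := fun s => isJet_constJet 1 3 s
  set G : ℝ → ℂ := fun η => Complex.exp (Complex.I * S₀ 0 η) * ibpRem S₀ (constJet 1) η with hG
  have hcont : ContinuousOn G (Ici M) :=
    continuousOn_exp_mul_ibpRem (hjet _) (hcst _) fun η hη => h.ne_zero hη
  have hint : IntegrableOn G (Ioi M) := by
    have hi : IntegrableOn (fun η : ℝ => L * η ^ (-2 : ℝ)) (Ioi M) :=
      (integrableOn_Ioi_rpow_of_lt (by norm_num) (by linarith)).const_mul L
    refine Integrable.mono' hi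
      ((hcont.mono Ioi_subset_Ici_self).aestronglyMeasurable measurableSet_Ioi) ?_
    refine (ae_restrict_iff' measurableSet_Ioi).2 (Eventually.of_forall fun η hη => ?_)
    have hη1 : 1 ≤ η := hM.trans (le_of_lt hη)
    rw [hG, norm_mul, Complex.norm_exp_I_mul_ofReal, one_mul, Real.rpow_neg (by linarith), Real.rpow_two]
    refine (hb η (le_of_lt hη)).1.trans ?_
    exact mul_le_mul_of_nonneg_left (inv_pow_le_inv_sq hη1 (by omega)) hL
  have t1 : Tendsto (fun R => ibpPrim S₀ (constJet 1) R) atTop (𝓝 0) := by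
    refine squeeze_zero_norm' (a := fun R : ℝ => L * R⁻¹) ?_ ?_
    · filter_upwards [eventually_ge_atTop M] with R hR
      have hR1 : 1 ≤ R := hM.trans hR
      refine (hb R hR).2.trans ?_
      gcongr
      exact le_self_pow₀ hR1 (by omega)
    · simpa using tendsto_inv_atTop_zero.const_mul L
  have t2 := intervalIntegral_tendsto_integral_Ioi M hint (l := atTop) tendsto_id
  refine ⟨(∫ η in (0 : ℝ)..M, Complex.exp (Complex.I * S₀ 0 η)) +
    (0 - ibpPrim S₀ (constJet 1) M - ∫ η in Ioi M, G η), ?_⟩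
  refine Tendsto.congr' ?_ (tendsto_const_nhds.add ((t1.sub tendsto_const_nhds).sub t2))
  filter_upwards [eventually_ge_atTop M] with R hR
  have := integral_exp_mul_eq hR (hjet _) (hcst _) fun η hη => h.ne_zero hη.1
  have hc : ∀ α β : ℝ, IntervalIntegrable (fun η => Complex.exp (Complex.I * S₀ 0 η)) volume α β := by
    intro α β
    have := continuousOn_exp_mul (hjet univ) (hcst univ)
    rw [continuousOn_univ] at this
    simp only [constJet, if_true, mul_one] at this
    exact this.intervalIntegrable _ _
  rw [← intervalIntegral.integral_add_adjacent_intervals (hc 0 M) (hc M R)]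
  simp only [hG, id]
  rw [← this]
  simp [constJet]

/-- Two errors add up: the phase error εη^(m+4) multiplies a remainder of size η^(-2m-6), and the
remainders themselves differ by a factor εη. Both are bounded by a multiple of ε η^(-2), the first
sharply when m = 0. -/
theorem exists_norm_ibp_sub_le (m : ℕ) (κ K M : ℝ) :
    ∃ L : ℝ, 0 ≤ L ∧ ∀ (ε B : ℝ) (S S₀ : ℕ → ℝ → ℝ) (b : ℕ → ℝ → ℂ) (b₀ : ℂ),
      IsModelPhase m κ K M S₀ → IsNearModel m κ K M ε B S S₀ b b₀ →
      (∀ η ∈ Icc M B, ‖Complex.exp (Complex.I * S 0 η) * ibpRem S b η -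
        Complex.exp (Complex.I * S₀ 0 η) * ibpRem S₀ (constJet b₀) η‖ ≤ L * ε * (η ^ 2)⁻¹) ∧
      ‖ibpPrim S b M - ibpPrim S₀ (constJet b₀) M‖ ≤ L * ε := by
  set D : ℝ := 2 ^ (m + 4) * K + 2 ^ (m + 4) * K / κ ^ 2 + 2 * K + K ^ 2 with hD
  -- The radius covers the model jet (1/κ + K), its perturbation (DK, since εη ≤ K) and the extra
  -- coordinate of `scaledPrim`, at most 1.
  obtain ⟨L₁, hL₁, hl₁, h₁⟩ :=
    exists_bound_lipschitz_of_contDiff contDiff_scaledRem (1 / κ + K + D * K + 1)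
  obtain ⟨L₂, hL₂, hl₂, h₂⟩ :=
    exists_bound_lipschitz_of_contDiff contDiff_scaledPrim (1 / κ + K + D * K + 1)
  by_cases hpos : 0 < κ ∧ 0 ≤ K ∧ 1 ≤ M
  swap
  · exact ⟨0, le_rfl, fun ε B S S₀ b b₀ h => absurd ⟨h.κ_pos, h.K_nonneg, h.one_le⟩ hpos⟩
  obtain ⟨hκ, hK, hM⟩ := hpos
  have hD0 : 0 ≤ D := by positivity
  have hM0 : 0 ≤ M := by linarith
  refine ⟨2 ^ (m + 4) * K * L₁ + L₁ * D + (K * (1 + M) ^ (m + 4) * L₂ + L₂ * (D * M)),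
    by positivity, fun ε B S S₀ b b₀ h₀ h => ?_⟩
  have hε := h.ε_pos
  have base : ∀ η ∈ Icc M B, 1 ≤ η ∧ 0 < η ∧ η ∈ Icc 0 B ∧
      ‖scaledJet m S₀ (constJet b₀) η‖ ≤ 1 / κ + K + D * K + 1 ∧
      ‖scaledJet m S b η‖ ≤ 1 / κ + K + D * K + 1 ∧
      ‖scaledJet m S b η - scaledJet m S₀ (constJet b₀) η‖ ≤ D * (ε * η) := by
    intro η hη
    have h1 : 1 ≤ η := hM.trans hη.1
    have u0 := h₀.norm_scaledJet_le h.amp hη.1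
    have ud := h.norm_scaledJet_sub_le h₀ hη
    have hDK : D * (ε * η) ≤ D * K := by
      have : ε * η ≤ ε * B := by gcongr; exact hη.2
      exact mul_le_mul_of_nonneg_left (this.trans h.εB_le) hD0
    have hDK' : 0 ≤ D * K := by positivity
    refine ⟨h1, by linarith, ⟨by linarith, hη.2⟩, by linarith, ?_, ud⟩
    have := norm_le_insert' (scaledJet m S b η) (scaledJet m S₀ (constJet b₀) η)
    linarith
  constructor
  · intro η hη
    obtain ⟨h1, h0, hη', u0, u, ud⟩ := base η hη
    refine (norm_exp_I_mul_mul_sub_le _ _ _ _).trans ?_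
    rw [ibpRem_eq_scaledRem m _ _ h0 (h.ne_zero h₀ hη), ibpRem_eq_scaledRem m _ _ h0 (h₀.ne_zero hη.1),
      ← mul_sub, norm_mul, norm_mul, norm_inv, Complex.norm_real, Real.norm_eq_abs,
      abs_of_pos (a := η ^ (2 * m + 6)) (by positivity)]
    have p := h.phase 0 (by norm_num) η hη'
    have p' : |S 0 η - S₀ 0 η| ≤ K * ε * (2 ^ (m + 4) * η ^ (m + 4)) := by
      refine p.trans ?_
      rw [← mul_pow, Nat.sub_zero]
      gcongr
      linarith
    have q := hl₁ _ _ u u0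
    have q0 := h₁ _ u0
    have i1 : η ^ (m + 4) * (η ^ (2 * m + 6))⁻¹ ≤ (η ^ 2)⁻¹ := by
      have : η ^ (m + 4) * (η ^ (2 * m + 6))⁻¹ = (η ^ (m + 2))⁻¹ := by
        field_simp
        ring
      rw [this]
      exact inv_pow_le_inv_sq h1 (by omega)
    have i2 : η * (η ^ (2 * m + 6))⁻¹ ≤ (η ^ 2)⁻¹ := by
      have : η * (η ^ (2 * m + 6))⁻¹ = (η ^ (2 * m + 5))⁻¹ := by
        field_simp
        ring
      rw [this]
      exact inv_pow_le_inv_sq h1 (by omega)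
    calc |S 0 η - S₀ 0 η| * ((η ^ (2 * m + 6))⁻¹ * ‖scaledRem (scaledJet m S₀ (constJet b₀) η)‖)
          + (η ^ (2 * m + 6))⁻¹ * ‖scaledRem (scaledJet m S b η) -
            scaledRem (scaledJet m S₀ (constJet b₀) η)‖
        ≤ K * ε * (2 ^ (m + 4) * η ^ (m + 4)) * ((η ^ (2 * m + 6))⁻¹ * L₁) +
          (η ^ (2 * m + 6))⁻¹ * (L₁ * (D * (ε * η))) := by
          gcongr
          exact q.trans (by gcongr)
      _ = 2 ^ (m + 4) * K * L₁ * ε * (η ^ (m + 4) * (η ^ (2 * m + 6))⁻¹) +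
          L₁ * D * ε * (η * (η ^ (2 * m + 6))⁻¹) := by ring
      _ ≤ 2 ^ (m + 4) * K * L₁ * ε * (η ^ 2)⁻¹ + L₁ * D * ε * (η ^ 2)⁻¹ := by gcongr
      _ = (2 ^ (m + 4) * K * L₁ + L₁ * D) * ε * (η ^ 2)⁻¹ := by ring
      _ ≤ _ := by
          refine mul_le_mul_of_nonneg_right (mul_le_mul_of_nonneg_right ?_ hε.le) (by positivity)
          have : 0 ≤ K * (1 + M) ^ (m + 4) * L₂ + L₂ * (D * M) := by positivity
          linarith
  · have hη : M ∈ Icc M B := ⟨le_rfl, h.le_B⟩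
    obtain ⟨h1, h0, hη', u0, u, ud⟩ := base M hη
    rw [ibpPrim_eq_scaledPrim m _ _ h0 (h.ne_zero h₀ hη),
      ibpPrim_eq_scaledPrim m _ _ h0 (h₀.ne_zero hη.1)]
    refine (norm_exp_I_mul_mul_sub_le _ _ _ _).trans ?_
    rw [← mul_sub, norm_mul, norm_mul, norm_inv, Complex.norm_real, Real.norm_eq_abs,
      abs_of_pos (a := M ^ (m + 2)) (by positivity)]
    have ht : (M ^ (m + 3))⁻¹ ≤ 1 := inv_le_one_of_one_le₀ (one_le_pow₀ h1)
    have hi : (M ^ (m + 2))⁻¹ ≤ 1 := inv_le_one_of_one_le₀ (one_le_pow₀ h1)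
    have hR : 1 ≤ 1 / κ + K + D * K + 1 := by
      have : 0 ≤ 1 / κ + K + D * K := by positivity
      linarith
    have p := h.phase 0 (by norm_num) M hη'
    have q := hl₂ _ _ (norm_prodMk_le_max (by positivity) ht u hR)
      (norm_prodMk_le_max (by positivity) ht u0 hR)
    have q0 := h₂ _ (norm_prodMk_le_max (by positivity) ht u0 hR)
    rw [Prod.mk_sub_mk, sub_self, Prod.norm_def, norm_zero, max_eq_right (norm_nonneg _)] at q
    calc _ ≤ K * ε * (1 + M) ^ (m + 4) * (1 * L₂) + 1 * (L₂ * (D * (ε * M))) := by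
          gcongr
          · exact p
          · exact q.trans (by gcongr)
      _ = (K * (1 + M) ^ (m + 4) * L₂ + L₂ * (D * M)) * ε := by ring
      _ ≤ _ := by
          refine mul_le_mul_of_nonneg_right ?_ hε.le
          have : 0 ≤ 2 ^ (m + 4) * K * L₁ + L₁ * D := by positivity
          linarith

/-- The integral over `[0, B]` of an oscillating exponential `ε`-close to a model one is
`ε`-close to the improper integral of the model. -/
theorem exists_norm_integral_sub_le (m : ℕ) (κ K M : ℝ) :
    ∃ K' : ℝ, ∀ (ε B : ℝ) (S S₀ : ℕ → ℝ → ℝ) (b : ℕ → ℝ → ℂ) (b₀ J : ℂ),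
      IsModelPhase m κ K M S₀ → IsNearModel m κ K M ε B S S₀ b b₀ →
      Tendsto (fun R : ℝ => ∫ η in (0 : ℝ)..R, Complex.exp (Complex.I * S₀ 0 η)) atTop (𝓝 J) →
      ‖(∫ η in (0 : ℝ)..B, Complex.exp (Complex.I * S 0 η) * b 0 η) - b₀ * J‖ ≤ K' * ε := by
  obtain ⟨L, hL, hl⟩ := exists_norm_ibp_sub_le m κ K M
  obtain ⟨L', hL', hl'⟩ := exists_norm_ibp_le m κ K
  refine ⟨(K * (1 + M) ^ (m + 4) * K + K * (1 + M)) * M + L + L + L' * K, ?_⟩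
  intro ε B S S₀ b b₀ J h₀ h hJ
  have hε := h.ε_pos
  have hK := h₀.K_nonneg
  have hM := h₀.one_le
  have hM0 : 0 ≤ M := by linarith
  have hMB := h.le_B
  have hB0 : 0 < B := by linarith
  obtain ⟨hrem, hprim⟩ := hl ε B S S₀ b b₀ h₀ h
  have hmod := hl' M S₀ b₀ h₀ h.amp
  have hj0 : ∀ s, IsJet S₀ 4 s := fun s => h₀.jet.mono le_rfl (subset_univ s)
  have hc0 : ∀ s, IsJet (constJet b₀) 3 s := fun s => isJet_constJet b₀ 3 s
  set f : ℝ → ℂ := fun η => Complex.exp (Complex.I * S 0 η) * b 0 η with hf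
  set f₀ : ℝ → ℂ := fun η => Complex.exp (Complex.I * S₀ 0 η) * constJet b₀ 0 η with hf₀
  set G : ℝ → ℂ := fun η => Complex.exp (Complex.I * S 0 η) * ibpRem S b η with hG
  set G₀ : ℝ → ℂ := fun η => Complex.exp (Complex.I * S₀ 0 η) * ibpRem S₀ (constJet b₀) η with hG₀
  have if₀ : ∀ α β, IntervalIntegrable f₀ volume α β := fun α β =>
    (continuousOn_univ.1 (continuousOn_exp_mul (hj0 univ) (hc0 univ))).intervalIntegrable _ _
  have hfc : ContinuousOn f (Icc 0 B) := continuousOn_exp_mul h.jetS h.jetb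
  have if1 : IntervalIntegrable f volume 0 M := ContinuousOn.intervalIntegrable <| by
    rw [uIcc_of_le hM0]; exact hfc.mono (Icc_subset_Icc le_rfl hMB)
  have if2 : IntervalIntegrable f volume M B := ContinuousOn.intervalIntegrable <| by
    rw [uIcc_of_le hMB]; exact hfc.mono (Icc_subset_Icc hM0 le_rfl)
  have iG₀ : ∀ α β, M ≤ α → α ≤ β → IntervalIntegrable G₀ volume α β := fun α β hα hαβ =>
    ContinuousOn.intervalIntegrable <| by
      rw [uIcc_of_le hαβ]
      exact continuousOn_exp_mul_ibpRem (hj0 _) (hc0 _) fun η hη => h₀.ne_zero (hα.trans hη.1)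
  have iG : IntervalIntegrable G volume M B := ContinuousOn.intervalIntegrable <| by
    rw [uIcc_of_le hMB]
    exact continuousOn_exp_mul_ibpRem (h.jetS.mono le_rfl (Icc_subset_Icc hM0 le_rfl))
      (h.jetb.mono le_rfl (Icc_subset_Icc hM0 le_rfl)) fun η hη => h.ne_zero h₀ hη
  have hend : ibpPrim S b B = 0 := by simp [ibpPrim, h.end0, h.end1]
  have e1 : ∫ η in M..B, f η = ibpPrim S b B - ibpPrim S b M - ∫ η in M..B, G η :=
    integral_exp_mul_eq hMB (h.jetS.mono le_rfl (Icc_subset_Icc hM0 le_rfl))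
      (h.jetb.mono le_rfl (Icc_subset_Icc hM0 le_rfl)) fun η hη => h.ne_zero h₀ hη
  have bmid : ‖∫ η in (0 : ℝ)..M, (f η - f₀ η)‖ ≤
      (K * (1 + M) ^ (m + 4) * K + K * (1 + M)) * ε * |M - 0| := by
    refine intervalIntegral.norm_integral_le_of_norm_le_const fun η hη => ?_
    rw [uIoc_of_le hM0] at hη
    have hη' : η ∈ Icc 0 B := ⟨hη.1.le, hη.2.trans hMB⟩
    have h0 : 0 ≤ η := hη.1.le
    refine (norm_exp_I_mul_mul_sub_le _ _ _ _).trans ?_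
    have p := h.phase 0 (by norm_num) η hη'
    have q := h.amp0 η hη'
    have q0 := h.amp
    simp only [constJet, if_true]
    calc _ ≤ K * ε * (1 + η) ^ (m + 4) * K + K * ε * (1 + η) := by gcongr; exact p
      _ ≤ K * ε * (1 + M) ^ (m + 4) * K + K * ε * (1 + M) := by gcongr <;> exact hη.2
      _ = _ := by ring
  have bG : ‖∫ η in M..B, (G η - G₀ η)‖ ≤ L * ε :=
    norm_integral_le_of_norm_le_inv_sq hM hMB (by positivity) hrem
  -- The model is cut off at R ≥ B. Its part over [B, R] is O(ε) because η⁻¹ ≤ Kε there; the only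
  -- bound depending on R is that of the boundary term, which disappears as R tends to infinity.
  have key : ∀ R, B ≤ R → ‖(∫ η in (0 : ℝ)..B, f η) - ∫ η in (0 : ℝ)..R, f₀ η‖ ≤
      ((K * (1 + M) ^ (m + 4) * K + K * (1 + M)) * M + L + L + L' * K) * ε + L' * R⁻¹ := by
    intro R hR
    have hR1 : 1 ≤ R := by linarith
    have e2 : ∫ η in M..R, f₀ η = ibpPrim S₀ (constJet b₀) R - ibpPrim S₀ (constJet b₀) M -
        ∫ η in M..R, G₀ η :=
      integral_exp_mul_eq (hMB.trans hR) (hj0 _) (hc0 _) fun η hη => h₀.ne_zero hη.1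
    have bR : ‖ibpPrim S₀ (constJet b₀) R‖ ≤ L' * R⁻¹ := by
      refine (hmod R (hMB.trans hR)).2.trans ?_
      gcongr
      exact le_self_pow₀ hR1 (by omega)
    have btail : ‖∫ η in B..R, G₀ η‖ ≤ L' * (K * ε) := by
      refine norm_integral_le_of_norm_le_inv_sq (by linarith) hR (by positivity) fun η hη => ?_
      have hη1 : 1 ≤ η := by linarith [hη.1]
      have hη0 : 0 < η := by linarith
      rw [hG₀, norm_mul, Complex.norm_exp_I_mul_ofReal, one_mul]
      refine (hmod η (hMB.trans hη.1)).1.trans ?_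
      have i1 : η⁻¹ ≤ K * ε := by
        rw [inv_le_iff_one_le_mul₀ hη0]
        exact h.le_εB.trans (by gcongr; exact hη.1)
      have i2 : (η ^ (2 * m + 6))⁻¹ ≤ η⁻¹ * (η ^ 2)⁻¹ := by
        rw [← mul_inv, ← pow_succ']
        exact inv_anti₀ (by positivity) (pow_le_pow_right₀ hη1 (by omega))
      calc L' * (η ^ (2 * m + 6))⁻¹ ≤ L' * (η⁻¹ * (η ^ 2)⁻¹) := by gcongr
        _ ≤ L' * (K * ε * (η ^ 2)⁻¹) := by gcongr
        _ = _ := by ring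
    have eq : (∫ η in (0 : ℝ)..B, f η) - ∫ η in (0 : ℝ)..R, f₀ η =
        (∫ η in (0 : ℝ)..M, (f η - f₀ η)) - (ibpPrim S b M - ibpPrim S₀ (constJet b₀) M)
        - (∫ η in M..B, (G η - G₀ η)) + (∫ η in B..R, G₀ η) - ibpPrim S₀ (constJet b₀) R := by
      rw [← intervalIntegral.integral_add_adjacent_intervals if1 if2,
        ← intervalIntegral.integral_add_adjacent_intervals (if₀ 0 M) (if₀ M R),
        intervalIntegral.integral_sub if1 (if₀ 0 M),
        intervalIntegral.integral_sub iG (iG₀ M B le_rfl hMB), e1, e2, hend,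
        ← intervalIntegral.integral_add_adjacent_intervals (iG₀ M B le_rfl hMB) (iG₀ B R hMB hR)]
      ring
    rw [eq]
    rw [sub_zero, abs_of_nonneg hM0] at bmid
    refine (norm_sub_le _ _).trans ?_
    refine (add_le_add ((norm_add_le _ _).trans (add_le_add ((norm_sub_le _ _).trans
      (add_le_add ((norm_sub_le _ _).trans (add_le_add bmid hprim)) bG)) btail)) bR).trans ?_
    exact le_of_eq (by ring)
  have hJ' : Tendsto (fun R : ℝ => ∫ η in (0 : ℝ)..R, f₀ η) atTop (𝓝 (b₀ * J)) := by
    refine (hJ.const_mul b₀).congr fun R => ?_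
    rw [← intervalIntegral.integral_const_mul]
    refine intervalIntegral.integral_congr fun η _ => ?_
    simp only [hf₀, constJet, if_true]
    ring
  have lim1 := (hJ'.const_sub (∫ η in (0 : ℝ)..B, f η)).norm
  have lim2 : Tendsto (fun R : ℝ => ((K * (1 + M) ^ (m + 4) * K + K * (1 + M)) * M + L + L +
      L' * K) * ε + L' * R⁻¹) atTop (𝓝 (((K * (1 + M) ^ (m + 4) * K + K * (1 + M)) * M + L + L +
      L' * K) * ε + L' * 0)) := (tendsto_inv_atTop_zero.const_mul L').const_add _
  rw [mul_zero, add_zero] at lim2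
  exact le_of_tendsto_of_tendsto lim1 lim2 ((eventually_ge_atTop B).mono key)

/-! ### Jets and approximating polynomials. -/

open Polynomial in
theorem isJet_eval_iterate_derivative (p : ℝ[X]) (N : ℕ) (s : Set ℝ) :
    IsJet (fun k η => (derivative^[k] p).eval η) N s := by
  intro k _ η _
  simp only [Function.iterate_succ_apply']
  exact (derivative^[k] p).hasDerivAt η

theorem IsJet.sub {E : Type*} [NormedAddCommGroup E] [NormedSpace ℝ E] {f g : ℕ → ℝ → E}
    {N : ℕ} {s : Set ℝ} (hf : IsJet f N s) (hg : IsJet g N s) :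
    IsJet (fun k η => f k η - g k η) N s :=
  fun k hk η hη => (hf k hk η hη).fun_sub (hg k hk η hη)

theorem IsJet.comp_mul {E : Type*} [NormedAddCommGroup E] [NormedSpace ℝ E] {f : ℕ → ℝ → E}
    {N : ℕ} {s s' : Set ℝ} (hf : IsJet f N s) (μ : ℝ) (hs : ∀ η ∈ s', μ * η ∈ s) :
    IsJet (fun k η => μ ^ k • f k (μ * η)) N s' := by
  intro k hk η hη
  have := ((hf k hk (μ * η) (hs η hη)).scomp η ((hasDerivAt_id η).const_mul μ)).fun_const_smul (μ ^ k)
  refine this.congr_deriv ?_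
  simp [smul_smul, pow_succ]

/-- Taylor's estimate: if the derivatives of order `< N` vanish at `0`, then the `k`-th derivative
is bounded by the supremum of the `N`-th one times `|η| ^ (N - k)`. -/
theorem IsJet.norm_le_pow {E : Type*} [NormedAddCommGroup E] [NormedSpace ℝ E] {f : ℕ → ℝ → E}
    {N : ℕ} {s : Set ℝ} (hf : IsJet f N s) [hs : s.OrdConnected] (h0 : (0 : ℝ) ∈ s) {K : ℝ}
    (hK : ∀ η ∈ s, ‖f N η‖ ≤ K) (hz : ∀ k < N, f k 0 = 0) :
    ∀ k ≤ N, ∀ η ∈ s, ‖f k η‖ ≤ K * |η| ^ (N - k) := by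
  have hK0 : 0 ≤ K := (norm_nonneg _).trans (hK 0 h0)
  have main : ∀ j k, k + j = N → ∀ η ∈ s, ‖f k η‖ ≤ K * |η| ^ j := by
    intro j
    induction j with
    | zero => rintro k rfl η hη; simpa using hK η hη
    | succ j ih =>
      intro k hk η hη
      have hsub : uIcc 0 η ⊆ s := hs.uIcc_subset h0 hη
      have := Convex.norm_image_sub_le_of_norm_hasDerivWithin_le (f := f k) (f' := f (k + 1))
        (s := uIcc 0 η) (x := 0) (y := η) (C := K * |η| ^ j)
        (fun t ht => (hf k (by omega) t (hsub ht)).hasDerivWithinAt)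
        (fun t ht => (ih (k + 1) (by omega) t (hsub ht)).trans (by
          have : |t| ≤ |η| := by simpa using abs_sub_left_of_mem_uIcc ht
          gcongr)) (convex_uIcc 0 η) left_mem_uIcc right_mem_uIcc
      rw [hz k (by omega), sub_zero, sub_zero, Real.norm_eq_abs] at this
      rw [pow_succ, ← mul_assoc]
      exact this
  exact fun k hk η hη => main (N - k) k (by omega) η hη

open Polynomial Matrix in
/-- The coefficients of a polynomial are bounded by its supremum on `[0, 1]`. -/
theorem exists_abs_coeff_le (n : ℕ) : ∃ V : ℝ, 0 ≤ V ∧ ∀ p : ℝ[X], p.natDegree ≤ n → ∀ E : ℝ,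
    (∀ η ∈ Icc (0 : ℝ) 1, |p.eval η| ≤ E) → ∀ j, |p.coeff j| ≤ V * E := by
  -- Distinct nodes in [0, 1]: the values there determine the coefficients through the inverse
  -- Vandermonde matrix, whose entries supply the constant.
  let v : Fin (n + 1) → ℝ := fun i => (i : ℝ) / (n + 1)
  have hv : Function.Injective v := by
    intro i j hij
    have h : (n + 1 : ℝ) ≠ 0 := by positivity
    simp only [v] at hij
    field_simp at hij
    exact Fin.ext (by exact_mod_cast hij)
  have hdet : IsUnit (vandermonde v).det := (det_vandermonde_ne_zero_iff.2 hv).isUnit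
  have hV : 0 ≤ ∑ j, ∑ i, |(vandermonde v)⁻¹ j i| := by positivity
  refine ⟨∑ j, ∑ i, |(vandermonde v)⁻¹ j i|, hV, fun p hp E hE j => ?_⟩
  have hE0 : 0 ≤ E := (abs_nonneg _).trans (hE 0 ⟨le_rfl, zero_le_one⟩)
  by_cases hj : j < n + 1
  swap
  · rw [coeff_eq_zero_of_natDegree_lt (by omega)]
    simpa using mul_nonneg hV hE0
  let c : Fin (n + 1) → ℝ := fun i => p.coeff i
  have hA : vandermonde v *ᵥ c = fun i => p.eval (v i) := by
    ext i
    rw [eval_eq_sum_range' (n := n + 1) (by omega), Finset.sum_range]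
    simp only [mulVec, dotProduct, vandermonde_apply, c]
    exact Finset.sum_congr rfl fun k _ => mul_comm _ _
  have hc : c = (vandermonde v)⁻¹ *ᵥ fun i => p.eval (v i) := by
    rw [← hA, mulVec_mulVec, nonsing_inv_mul _ hdet, one_mulVec]
  have hcj : p.coeff j = ∑ i, (vandermonde v)⁻¹ ⟨j, hj⟩ i * p.eval (v i) := congrFun hc ⟨j, hj⟩
  rw [hcj]
  calc _ ≤ ∑ i, |(vandermonde v)⁻¹ ⟨j, hj⟩ i * p.eval (v i)| := Finset.abs_sum_le_sum_abs _ _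
    _ ≤ ∑ i, |(vandermonde v)⁻¹ ⟨j, hj⟩ i| * E := by
        refine Finset.sum_le_sum fun i _ => ?_
        rw [abs_mul]
        gcongr
        refine hE _ ⟨by positivity, ?_⟩
        simp only [v]
        rw [div_le_one (by positivity)]
        exact_mod_cast i.2.le
    _ = (∑ i, |(vandermonde v)⁻¹ ⟨j, hj⟩ i|) * E := by rw [Finset.sum_mul]
    _ ≤ _ := by
        refine mul_le_mul_of_nonneg_right ?_ hE0
        exact Finset.single_le_sum (f := fun j => ∑ i, |(vandermonde v)⁻¹ j i|)
          (fun j _ => by positivity) (Finset.mem_univ (⟨j, hj⟩ : Fin (n + 1)))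

-- A crude bound suffices; what matters is that it is linear in the bound on the coefficients and
-- has the right growth in η.
open Polynomial in
theorem abs_eval_iterate_derivative_le {k n : ℕ} (hk : k ≤ n) {p : ℝ[X]} (hp : p.natDegree ≤ n)
    {E : ℝ} (hE : ∀ j, |p.coeff j| ≤ E) {η : ℝ} (hη : 0 ≤ η) :
    |(derivative^[k] p).eval η| ≤ (n + 1) * n ^ k * E * (1 + η) ^ (n - k) := by
  have hE0 : 0 ≤ E := (abs_nonneg _).trans (hE 0)
  induction k generalizing n p E with
  | zero =>
    rw [Function.iterate_zero, id, eval_eq_sum_range' (n := n + 1) (by omega)]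
    calc _ ≤ ∑ i ∈ Finset.range (n + 1), |p.coeff i * η ^ i| := Finset.abs_sum_le_sum_abs _ _
      _ ≤ ∑ i ∈ Finset.range (n + 1), E * (1 + η) ^ n := by
          refine Finset.sum_le_sum fun i hi => ?_
          rw [abs_mul, abs_of_nonneg (pow_nonneg hη i)]
          have h1 : η ^ i ≤ (1 + η) ^ i := by gcongr; linarith
          have h2 : (1 + η) ^ i ≤ (1 + η) ^ n :=
            pow_le_pow_right₀ (by linarith) (by have := Finset.mem_range.1 hi; omega)
          exact mul_le_mul (hE i) (h1.trans h2) (by positivity) hE0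
      _ = _ := by simp; ring
  | succ k ih =>
    obtain ⟨n, rfl⟩ : ∃ n', n = n' + 1 := ⟨n - 1, by omega⟩
    rw [Function.iterate_succ_apply]
    have hd : (derivative p).natDegree ≤ n := (natDegree_derivative_le p).trans (by omega)
    have hc : ∀ j, |(derivative p).coeff j| ≤ (n + 1) * E := by
      intro j
      by_cases hj : j ≤ n
      · rw [coeff_derivative, abs_mul, mul_comm, abs_of_nonneg (by positivity : (0 : ℝ) ≤ j + 1)]
        have : (j : ℝ) ≤ n := by exact_mod_cast hj
        exact mul_le_mul (by linarith) (hE _) (abs_nonneg _) (by positivity)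
      · rw [coeff_eq_zero_of_natDegree_lt (by omega), abs_zero]
        positivity
    have := ih (by omega) hd hc (by positivity)
    refine this.trans ?_
    have e : n + 1 - (k + 1) = n - k := by omega
    rw [e]
    push_cast
    have h1 : (n : ℝ) ^ k ≤ (n + 1) ^ k := by gcongr; linarith
    calc ((n : ℝ) + 1) * n ^ k * ((n + 1) * E) * (1 + η) ^ (n - k)
        ≤ ((n : ℝ) + 1 + 1) * (n + 1) ^ k * ((n + 1) * E) * (1 + η) ^ (n - k) := by
          gcongr; linarith
      _ = _ := by ring

open Polynomial in
/-- A function close to a polynomial of degree `n` on `[0, 1]` and with small derivative of order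
`n + 1` is close to it, with its derivatives, on the whole interval. -/
theorem exists_abs_jet_sub_eval_le (n : ℕ) : ∃ V : ℝ, 0 ≤ V ∧
    ∀ (S : ℕ → ℝ → ℝ) (B E₁ E₂ : ℝ) (p : ℝ[X]), 1 ≤ B → IsJet S (n + 1) (Icc 0 B) →
      (∀ η ∈ Icc 0 B, |S (n + 1) η| ≤ E₁) → p.natDegree ≤ n →
      (∀ η ∈ Icc (0 : ℝ) 1, |S 0 η - p.eval η| ≤ E₂) →
      ∀ k ≤ n, ∀ η ∈ Icc 0 B, |S k η - (derivative^[k] p).eval η| ≤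
        E₁ * η ^ (n + 1 - k) + V * (E₁ + E₂) * (1 + η) ^ (n - k) := by
  obtain ⟨V, hV, hcoeff⟩ := exists_abs_coeff_le n
  refine ⟨(n + 1) * (n + 1) ^ n * V, by positivity, ?_⟩
  intro S B E₁ E₂ p hB hS hE₁ hp hE₂ k hk η hη
  have h0B : (0 : ℝ) ∈ Icc 0 B := ⟨le_rfl, by linarith⟩
  have hE₁0 : 0 ≤ E₁ := (abs_nonneg _).trans (hE₁ 0 h0B)
  have hE₂0 : 0 ≤ E₂ := (abs_nonneg _).trans (hE₂ 0 ⟨le_rfl, zero_le_one⟩)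
  -- The Taylor polynomial of `S 0` at 0. It is close to `S` by the bound `E₁`, and close to `p` on
  -- [0, 1], hence in all coefficients. Thus closeness of the values on [0, 1] controls every
  -- derivative on the long interval.
  set q : ℝ[X] := ∑ j ∈ Finset.range (n + 1), monomial j (S j 0 / j.factorial) with hq
  have hqdeg : q.natDegree ≤ n := by
    refine natDegree_sum_le_of_forall_le _ _ fun j hj => (natDegree_monomial_le _).trans ?_
    have := Finset.mem_range.1 hj
    omega
  have hqc : ∀ j < n + 1, q.coeff j = S j 0 / j.factorial := by
    intro j hj
    simp [hq, coeff_monomial, hj]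
  have hT := (hS.sub (isJet_eval_iterate_derivative q (n + 1) _)).norm_le_pow h0B (K := E₁)
    (fun η hη => by
      rw [iterate_derivative_eq_zero (by omega)]
      simpa using hE₁ η hη)
    (fun j hj => by
      have : (derivative^[j] q).eval 0 = S j 0 := by
        rw [← coeff_zero_eq_eval_zero, coeff_iterate_derivative, zero_add, Nat.descFactorial_self,
          hqc j hj, nsmul_eq_mul]
        field_simp
      rw [this, sub_self])
  have hd : ∀ j, |(q - p).coeff j| ≤ V * (E₁ + E₂) := by
    refine hcoeff (q - p) ((natDegree_sub_le _ _).trans (max_le hqdeg hp)) _ fun t ht => ?_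
    have ht' : t ∈ Icc 0 B := ⟨ht.1, ht.2.trans hB⟩
    have h1 := hT 0 (by omega) t ht'
    simp only [Function.iterate_zero, id, Real.norm_eq_abs, abs_of_nonneg ht.1] at h1
    have h2 : E₁ * t ^ (n + 1 - 0) ≤ E₁ :=
      mul_le_of_le_one_right hE₁0 (pow_le_one₀ ht.1 ht.2)
    have h3 := hE₂ t ht
    rw [eval_sub]
    have : q.eval t - p.eval t = -(S 0 t - q.eval t) + (S 0 t - p.eval t) := by ring
    rw [this]
    refine (abs_add_le _ _).trans ?_
    rw [abs_neg]
    linarith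
  have h1 := hT k (by omega) η hη
  rw [Real.norm_eq_abs, abs_of_nonneg hη.1] at h1
  have h2 := abs_eval_iterate_derivative_le hk
    ((natDegree_sub_le q p).trans (max_le hqdeg hp)) hd hη.1
  rw [iterate_derivative_sub, eval_sub] at h2
  have e : S k η - (derivative^[k] p).eval η = (S k η - (derivative^[k] q).eval η) +
      ((derivative^[k] q).eval η - (derivative^[k] p).eval η) := by ring
  rw [e]
  refine (abs_add_le _ _).trans (add_le_add h1 (h2.trans ?_))
  have hn : (n : ℝ) ^ k ≤ (n + 1) ^ n := by
    calc (n : ℝ) ^ k ≤ (n + 1) ^ k := by gcongr; linarith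
      _ ≤ _ := pow_le_pow_right₀ (by linarith [Nat.cast_nonneg (α := ℝ) n]) hk
  have hη0 := hη.1
  calc (n + 1) * (n : ℝ) ^ k * (V * (E₁ + E₂)) * (1 + η) ^ (n - k)
      ≤ (n + 1) * (n + 1 : ℝ) ^ n * (V * (E₁ + E₂)) * (1 + η) ^ (n - k) := by gcongr
    _ = _ := by ring

/-! ### The model polynomial and the rescaled half-integral. -/

open Polynomial in
/-- The model phase `yη + vη² + ση^(m+3)`. -/
noncomputable def modelPoly (m : ℕ) (y v σ : ℝ) : ℝ[X] := C y * X + C v * X ^ 2 + C σ * X ^ (m + 3)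

theorem eval_modelPoly (m : ℕ) (y v σ η : ℝ) :
    (modelPoly m y v σ).eval η = y * η + v * η ^ 2 + σ * η ^ (m + 3) := by
  simp [modelPoly]

theorem natDegree_modelPoly_le (m : ℕ) (y v σ : ℝ) : (modelPoly m y v σ).natDegree ≤ m + 3 := by
  unfold modelPoly
  compute_degree

open Polynomial in
theorem abs_coeff_modelPoly_le (m : ℕ) (y v σ : ℝ) (j : ℕ) :
    |(modelPoly m y v σ).coeff j| ≤ |y| + |v| + |σ| := by
  have h : ∀ (c : ℝ) (i : ℕ), |(C c * X ^ i : ℝ[X]).coeff j| ≤ |c| := by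
    intro c i
    rw [coeff_C_mul_X_pow]
    split_ifs <;> simp
  have e : modelPoly m y v σ = C y * X ^ 1 + C v * X ^ 2 + C σ * X ^ (m + 3) := by
    rw [modelPoly, pow_one]
  rw [e, coeff_add, coeff_add]
  exact (abs_add_le _ _).trans (add_le_add ((abs_add_le _ _).trans (add_le_add (h _ _) (h _ _)))
    (h _ _))

-- The constants depend on y and v only through `Y`, which makes the asymptotics uniform in x.
-- Beyond the chosen threshold the lower-order part of the derivative, at most 3Yη, is no more than
-- half of the leading one.
open Polynomial in
theorem isModelPhase_modelPoly (m : ℕ) {y v σ Y : ℝ} (hσ : σ ≠ 0) (hy : |y| ≤ Y) (hv : |v| ≤ Y) :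
    IsModelPhase m ((m + 3) * |σ| / 2)
      ((m + 4) * (m + 3) ^ 3 * (Y + Y + |σ|) * 2 ^ (m + 3))
      (1 + 6 * Y / ((m + 3) * |σ|))
      (fun k η => (derivative^[k] (modelPoly m y v σ)).eval η) := by
  have hσ' : 0 < |σ| := abs_pos.2 hσ
  have hY : 0 ≤ Y := (abs_nonneg _).trans hy
  have hq : 0 ≤ 6 * Y / ((m + 3) * |σ|) := by positivity
  refine ⟨by positivity, by positivity, by linarith, isJet_eval_iterate_derivative _ _ _, ?_, ?_⟩
  · intro k hk η hη
    refine (abs_eval_iterate_derivative_le (k := k) (by omega) (natDegree_modelPoly_le m y v σ)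
      (fun j => (abs_coeff_modelPoly_le m y v σ j).trans
        (by linarith : |y| + |v| + |σ| ≤ Y + Y + |σ|)) (by linarith)).trans ?_
    have h1 : (1 + η) ^ (m + 3 - k) ≤ 2 ^ (m + 3) * η ^ (m + 3 - k) := by
      calc (1 + η) ^ (m + 3 - k) ≤ (2 * η) ^ (m + 3 - k) := by gcongr; linarith
        _ = 2 ^ (m + 3 - k) * η ^ (m + 3 - k) := mul_pow _ _ _
        _ ≤ _ := mul_le_mul_of_nonneg_right (pow_le_pow_right₀ one_le_two (by omega))
              (pow_nonneg (by linarith) _)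
    have h2 : ((m + 3 : ℕ) : ℝ) ^ k ≤ (m + 3) ^ 3 := by
      push_cast
      exact pow_le_pow_right₀ (by linarith [Nat.cast_nonneg (α := ℝ) m]) hk
    have h3 : ((m + 3 : ℕ) : ℝ) + 1 = m + 4 := by push_cast; ring
    rw [h3]
    have hη0 : 0 ≤ η := by linarith
    calc ((m : ℝ) + 4) * ((m + 3 : ℕ) : ℝ) ^ k * (Y + Y + |σ|) * (1 + η) ^ (m + 3 - k)
        ≤ (m + 4) * (m + 3) ^ 3 * (Y + Y + |σ|) * (2 ^ (m + 3) * η ^ (m + 3 - k)) := by gcongr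
      _ = _ := by ring
  · intro η hη
    have hη1 : 1 ≤ η := by linarith
    have hη0 : 0 ≤ η := by linarith
    have e : (derivative^[1] (modelPoly m y v σ)).eval η =
        (m + 3) * σ * η ^ (m + 2) + (y + 2 * v * η) := by
      simp [modelPoly]
      ring
    simp only [e]
    have h1 : |y + 2 * v * η| ≤ 3 * Y * η := by
      refine (abs_add_le _ _).trans ?_
      rw [abs_mul, abs_mul, abs_two, abs_of_nonneg hη0]
      nlinarith
    have h2 : |(m + 3) * σ * η ^ (m + 2)| = (m + 3) * |σ| * η ^ (m + 2) := by
      rw [abs_mul, abs_mul, abs_of_nonneg (pow_nonneg hη0 _),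
        abs_of_nonneg (by positivity : (0 : ℝ) ≤ m + 3)]
    have h3 : 3 * Y * η ≤ (m + 3) * |σ| / 2 * η ^ (m + 2) := by
      have a1 : 6 * Y / ((m + 3) * |σ|) ≤ η ^ (m + 1) :=
        (by linarith : _ ≤ η).trans (le_self_pow₀ hη1 (by omega))
      rw [div_le_iff₀ (by positivity)] at a1
      calc 3 * Y * η = (6 * Y) / 2 * η := by ring
        _ ≤ (η ^ (m + 1) * ((m + 3) * |σ|)) / 2 * η := by gcongr
        _ = _ := by ring
    have h4 := abs_sub_abs_le_abs_sub ((m + 3) * σ * η ^ (m + 2)) (-(y + 2 * v * η))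
    rw [sub_neg_eq_add, abs_neg] at h4
    linarith

/-- The truncated integral `∫₀ᴿ exp (i(yη + vη² + ση^(m+3))) dη`. -/
noncomputable def halfTrunc (m : ℕ) (y v σ R : ℝ) : ℂ :=
  ∫ η in (0 : ℝ)..R, Complex.exp (Complex.I * (y * η + v * η ^ 2 + σ * η ^ (m + 3) : ℝ))

theorem halfTrunc_eq (m : ℕ) (y v σ R : ℝ) : halfTrunc m y v σ R =
    ∫ η in (0 : ℝ)..R, Complex.exp (Complex.I *
      ((Polynomial.derivative^[0] (modelPoly m y v σ)).eval η : ℝ)) := by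
  simp only [halfTrunc, Function.iterate_zero, id, eval_modelPoly]

theorem exists_tendsto_halfTrunc (m : ℕ) (y v : ℝ) {σ : ℝ} (hσ : σ ≠ 0) :
    ∃ J, Tendsto (halfTrunc m y v σ) atTop (𝓝 J) := by
  obtain ⟨J, hJ⟩ := (isModelPhase_modelPoly m hσ (le_max_left |y| |v|)
    (le_max_right |y| |v|)).exists_tendsto
  exact ⟨J, hJ.congr fun R => (halfTrunc_eq m y v σ R).symm⟩

set_option maxHeartbeats 1000000 in
/-- One half of the integral of the singular chart: near a point where the phase has a
degeneration of order `m + 3`, an oscillatory integral at scale `ε` is close to its model. -/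
theorem exists_norm_half_integral_sub_le (m : ℕ) {c μ : ℝ} (hc : c ≠ 0) (hμ : μ ≠ 0) {r D : ℝ}
    (hr : 0 < r) (hD : 0 ≤ D) : ∃ δ₀ > 0, ∀ δ > 0, δ ≤ δ₀ → ∀ C ≥ 0, ∃ K ε₀ : ℝ, 0 < ε₀ ∧
    ∀ (ε : ℝ) (f : ℕ → ℝ → ℝ) (a : ℕ → ℝ → ℂ) (a₀ J : ℂ) (t y v : ℝ), 0 < ε → ε < ε₀ →
      IsJet f (m + 4) (Icc (-r) r) → (∀ θ ∈ Icc (-r) r, |f (m + 4) θ| ≤ D) →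
      IsJet a 3 (Icc (-r) r) → (∀ θ ∈ Icc (-r) r, ‖a 0 θ - a₀‖ ≤ C * (ε + |θ|)) →
      (∀ θ ∈ Icc (-r) r, ‖a 1 θ‖ ≤ C) → (∀ θ ∈ Icc (-r) r, ‖a 2 θ‖ ≤ C) → ‖a₀‖ ≤ C →
      (∀ θ ∈ Icc (-r) r, δ / 2 ≤ |θ| → a 0 θ = 0) →
      (∀ θ, |θ| ≤ |μ| * ε → |f 0 θ - (t + y * ε ^ (m + 2) * θ -
        c * θ ^ (m + 3) / (m + 3).factorial)| ≤ C * ε ^ (m + 4)) →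
      |y| ≤ C → |v| ≤ C * ε →
      Tendsto (halfTrunc m (μ * y) v (-c * μ ^ (m + 3) / (m + 3).factorial)) atTop (𝓝 J) →
      ‖(∫ η in (0 : ℝ)..(δ / (|μ| * ε)), Complex.exp (Complex.I *
        ((f 0 (μ * ε * η) - t) / ε ^ (m + 3) : ℝ)) * a 0 (μ * ε * η)) - a₀ * J‖ ≤ K * ε := by
  obtain ⟨V, hV, hjet⟩ := exists_abs_jet_sub_eval_le (m + 3)
  have hσ : -c * μ ^ (m + 3) / (m + 3).factorial ≠ 0 :=
    div_ne_zero (mul_ne_zero (neg_ne_zero.2 hc) (pow_ne_zero _ hμ)) (by positivity)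
  generalize hσdef : -c * μ ^ (m + 3) / (m + 3).factorial = σ at hσ ⊢
  have hσ' : 0 < |σ| := abs_pos.2 hσ
  have hμ' : 0 < |μ| := abs_pos.2 hμ
  -- The model derivative is bounded below by 2κη^(m+2); the two parts of the perturbation take κ/2
  -- each, leaving κ for the actual phase.
  obtain ⟨κ, hκdef⟩ : ∃ κ' : ℝ, κ' = (m + 3) * |σ| / 4 := ⟨_, rfl⟩
  have hκ : 0 < κ := by rw [hκdef]; positivity
  -- For δ ≤ q the bound `D` on the derivative of order m + 4 takes at most κ/2. This choice
  -- precedes `C`, so the support condition does not depend on the amplitude.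
  obtain ⟨q, hq⟩ : ∃ q' : ℝ, q' = κ / 2 / (|μ| ^ (m + 3) * D + 1) := ⟨_, rfl⟩
  have hq0 : 0 < q := by rw [hq]; positivity
  refine ⟨min (r / 2) q, by positivity, fun δ hδ hδ₀ C hC => ?_⟩
  have hδr : δ ≤ r / 2 := hδ₀.trans (min_le_left _ _)
  have hδq : |μ| ^ (m + 3) * D * δ ≤ κ / 2 := by
    have h1 : δ ≤ κ / 2 / (|μ| ^ (m + 3) * D + 1) := hq ▸ hδ₀.trans (min_le_right _ _)
    rw [le_div_iff₀ (by positivity), mul_add, mul_comm] at h1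
    linarith
  obtain ⟨Y, hY⟩ : ∃ Y' : ℝ, Y' = (|μ| + 1) * C := ⟨_, rfl⟩
  have hY0 : 0 ≤ Y := by rw [hY]; positivity
  obtain ⟨K₀, hK₀⟩ : ∃ K₀' : ℝ, K₀' = (m + 4) * (m + 3) ^ 3 * (Y + Y + |σ|) * 2 ^ (m + 3) := ⟨_, rfl⟩
  have hK₀0 : 0 ≤ K₀ := by rw [hK₀]; positivity
  obtain ⟨M, hM⟩ : ∃ M' : ℝ, M' = 1 + 6 * Y / ((m + 3) * |σ|) := ⟨_, rfl⟩
  have hM1 : 1 ≤ M := by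
    have : 0 ≤ 6 * Y / ((m + 3) * |σ|) := by positivity
    linarith
  obtain ⟨E₁, hE₁⟩ : ∃ E₁' : ℝ, E₁' = |μ| ^ (m + 4) * D := ⟨_, rfl⟩
  have hE₁0 : 0 ≤ E₁ := by rw [hE₁]; positivity
  obtain ⟨E₂, hE₂⟩ : ∃ E₂' : ℝ, E₂' = V * (E₁ + 2 * C) := ⟨_, rfl⟩
  have hE₂0 : 0 ≤ E₂ := by rw [hE₂]; positivity
  have hs1 : 0 ≤ δ / |μ| := by positivity
  have hs2 : 0 ≤ |μ| / δ := by positivity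
  obtain ⟨K₁, hK₁0, hk1, hk2, hk3, hk4, hk5, hk6, hk7, hk8⟩ : ∃ K₁ : ℝ, 0 ≤ K₁ ∧ K₀ ≤ K₁ ∧
      E₁ + E₂ ≤ K₁ ∧ δ / |μ| ≤ K₁ ∧ |μ| / δ ≤ K₁ ∧ C ≤ K₁ ∧ C * (1 + |μ|) ≤ K₁ ∧ C * |μ| ≤ K₁ ∧
      C * |μ| ^ 2 ≤ K₁ := by
    have h1 : 0 ≤ C * |μ| := by positivity
    have h2 : 0 ≤ C * |μ| ^ 2 := by positivity
    refine ⟨K₀ + (E₁ + E₂) + δ / |μ| + |μ| / δ + C + C * |μ| + C * |μ| ^ 2, by positivity, ?_, ?_,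
      ?_, ?_, ?_, ?_, ?_, ?_⟩ <;> linarith
  obtain ⟨K', hK'⟩ := exists_norm_integral_sub_le m κ K₁ M
  refine ⟨K', min 1 (min (δ / (|μ| * M)) (κ / 2 / (E₂ * 2 ^ (m + 2) + 1))), by positivity, ?_⟩
  intro ε f a a₀ J t y v hε hε₀ hf hfD ha ha0 ha1 ha2 haC hasupp hexp hy hv hJ
  have hε1 : ε < 1 := hε₀.trans_le (min_le_left _ _)
  have hεM : ε < δ / (|μ| * M) := hε₀.trans_le ((min_le_right _ _).trans (min_le_left _ _))
  have hεκ : E₂ * 2 ^ (m + 2) * ε ≤ κ / 2 := by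
    have h1 : ε < κ / 2 / (E₂ * 2 ^ (m + 2) + 1) :=
      hε₀.trans_le ((min_le_right _ _).trans (min_le_right _ _))
    rw [lt_div_iff₀ (by positivity), mul_add, mul_comm] at h1
    linarith
  set B : ℝ := δ / (|μ| * ε) with hB
  have hμε : 0 < |μ| * ε := by positivity
  have hμB : |μ| * ε * B = δ := by rw [hB]; field_simp
  have hB0 : 0 < B := by positivity
  have hMB : M ≤ B := by
    rw [hB, le_div_iff₀ hμε]
    rw [lt_div_iff₀ (by positivity)] at hεM
    exact le_of_eq_of_le (by ring) hεM.le
  have habs : ∀ η, 0 ≤ η → |μ * ε * η| = |μ| * ε * η := by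
    intro η hη
    rw [abs_mul, abs_mul, abs_of_pos hε, abs_of_nonneg hη]
  have habs' : ∀ η ∈ Icc 0 B, |μ * ε * η| ≤ δ := by
    intro η hη
    rw [habs η hη.1, ← hμB]
    gcongr
    exact hη.2
  have hmaps : ∀ η ∈ Icc 0 B, μ * ε * η ∈ Icc (-r) r := fun η hη =>
    abs_le.1 ((habs' η hη).trans (by linarith))
  set p := modelPoly m (μ * y) v σ with hp
  have hyY : |μ * y| ≤ Y := by
    rw [abs_mul, hY]
    have : |μ| * |y| ≤ |μ| * C := by gcongr
    exact this.trans (mul_le_mul_of_nonneg_right (by linarith) hC)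
  have hvY : |v| ≤ Y := by
    have h1 : C * ε ≤ C := mul_le_of_le_one_right hC hε1.le
    have h2 : 0 ≤ |μ| * C := by positivity
    rw [hY]
    linarith
  have hmod := isModelPhase_modelPoly m hσ hyY hvY
  rw [← hK₀, ← hM, ← hp] at hmod
  have hmodel : IsModelPhase m κ K₁ M
      (fun k η => (Polynomial.derivative^[k] p).eval η) := by
    have h1 := hmod.mono hk1
    refine ⟨hκ, h1.K_nonneg, hM1, h1.jet, h1.bound, fun η hη => ?_⟩
    refine le_trans ?_ (h1.lower η hη)
    have : 0 ≤ η := by linarith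
    gcongr
    rw [hκdef]
    have : 0 ≤ (m + 3) * |σ| := by positivity
    linarith
  set S : ℕ → ℝ → ℝ := fun k η =>
    (μ * ε) ^ k • ((f k (μ * ε * η) - if k = 0 then t else 0) / ε ^ (m + 3)) with hS
  have hSjet : IsJet S (m + 4) (Icc 0 B) := by
    refine IsJet.comp_mul (f := fun k θ => (f k θ - if k = 0 then t else 0) / ε ^ (m + 3))
      (s := Icc (-r) r) ?_ (μ * ε) hmaps
    intro k hk θ hθ
    have := ((hf k hk θ hθ).sub_const (if k = 0 then t else 0)).div_const (ε ^ (m + 3))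
    simpa using this
  have hSE₁ : ∀ η ∈ Icc 0 B, |S (m + 3 + 1) η| ≤ E₁ * ε := by
    intro η hη
    have h1 := hfD _ (hmaps η hη)
    simp only [hS, smul_eq_mul]
    rw [if_neg (by omega), sub_zero, abs_mul, abs_div, abs_pow, abs_mul, abs_of_pos hε,
      abs_of_pos (by positivity : 0 < ε ^ (m + 3))]
    calc (|μ| * ε) ^ (m + 3 + 1) * (|f (m + 4) (μ * ε * η)| / ε ^ (m + 3))
        ≤ (|μ| * ε) ^ (m + 3 + 1) * (D / ε ^ (m + 3)) := by gcongr
      _ = _ := by rw [hE₁]; field_simp; ring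
  -- One Cε is the expansion error divided by ε^(m+3); the other is the term vη² of the model,
  -- absent from the expansion.
  have hSE₂ : ∀ η ∈ Icc (0 : ℝ) 1, |S 0 η - p.eval η| ≤ 2 * C * ε := by
    intro η hη
    have h1 := hexp (μ * ε * η) (by
      rw [habs η hη.1]; exact mul_le_of_le_one_right hμε.le hη.2)
    have e : S 0 η - p.eval η = (f 0 (μ * ε * η) - (t + y * ε ^ (m + 2) * (μ * ε * η) -
        c * (μ * ε * η) ^ (m + 3) / (m + 3).factorial)) / ε ^ (m + 3) - v * η ^ 2 := by
      rw [hp, eval_modelPoly, ← hσdef]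
      simp only [hS, if_true, pow_zero, one_smul]
      field_simp
      ring
    rw [e]
    refine (abs_sub _ _).trans ?_
    rw [abs_div, abs_of_pos (by positivity : 0 < ε ^ (m + 3)), abs_mul,
      abs_of_nonneg (sq_nonneg η)]
    have h2 : |v| * η ^ 2 ≤ C * ε * 1 := by
      gcongr
      exact pow_le_one₀ hη.1 hη.2
    have h3 : |f 0 (μ * ε * η) - (t + y * ε ^ (m + 2) * (μ * ε * η) -
        c * (μ * ε * η) ^ (m + 3) / (m + 3).factorial)| / ε ^ (m + 3) ≤ C * ε := by
      rw [div_le_iff₀ (by positivity)]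
      refine h1.trans (le_of_eq (by ring))
    linarith
  have hdiff := hjet S B (E₁ * ε) (2 * C * ε) p (hM1.trans hMB) hSjet hSE₁
    (natDegree_modelPoly_le m _ _ _) hSE₂
  have hE₂' : V * (E₁ * ε + 2 * C * ε) = E₂ * ε := by rw [hE₂]; ring
  rw [hE₂'] at hdiff
  set b : ℕ → ℝ → ℂ := fun k η => (μ * ε) ^ k • a k (μ * ε * η) with hb
  -- The amplitude vanishes already from δ/2 on, hence near |s| = δ, so its derivative is zero there
  -- too.
  have hae : ∀ s : ℝ, |s| = δ → a 0 s = 0 ∧ a 1 s = 0 := by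
    intro s hs
    have hsr : s ∈ Icc (-r) r := abs_le.1 (by linarith)
    have h0 : a 0 =ᶠ[𝓝 s] fun _ => (0 : ℂ) := by
      have hcont : Tendsto (fun s : ℝ => |s|) (𝓝 s) (𝓝 δ) := hs ▸ continuous_abs.tendsto s
      filter_upwards [hcont.eventually (Ioo_mem_nhds (by linarith : δ / 2 < δ)
        (by linarith : δ < r))] with u hu
      exact hasupp u (abs_le.1 hu.2.le) hu.1.le
    exact ⟨h0.eq_of_nhds, ((ha 0 (by norm_num) s hsr).congr_of_eventuallyEq h0.symm).unique
      (hasDerivAt_const s 0)⟩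
  have hBδ : |μ * ε * B| = δ := by rw [habs B hB0.le, hμB]
  have hnear : IsNearModel m κ K₁ M ε B S (fun k η => (Polynomial.derivative^[k] p).eval η)
      b a₀ := by
    refine ⟨hε, hMB, ?_, ?_, hSjet.mono (by omega) le_rfl, ha.comp_mul _ hmaps, ?_, ?_, ?_, ?_, ?_,
      ?_, ?_, ?_⟩
    · have : ε * B = δ / |μ| := by rw [hB]; field_simp
      rw [this]; exact hk3
    · have h1 : |μ| / δ * ε * B = 1 := by rw [hB]; field_simp
      rw [← h1]
      gcongr
    · intro k hk η hη
      refine (hdiff k (by omega) η hη).trans ?_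
      have hη0 := hη.1
      have e : m + 3 + 1 - k = m + 4 - k := rfl
      rw [e]
      have h1 : η ^ (m + 4 - k) ≤ (1 + η) ^ (m + 4 - k) := by gcongr; linarith
      have h2 : (1 + η) ^ (m + 3 - k) ≤ (1 + η) ^ (m + 4 - k) :=
        pow_le_pow_right₀ (by linarith) (by omega)
      calc _ ≤ E₁ * ε * (1 + η) ^ (m + 4 - k) + E₂ * ε * (1 + η) ^ (m + 4 - k) := by gcongr
        _ = (E₁ + E₂) * ε * (1 + η) ^ (m + 4 - k) := by ring
        _ ≤ _ := by gcongr
    · intro η hη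
      have hη1 : 1 ≤ η := hM1.trans hη.1
      have hη0 : 0 ≤ η := by linarith
      have hη' : η ∈ Icc 0 B := ⟨hη0, hη.2⟩
      have h1 := hdiff 1 (by omega) η hη'
      have h2 := hmod.lower η hη.1
      have e1 : m + 3 + 1 - 1 = m + 3 := by omega
      have e2 : m + 3 - 1 = m + 2 := by omega
      rw [e1, e2] at h1
      have h3 : E₁ * ε * η ^ (m + 3) ≤ κ / 2 * η ^ (m + 2) := by
        calc E₁ * ε * η ^ (m + 3) = |μ| ^ (m + 3) * D * (|μ| * ε * η) * η ^ (m + 2) := by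
              rw [hE₁]; ring
          _ ≤ |μ| ^ (m + 3) * D * δ * η ^ (m + 2) := by
              gcongr
              rw [← hμB]
              gcongr
              exact hη.2
          _ ≤ _ := by gcongr
      have h4 : E₂ * ε * (1 + η) ^ (m + 2) ≤ κ / 2 * η ^ (m + 2) := by
        calc E₂ * ε * (1 + η) ^ (m + 2) ≤ E₂ * ε * (2 * η) ^ (m + 2) := by gcongr; linarith
          _ = E₂ * 2 ^ (m + 2) * ε * η ^ (m + 2) := by rw [mul_pow]; ring
          _ ≤ _ := by gcongr
      have h5 := abs_sub_abs_le_abs_sub ((Polynomial.derivative^[1] p).eval η) (S 1 η)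
      rw [abs_sub_comm] at h5
      have h6 : (m + 3) * |σ| / 2 * η ^ (m + 2) = 2 * κ * η ^ (m + 2) := by rw [hκdef]; ring
      rw [h6] at h2
      linarith
    · intro η hη
      have hη0 := hη.1
      have h1 := ha0 _ (hmaps η hη)
      rw [habs η hη.1] at h1
      simp only [hb, pow_zero, one_smul]
      refine h1.trans ?_
      calc C * (ε + |μ| * ε * η) ≤ C * ((1 + |μ|) * ε * (1 + η)) := by
            gcongr
            have h2 : 0 ≤ |μ| * ε + ε * η := by positivity
            have h3 : (1 + |μ|) * ε * (1 + η) = ε + |μ| * ε * η + (|μ| * ε + ε * η) := by ring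
            rw [h3]
            exact le_add_of_nonneg_right h2
        _ = C * (1 + |μ|) * ε * (1 + η) := by ring
        _ ≤ _ := by gcongr
    · intro η hη
      have h1 := ha1 _ (hmaps η hη)
      simp only [hb, pow_one, norm_smul, Real.norm_eq_abs, abs_mul, abs_of_pos hε]
      calc |μ| * ε * ‖a 1 (μ * ε * η)‖ ≤ |μ| * ε * C := by gcongr
        _ = C * |μ| * ε := by ring
        _ ≤ _ := by gcongr
    · intro η hη
      have h1 := ha2 _ (hmaps η hη)
      simp only [hb, norm_smul, Real.norm_eq_abs, abs_mul, abs_pow, abs_of_pos hε]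
      calc (|μ| * ε) ^ 2 * ‖a 2 (μ * ε * η)‖ ≤ (|μ| * ε) ^ 2 * C := by gcongr
        _ = C * |μ| ^ 2 * ε ^ 2 := by ring
        _ ≤ _ := by gcongr
    · exact haC.trans hk5
    · simp [hb, (hae _ hBδ).1]
    · simp [hb, (hae _ hBδ).2]
  have := hK' ε B S _ b a₀ J hmodel hnear (hJ.congr fun R => halfTrunc_eq m _ v σ R)
  simpa [hS, hb] using this

/-! ### Iterated partial derivatives. -/

section PartialDerivative

variable {E F : Type*} [NormedAddCommGroup E] [NormedSpace ℝ E] [NormedAddCommGroup F]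
  [NormedSpace ℝ F]

/-- Partial derivative with respect to the last, real variable. -/
noncomputable def dlast (G : E × ℝ → F) (w : E × ℝ) : F := deriv (fun s => G (w.1, s)) w.2

theorem hasDerivAt_snd_fderiv {U : Set (E × ℝ)} (hU : IsOpen U) {G : E × ℝ → F}
    (hG : ContDiffOn ℝ ∞ G U) {w : E × ℝ} (hw : w ∈ U) :
    HasDerivAt (fun s => G (w.1, s)) (fderiv ℝ G w (0, 1)) w.2 := by
  have h1 : HasFDerivAt G (fderiv ℝ G w) w :=
    ((hG.contDiffAt (hU.mem_nhds hw)).differentiableAt (by simp)).hasFDerivAt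
  have h2 : HasDerivAt (fun s : ℝ => (w.1, s)) ((0 : E), (1 : ℝ)) w.2 :=
    (hasDerivAt_const _ _).prodMk (hasDerivAt_id _)
  exact h1.comp_hasDerivAt (x := w.2) (f := fun s : ℝ => (w.1, s)) h2

theorem dlast_eq_fderiv {U : Set (E × ℝ)} (hU : IsOpen U) {G : E × ℝ → F}
    (hG : ContDiffOn ℝ ∞ G U) {w : E × ℝ} (hw : w ∈ U) : dlast G w = fderiv ℝ G w (0, 1) :=
  (hasDerivAt_snd_fderiv hU hG hw).deriv

theorem hasDerivAt_dlast {U : Set (E × ℝ)} (hU : IsOpen U) {G : E × ℝ → F}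
    (hG : ContDiffOn ℝ ∞ G U) {w : E × ℝ} (hw : w ∈ U) :
    HasDerivAt (fun s => G (w.1, s)) (dlast G w) w.2 := by
  rw [dlast_eq_fderiv hU hG hw]
  exact hasDerivAt_snd_fderiv hU hG hw

theorem contDiffOn_dlast {U : Set (E × ℝ)} (hU : IsOpen U) {G : E × ℝ → F}
    (hG : ContDiffOn ℝ ∞ G U) : ContDiffOn ℝ ∞ (dlast G) U := by
  have h1 : ContDiffOn ℝ ∞ (fderiv ℝ G) U := hG.fderiv_of_isOpen hU (by simp)
  exact (h1.clm_apply contDiffOn_const).congr fun w hw => dlast_eq_fderiv hU hG hw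

theorem contDiffOn_iterate_dlast {U : Set (E × ℝ)} (hU : IsOpen U) {G : E × ℝ → F}
    (hG : ContDiffOn ℝ ∞ G U) (k : ℕ) : ContDiffOn ℝ ∞ (dlast^[k] G) U := by
  induction k with
  | zero => exact hG
  | succ k ih => rw [Function.iterate_succ_apply']; exact contDiffOn_dlast hU ih

theorem isJet_iterate_dlast {U : Set (E × ℝ)} (hU : IsOpen U) {G : E × ℝ → F}
    (hG : ContDiffOn ℝ ∞ G U) {x : E} {ψ : ℝ} {s : Set ℝ} (hs : ∀ θ ∈ s, (x, ψ + θ) ∈ U) (N : ℕ) :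
    IsJet (fun k θ => dlast^[k] G (x, ψ + θ)) N s := by
  intro k _ θ hθ
  have := hasDerivAt_dlast hU (contDiffOn_iterate_dlast hU hG k) (hs θ hθ)
  simp only [Function.iterate_succ_apply']
  exact this.comp_const_add ψ θ

end PartialDerivative

theorem exists_norm_le_on_closedBall {E F : Type*} [NormedAddCommGroup E] [NormedSpace ℝ E]
    [ProperSpace E] [NormedAddCommGroup F] [NormedSpace ℝ F] {U : Set E} {G : E → F}
    (hG : ContDiffOn ℝ ∞ G U) {w : E} {r : ℝ} (hr : Metric.closedBall w r ⊆ U) :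
    ∃ D : ℝ, 0 ≤ D ∧ ∀ u ∈ Metric.closedBall w r, ‖G u‖ ≤ D := by
  obtain ⟨D, hD⟩ := (isCompact_closedBall w r).exists_bound_of_continuousOn
    (hG.continuousOn.mono hr)
  exact ⟨max D 0, le_max_right _ _, fun u hu => (hD u hu).trans (le_max_left _ _)⟩

theorem mk_mem_closedBall {E : Type*} [NormedAddCommGroup E] {x x₀ : E} {ψ θ r : ℝ}
    (hx : ‖x - x₀‖ ≤ r) (hθ : |θ| ≤ r) : (x, ψ + θ) ∈ Metric.closedBall (x₀, ψ) r := by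
  rw [mem_closedBall_iff_norm, Prod.mk_sub_mk, Prod.norm_def]
  simpa using ⟨hx, hθ⟩

theorem dpsi_eq_dlast : dpsi = (dlast : (ℝ × ℝ → Plane) → ℝ × ℝ → Plane) := rfl

theorem hasDerivAt_fst_fderiv {U : Set (ℝ × ℝ)} (hU : IsOpen U) {G : ℝ × ℝ → Plane}
    (hG : ContDiffOn ℝ ∞ G U) {w : ℝ × ℝ} (hw : w ∈ U) :
    HasDerivAt (fun t => G (t, w.2)) (fderiv ℝ G w (1, 0)) w.1 := by
  have h1 : HasFDerivAt G (fderiv ℝ G w) w :=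
    ((hG.contDiffAt (hU.mem_nhds hw)).differentiableAt (by simp)).hasFDerivAt
  have h2 : HasDerivAt (fun s : ℝ => (s, w.2)) ((1 : ℝ), (0 : ℝ)) w.1 :=
    (hasDerivAt_id _).prodMk (hasDerivAt_const _ _)
  exact h1.comp_hasDerivAt (x := w.1) (f := fun s : ℝ => (s, w.2)) h2

theorem dtau_eq_fderiv {U : Set (ℝ × ℝ)} (hU : IsOpen U) {G : ℝ × ℝ → Plane}
    (hG : ContDiffOn ℝ ∞ G U) {w : ℝ × ℝ} (hw : w ∈ U) : dtau G w = fderiv ℝ G w (1, 0) :=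
  (hasDerivAt_fst_fderiv hU hG hw).deriv

theorem hasDerivAt_dtau {U : Set (ℝ × ℝ)} (hU : IsOpen U) {G : ℝ × ℝ → Plane}
    (hG : ContDiffOn ℝ ∞ G U) {w : ℝ × ℝ} (hw : w ∈ U) :
    HasDerivAt (fun t => G (t, w.2)) (dtau G w) w.1 := by
  rw [dtau_eq_fderiv hU hG hw]
  exact hasDerivAt_fst_fderiv hU hG hw

theorem contDiffOn_dtau {U : Set (ℝ × ℝ)} (hU : IsOpen U) {G : ℝ × ℝ → Plane}
    (hG : ContDiffOn ℝ ∞ G U) : ContDiffOn ℝ ∞ (dtau G) U := by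
  have h1 : ContDiffOn ℝ ∞ (fderiv ℝ G) U := hG.fderiv_of_isOpen hU (by simp)
  exact (h1.clm_apply contDiffOn_const).congr fun w hw => dtau_eq_fderiv hU hG hw

/-! ### Plane geometry and eikonal coordinates at a focal point. -/

theorem inner_plane (u v : Plane) : inner ℝ u v = u 0 * v 0 + u 1 * v 1 := by
  simp [PiLp.inner_apply, Fin.sum_univ_two, mul_comm]

theorem plane_eq_zero {u : Plane} (h0 : u 0 = 0) (h1 : u 1 = 0) : u = 0 := by
  ext i
  fin_cases i <;> simpa

theorem abs_det2_of_inner_eq_zero {u v : Plane} (h : inner ℝ u v = 0) :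
    |det2 u v| = ‖u‖ * ‖v‖ := by
  rw [← abs_of_nonneg (mul_nonneg (norm_nonneg u) (norm_nonneg v)), ← sq_eq_sq_iff_abs_eq_abs,
    mul_pow, ← real_inner_self_eq_norm_sq, ← real_inner_self_eq_norm_sq, inner_plane, inner_plane,
    det2]
  rw [inner_plane] at h
  linear_combination (-(u 0 * v 0 + u 1 * v 1)) * h

/-- Two orthogonal nonzero vectors span the plane. -/
theorem eq_zero_of_inner_eq_zero {p q u : Plane} (hp : p ≠ 0) (hq : q ≠ 0) (hpq : inner ℝ p q = 0)
    (h1 : inner ℝ p u = 0) (h2 : inner ℝ q u = 0) : u = 0 := by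
  have hd : det2 p q ≠ 0 := by
    rw [← abs_pos, abs_det2_of_inner_eq_zero hpq]
    positivity
  rw [inner_plane] at h1 h2
  have e0 : det2 p q * u 0 = 0 := by
    rw [det2]; linear_combination q 1 * h1 - p 1 * h2
  have e1 : det2 p q * u 1 = 0 := by
    rw [det2]; linear_combination p 0 * h2 - q 0 * h1
  exact plane_eq_zero ((mul_eq_zero.1 e0).resolve_left hd) ((mul_eq_zero.1 e1).resolve_left hd)

namespace IsEikonalCoordinateSystem

variable {L : Set (Plane × Plane)} {Ω : Set (ℝ × ℝ)} {X P : ℝ × ℝ → Plane} {a : ℝ × ℝ}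

theorem inner_dtau (h : IsEikonalCoordinateSystem L Ω X P) (ha : a ∈ Ω) :
    inner ℝ (P a) (dtau X a) = 1 := by
  rw [dtau_eq_fderiv h.isOpen h.smooth_X ha]
  exact h.pfaff a ha _

theorem inner_dpsi (h : IsEikonalCoordinateSystem L Ω X P) (ha : a ∈ Ω) :
    inner ℝ (P a) (dpsi X a) = 0 := by
  rw [dpsi_eq_dlast, dlast_eq_fderiv h.isOpen h.smooth_X ha]
  exact h.pfaff a ha _

theorem ne_zero (h : IsEikonalCoordinateSystem L Ω X P) (ha : a ∈ Ω) : P a ≠ 0 := by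
  intro h0
  have := h.inner_dtau ha
  simp [h0] at this

/-- The degenerate Jacobian makes X_ψ a multiple of X_τ, which is nonzero since ⟨P, X_τ⟩ = 1;
pairing with P, the multiple is zero. -/
theorem dpsi_eq_zero (h : IsEikonalCoordinateSystem L Ω X P) (ha : a ∈ Ω) (hf : IsFocal X a) :
    dpsi X a = 0 := by
  have h1 := h.inner_dtau ha
  have h2 := h.inner_dpsi ha
  rw [inner_plane] at h1 h2
  rw [IsFocal, det2] at hf
  refine plane_eq_zero ?_ ?_
  · linear_combination -(dpsi X a 0) * h1 + dtau X a 0 * h2 - P a 1 * hf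
  · linear_combination -(dpsi X a 1) * h1 + dtau X a 1 * h2 + P a 0 * hf

/-- Otherwise ∂/∂ψ would be in the kernel of the differential of (X, P). -/
theorem dpsi_momentum_ne_zero (h : IsEikonalCoordinateSystem L Ω X P) (ha : a ∈ Ω)
    (hf : IsFocal X a) : dpsi P a ≠ 0 := by
  intro h0
  have h1 := h.immersion a ha (0, 1)
    (by rw [← dlast_eq_fderiv h.isOpen h.smooth_X ha]; exact h.dpsi_eq_zero ha hf)
    (by rw [← dlast_eq_fderiv h.isOpen h.smooth_P ha]; exact h0)
  simp at h1

theorem mem (h : IsEikonalCoordinateSystem L Ω X P) (ha : a ∈ Ω) : (X a, P a) ∈ L := by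
  obtain ⟨O, -, hO⟩ := h.image_open Ω le_rfl h.isOpen
  have : (X a, P a) ∈ L ∩ O := hO ▸ mem_image_of_mem (fun a => (X a, P a)) ha
  exact this.1

theorem eventually_mem (h : IsEikonalCoordinateSystem L Ω X P) (ha : a ∈ Ω) :
    ∀ᶠ s in 𝓝 a.2, (a.1, s) ∈ Ω := by
  have : Tendsto (fun s : ℝ => (a.1, s)) (𝓝 a.2) (𝓝 a) := by
    have : Continuous fun s : ℝ => (a.1, s) := by fun_prop
    exact this.tendsto a.2
  exact this.eventually (h.isOpen.mem_nhds ha)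

/-- On a level set of a function of `(x, |p|)`, the vectors `P` and `P_ψ` are orthogonal at focal
points. -/
theorem inner_dpsi_momentum (h : IsEikonalCoordinateSystem L Ω X P) (ha : a ∈ Ω)
    (hf : IsFocal X a) {D : Set (Plane × ℝ)} (hD : IsOpen D) {F : Plane × ℝ → ℝ}
    (hF : ContDiffOn ℝ ∞ F D) {E : ℝ}
    (hlevel : ∀ q ∈ L, (q.1, ‖q.2‖) ∈ D ∧ F (q.1, ‖q.2‖) = E)
    (hreg : deriv (fun r => F (X a, r)) ‖P a‖ ≠ 0) : inner ℝ (P a) (dpsi P a) = 0 := by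
  have hmem : (X a, ‖P a‖) ∈ D := (hlevel _ (h.mem ha)).1
  have hP := h.ne_zero ha
  have hFd : HasFDerivAt F (fderiv ℝ F (X a, ‖P a‖)) (X a, ‖P a‖) :=
    ((hF.contDiffAt (hD.mem_nhds hmem)).differentiableAt (by simp)).hasFDerivAt
  have hr : fderiv ℝ F (X a, ‖P a‖) (0, 1) ≠ 0 := by
    rwa [← dlast_eq_fderiv hD hF hmem]
  have dX : HasDerivAt (fun s => X (a.1, s)) (dpsi X a) a.2 :=
    hasDerivAt_dlast h.isOpen h.smooth_X ha
  have dP : HasDerivAt (fun s => P (a.1, s)) (dpsi P a) a.2 :=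
    hasDerivAt_dlast h.isOpen h.smooth_P ha
  have dN : HasDerivAt (fun s => ‖P (a.1, s)‖) (inner ℝ (P a) (dpsi P a) / ‖P a‖) a.2 := by
    have h1 := dP.norm_sq.sqrt (by simpa using hP)
    simp only [Real.sqrt_sq (norm_nonneg _)] at h1
    refine h1.congr_deriv ?_
    rw [mul_div_mul_left _ _ two_ne_zero]
  have dF : HasDerivAt (fun s => F (X (a.1, s), ‖P (a.1, s)‖))
      (fderiv ℝ F (X a, ‖P a‖) (dpsi X a, inner ℝ (P a) (dpsi P a) / ‖P a‖)) a.2 :=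
    HasFDerivAt.comp_hasDerivAt (x := a.2) (f := fun s => (X (a.1, s), ‖P (a.1, s)‖)) hFd
      (dX.prodMk dN)
  have hconst : (fun s => F (X (a.1, s), ‖P (a.1, s)‖)) =ᶠ[𝓝 a.2] fun _ => E := by
    filter_upwards [h.eventually_mem ha] with s hs
    exact (hlevel _ (h.mem hs)).2
  have h0 := (dF.congr_of_eventuallyEq hconst.symm).unique (hasDerivAt_const a.2 E)
  rw [h.dpsi_eq_zero ha hf] at h0
  -- As X_ψ = 0, the chain rule leaves only the derivative of F in |p|, nonzero by assumption, times
  -- the derivative of |P|.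
  have e : ((0 : Plane), inner ℝ (P a) (dpsi P a) / ‖P a‖) =
      (inner ℝ (P a) (dpsi P a) / ‖P a‖) • ((0 : Plane), (1 : ℝ)) := by simp
  rw [e, map_smul, smul_eq_mul] at h0
  have h1 := (mul_eq_zero.1 h0).resolve_right hr
  exact (div_eq_zero_iff.1 h1).resolve_right (by simpa using hP)

/-- The ψ-derivative of ⟨P, X_ψ⟩ = 0. At a focal point it says P ⟂ X_ψψ. -/
theorem inner_dpsi_dpsi_add (h : IsEikonalCoordinateSystem L Ω X P) (ha : a ∈ Ω) :
    inner ℝ (P a) (dpsi (dpsi X) a) + inner ℝ (dpsi P a) (dpsi X a) = 0 := by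
  have d1 := (hasDerivAt_dlast h.isOpen h.smooth_P ha).inner ℝ
    (hasDerivAt_dlast h.isOpen (contDiffOn_dlast h.isOpen h.smooth_X) ha)
  have hconst : (fun s => inner ℝ (P (a.1, s)) (dlast X (a.1, s))) =ᶠ[𝓝 a.2] fun _ => (0 : ℝ) := by
    filter_upwards [h.eventually_mem ha] with s hs
    exact h.inner_dpsi hs
  exact (d1.congr_of_eventuallyEq hconst.symm).unique (hasDerivAt_const a.2 0)

/-- The second ψ-derivative of ⟨P, X_ψ⟩ = 0. At a focal point with X_ψψ = 0 it says P ⟂ X_ψψψ. -/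
theorem inner_dpsi_dpsi_dpsi_add (h : IsEikonalCoordinateSystem L Ω X P) (ha : a ∈ Ω) :
    inner ℝ (P a) (dpsi (dpsi (dpsi X)) a) + inner ℝ (dpsi P a) (dpsi (dpsi X) a) +
      (inner ℝ (dpsi P a) (dpsi (dpsi X) a) + inner ℝ (dpsi (dpsi P) a) (dpsi X a)) = 0 := by
  have sX := contDiffOn_dlast h.isOpen h.smooth_X
  have sP := contDiffOn_dlast h.isOpen h.smooth_P
  have d1 := (hasDerivAt_dlast h.isOpen h.smooth_P ha).inner ℝ
    (hasDerivAt_dlast h.isOpen (contDiffOn_dlast h.isOpen sX) ha)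
  have d2 := (hasDerivAt_dlast h.isOpen sP ha).inner ℝ (hasDerivAt_dlast h.isOpen sX ha)
  have hconst : (fun s => inner ℝ (P (a.1, s)) (dlast (dlast X) (a.1, s)) +
      inner ℝ (dlast P (a.1, s)) (dlast X (a.1, s))) =ᶠ[𝓝 a.2] fun _ => (0 : ℝ) := by
    filter_upwards [h.eventually_mem ha] with s hs
    exact h.inner_dpsi_dpsi_add hs
  exact ((d1.fun_add d2).congr_of_eventuallyEq hconst.symm).unique (hasDerivAt_const a.2 0)

end IsEikonalCoordinateSystem

/-! ### Expansion of the phase function at a focal point. -/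

theorem exists_closedBall_subset {E : Type*} [NormedAddCommGroup E] {U : Set E} (hU : IsOpen U)
    {w : E} (hw : w ∈ U) : ∃ r : ℝ, 0 < r ∧ r ≤ 1 ∧ Metric.closedBall w r ⊆ U := by
  obtain ⟨r, hr, h⟩ := Metric.nhds_basis_closedBall.mem_iff.1 (hU.mem_nhds hw)
  exact ⟨min r 1, by positivity, min_le_right _ _,
    (Metric.closedBall_subset_closedBall (min_le_left _ _)).trans h⟩

open Polynomial in
theorem eval_zero_iterate_derivative_monomial (j k : ℕ) :
    (derivative^[k] (monomial j (1 / (j.factorial : ℝ)))).eval 0 = if j = k then 1 else 0 := by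
  rw [← coeff_zero_eq_eval_zero, coeff_iterate_derivative, zero_add, Nat.descFactorial_self,
    coeff_monomial, nsmul_eq_mul]
  split_ifs with h
  · subst h
    field_simp
  · simp

open Polynomial in
/-- Taylor's formula in the last variable. -/
theorem exists_norm_sub_taylor_le {E F : Type*} [NormedAddCommGroup E] [NormedSpace ℝ E]
    [ProperSpace E] [NormedAddCommGroup F] [NormedSpace ℝ F] {U : Set (E × ℝ)} (hU : IsOpen U)
    {G : E × ℝ → F} (hG : ContDiffOn ℝ ∞ G U) {w : E × ℝ} (hw : w ∈ U) (N : ℕ) :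
    ∃ K r : ℝ, 0 ≤ K ∧ 0 < r ∧ ∀ θ : ℝ, |θ| ≤ r →
      ‖G (w.1, w.2 + θ) - ∑ j ∈ Finset.range N, (θ ^ j / j.factorial) • dlast^[j] G w‖ ≤
        K * |θ| ^ N := by
  obtain ⟨r, hr, -, hrU⟩ := exists_closedBall_subset hU hw
  obtain ⟨K, hK, hb⟩ := exists_norm_le_on_closedBall (contDiffOn_iterate_dlast hU hG N) hrU
  refine ⟨K, r, hK, hr, fun θ hθ => ?_⟩
  have hmem : ∀ t ∈ Icc (-r) r, (w.1, w.2 + t) ∈ Metric.closedBall w r := fun t ht =>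
    mk_mem_closedBall (x₀ := w.1) (ψ := w.2) (by simpa using hr.le) (abs_le.2 ht)
  have j1 : IsJet (fun k t => dlast^[k] G (w.1, w.2 + t)) N (Icc (-r) r) :=
    isJet_iterate_dlast hU hG (fun t ht => hrU (hmem t ht)) N
  have j2 : IsJet (fun k t => ∑ j ∈ Finset.range N,
      ((derivative^[k] (monomial j (1 / (j.factorial : ℝ)))).eval t) • dlast^[j] G w) N
      (Icc (-r) r) := by
    intro k hk t ht
    refine HasDerivAt.fun_sum fun j _ => ?_
    exact (isJet_eval_iterate_derivative _ N (Icc (-r) r) k hk t ht).smul_const _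
  have h0 : (0 : ℝ) ∈ Icc (-r) r := ⟨by linarith, hr.le⟩
  have := (j1.sub j2).norm_le_pow h0 (K := K) (fun t ht => by
      rw [Finset.sum_eq_zero, sub_zero]
      · exact hb _ (hmem t ht)
      · intro j hj
        rw [iterate_derivative_eq_zero, eval_zero, zero_smul]
        exact (natDegree_monomial_le _).trans_lt (Finset.mem_range.1 hj)) (fun k hk => by
      simp only [eval_zero_iterate_derivative_monomial, add_zero]
      rw [Finset.sum_eq_single k (fun j _ hj => by rw [if_neg hj, zero_smul])
        (fun h => absurd (Finset.mem_range.2 hk) h), if_pos rfl, one_smul, sub_self])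
    0 (Nat.zero_le _) θ (abs_le.1 hθ)
  simpa [eval_monomial, div_eq_inv_mul] using this

/-- Expansion of `x - X` along a curve `τ = const` when the first derivatives vanish. -/
theorem exists_norm_position_sub_le {Ω : Set (ℝ × ℝ)} (hΩ : IsOpen Ω) {X : ℝ × ℝ → Plane}
    (hX : ContDiffOn ℝ ∞ X Ω) {a : ℝ × ℝ} (ha : a ∈ Ω) (m : ℕ)
    (hz : ∀ k, 1 ≤ k → k ≤ m + 1 → dlast^[k] X a = 0) :
    ∃ K r : ℝ, 0 ≤ K ∧ 0 < r ∧ ∀ θ : ℝ, |θ| ≤ r →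
      ‖X (a.1, a.2 + θ) - X a‖ ≤ K * |θ| ^ (m + 2) ∧
      ‖X (a.1, a.2 + θ) - X a - (θ ^ (m + 2) / (m + 2).factorial) • dlast^[m + 2] X a‖ ≤
        K * |θ| ^ (m + 3) := by
  have hsum : ∀ (θ : ℝ) (N : ℕ), N ≤ m + 1 →
      ∑ j ∈ Finset.range (N + 1), (θ ^ j / j.factorial) • dlast^[j] X a = X a := by
    intro θ N hN
    rw [Finset.sum_range_succ', Finset.sum_eq_zero]
    · simp
    · intro j hj
      have := Finset.mem_range.1 hj
      rw [hz (j + 1) (by omega) (by omega), smul_zero]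
  obtain ⟨K₁, r₁, hK₁, hr₁, h₁⟩ := exists_norm_sub_taylor_le hΩ hX ha (m + 2)
  obtain ⟨K₂, r₂, hK₂, hr₂, h₂⟩ := exists_norm_sub_taylor_le hΩ hX ha (m + 3)
  refine ⟨max K₁ K₂, min r₁ r₂, le_max_of_le_left hK₁, by positivity, fun θ hθ => ⟨?_, ?_⟩⟩
  · have := h₁ θ (hθ.trans (min_le_left _ _))
    rw [hsum θ (m + 1) le_rfl] at this
    refine this.trans ?_
    gcongr
    exact le_max_left _ _
  · have := h₂ θ (hθ.trans (min_le_right _ _))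
    rw [Finset.sum_range_succ, hsum θ (m + 1) le_rfl, ← sub_sub] at this
    refine this.trans ?_
    gcongr
    exact le_max_right _ _

/-- Expansion of `⟨P, X* - X⟩` along the curve `τ = τ*` through the focal point. -/
theorem IsEikonalCoordinateSystem.exists_abs_inner_add_le {L : Set (Plane × Plane)}
    {Ω : Set (ℝ × ℝ)} {X P : ℝ × ℝ → Plane} (h : IsEikonalCoordinateSystem L Ω X P) {a : ℝ × ℝ}
    (ha : a ∈ Ω) (m : ℕ) (hz : ∀ k, 1 ≤ k → k ≤ m + 1 → dlast^[k] X a = 0) :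
    ∃ K r : ℝ, 0 ≤ K ∧ 0 < r ∧ ∀ θ : ℝ, |θ| ≤ r →
      |inner ℝ (P (a.1, a.2 + θ)) (X a - X (a.1, a.2 + θ)) +
        inner ℝ (dpsi P a) (dlast^[m + 2] X a) * θ ^ (m + 3) / (m + 3).factorial| ≤
        K * |θ| ^ (m + 4) := by
  obtain ⟨K₁, r₁, hK₁, hr₁, h₁⟩ := exists_norm_position_sub_le h.isOpen h.smooth_X ha m hz
  obtain ⟨K₂, r₂, hK₂, hr₂, h₂⟩ :=
    exists_norm_sub_taylor_le h.isOpen (contDiffOn_dlast h.isOpen h.smooth_P) ha 1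
  obtain ⟨r₃, hr₃, -, hΩ⟩ := exists_closedBall_subset h.isOpen ha
  set u := dlast^[m + 2] X a with hu
  set c := inner ℝ (dpsi P a) u with hc
  refine ⟨‖dpsi P a‖ * K₁ + K₂ * K₁, min r₁ (min r₂ r₃), by positivity, by positivity,
    fun θ hθ => ?_⟩
  have hsub : ∀ t ∈ uIcc 0 θ, |t| ≤ |θ| := fun t ht => by simpa using abs_sub_left_of_mem_uIcc ht
  -- The Pfaff equation removes ⟨P, X_ψ⟩ from the derivative and leaves -⟨P_ψ, X - X*⟩, for which
  -- the leading terms of P_ψ and X suffice; the estimate is then integrated.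
  have hd : ∀ t ∈ uIcc 0 θ, HasDerivWithinAt (fun t => inner ℝ (P (a.1, a.2 + t))
      (X a - X (a.1, a.2 + t)) + c * t ^ (m + 3) / (m + 3).factorial)
      (-inner ℝ (dlast P (a.1, a.2 + t)) (X (a.1, a.2 + t) - X a) +
        c * t ^ (m + 2) / (m + 2).factorial) (uIcc 0 θ) t := by
    intro t ht
    have htΩ : (a.1, a.2 + t) ∈ Ω := hΩ (mk_mem_closedBall (x₀ := a.1) (ψ := a.2)
      (by simpa using hr₃.le)
      ((hsub t ht).trans (hθ.trans ((min_le_right _ _).trans (min_le_right _ _)))))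
    have dP := (hasDerivAt_dlast h.isOpen h.smooth_P htΩ).comp_const_add a.2 t
    have dX := (hasDerivAt_dlast h.isOpen h.smooth_X htΩ).comp_const_add a.2 t
    have d1 := dP.inner ℝ (dX.const_sub (X a))
    have d2 := ((hasDerivAt_pow (m + 3) t).const_mul c).div_const ((m + 3).factorial : ℝ)
    refine (d1.fun_add d2).hasDerivWithinAt.congr_deriv ?_
    have e1 : inner ℝ (P (a.1, a.2 + t)) (dlast X (a.1, a.2 + t)) = 0 := h.inner_dpsi htΩ
    rw [inner_neg_right, e1, ← inner_neg_right, neg_sub, neg_zero, zero_add,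
      Nat.factorial_succ (m + 2)]
    simp only [Nat.add_one_sub_one]
    push_cast
    field_simp
    ring
  have hb : ∀ t ∈ uIcc 0 θ, ‖-inner ℝ (dlast P (a.1, a.2 + t)) (X (a.1, a.2 + t) - X a) +
        c * t ^ (m + 2) / (m + 2).factorial‖ ≤ (‖dpsi P a‖ * K₁ + K₂ * K₁) * |θ| ^ (m + 3) := by
    intro t ht
    have htθ := hsub t ht
    obtain ⟨b1, b2⟩ := h₁ t (htθ.trans (hθ.trans (min_le_left _ _)))
    have b3 := h₂ t (htθ.trans (hθ.trans ((min_le_right _ _).trans (min_le_left _ _))))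
    simp only [Finset.sum_range_one, pow_zero, Nat.factorial_zero, Nat.cast_one, div_one, one_smul,
      Function.iterate_zero, id, pow_one] at b3
    have e : -inner ℝ (dlast P (a.1, a.2 + t)) (X (a.1, a.2 + t) - X a) +
        c * t ^ (m + 2) / (m + 2).factorial =
        -(inner ℝ (dpsi P a) (X (a.1, a.2 + t) - X a - (t ^ (m + 2) / (m + 2).factorial) • u)) -
        inner ℝ (dlast P (a.1, a.2 + t) - dlast P a) (X (a.1, a.2 + t) - X a) := by
      rw [inner_sub_right (dpsi P a), inner_smul_right, inner_sub_left, hc, dpsi_eq_dlast]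
      ring
    rw [e]
    refine (norm_sub_le _ _).trans ?_
    rw [norm_neg]
    have i1 := norm_inner_le_norm (𝕜 := ℝ) (dpsi P a)
      (X (a.1, a.2 + t) - X a - (t ^ (m + 2) / (m + 2).factorial) • u)
    have i2 := norm_inner_le_norm (𝕜 := ℝ) (dlast P (a.1, a.2 + t) - dlast P a)
      (X (a.1, a.2 + t) - X a)
    calc _ ≤ ‖dpsi P a‖ * (K₁ * |t| ^ (m + 3)) + K₂ * |t| * (K₁ * |t| ^ (m + 2)) := by
          refine add_le_add (i1.trans (by gcongr)) (i2.trans ?_)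
          exact mul_le_mul b3 b1 (norm_nonneg _) (by positivity)
      _ = (‖dpsi P a‖ * K₁ + K₂ * K₁) * |t| ^ (m + 3) := by ring
      _ ≤ _ := by gcongr
  have := Convex.norm_image_sub_le_of_norm_hasDerivWithin_le hd hb (convex_uIcc 0 θ)
    left_mem_uIcc right_mem_uIcc
  simp only [add_zero, sub_self, inner_zero_right, Real.norm_eq_abs, sub_zero, ne_eq,
    Nat.add_eq_zero_iff, OfNat.ofNat_ne_zero, and_false, not_false_eq_true, zero_pow, mul_zero,
    zero_div] at this
  exact this.trans (le_of_eq (by ring))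

theorem mul_add_mul_add_mul_le {α β γ p q r : ℝ} (hα : 0 ≤ α) (hβ : 0 ≤ β) (hγ : 0 ≤ γ) (hp : 0 ≤ p)
    (hq : 0 ≤ q) (hr : 0 ≤ r) : α * p + β * q + γ * r ≤ (α + β + γ) * (p + q + r) := by
  have : 0 ≤ α * (q + r) + β * (p + r) + γ * (p + q) := by positivity
  linarith

set_option maxHeartbeats 800000 in
/-- The phase function near the focal point. -/
theorem exists_abs_phase_sub_le {L : Set (Plane × Plane)} {Ω : Set (ℝ × ℝ)} {X P : ℝ × ℝ → Plane}
    (h : IsEikonalCoordinateSystem L Ω X P) {a : ℝ × ℝ} (ha : a ∈ Ω) (m : ℕ)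
    (hz : ∀ k, 1 ≤ k → k ≤ m + 1 → dlast^[k] X a = 0) {W : Set (Plane × ℝ)} {T : Plane × ℝ → ℝ}
    (hT : IsPhaseFunction Ω X P a W T) :
    ∃ K r : ℝ, 0 ≤ K ∧ 0 < r ∧ ∀ (x : Plane) (θ : ℝ), ‖x - X a‖ ≤ r → |θ| ≤ r →
      |T (x, a.2 + θ) - (a.1 + inner ℝ (P a) (x - X a) + inner ℝ (dpsi P a) (x - X a) * θ -
        inner ℝ (dpsi P a) (dlast^[m + 2] X a) * θ ^ (m + 3) / (m + 3).factorial)| ≤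
      K * ((‖x - X a‖ + |θ| ^ (m + 2)) ^ 2 + ‖x - X a‖ * θ ^ 2 + |θ| ^ (m + 4)) := by
  obtain ⟨K₁, r₁, hK₁, hr₁, h₁⟩ := exists_norm_position_sub_le h.isOpen h.smooth_X ha m hz
  obtain ⟨K₂, r₂, hK₂, hr₂, h₂⟩ := exists_norm_sub_taylor_le h.isOpen h.smooth_P ha 2
  obtain ⟨K₃, r₃, hK₃, hr₃, h₃⟩ := h.exists_abs_inner_add_le ha m hz
  obtain ⟨ρ₀, hρ₀, -, hΩ₀⟩ := exists_closedBall_subset h.isOpen ha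
  obtain ⟨D₁, hD₁, hP⟩ := exists_norm_le_on_closedBall h.smooth_P hΩ₀
  obtain ⟨D₂, hD₂, hPt⟩ := exists_norm_le_on_closedBall (contDiffOn_dtau h.isOpen h.smooth_P) hΩ₀
  obtain ⟨D₃, hD₃, hXt⟩ := exists_norm_le_on_closedBall (contDiffOn_dtau h.isOpen h.smooth_X) hΩ₀
  obtain ⟨D, hD, hDK, hDX, hD2, hD1⟩ : ∃ D : ℝ, 0 < D ∧ D₂ * (1 + K₁) ≤ D ∧ D₂ * D₃ ≤ D ∧ D₂ ≤ D ∧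
      D₁ * (1 + K₁) ≤ D := by
    refine ⟨D₂ * (1 + K₁) + D₂ * D₃ + D₂ + D₁ * (1 + K₁) + 1, by positivity, ?_, ?_, ?_, ?_⟩
    all_goals
      have p1 : 0 ≤ D₂ * (1 + K₁) := by positivity
      have p2 : 0 ≤ D₂ * D₃ := by positivity
      have p3 : 0 ≤ D₁ * (1 + K₁) := by positivity
      linarith
  -- Below, s ≤ 2ρ and d ≤ ρ, so D(s + d) ≤ 1/2 and the term quadratic in d can be absorbed.
  obtain ⟨ρ, hρ, hρ₀', hρD⟩ : ∃ ρ : ℝ, 0 < ρ ∧ ρ ≤ ρ₀ ∧ D * (3 * ρ) ≤ 1 / 2 := by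
    refine ⟨min ρ₀ (1 / (6 * D)), by positivity, min_le_left _ _, ?_⟩
    calc D * (3 * min ρ₀ (1 / (6 * D))) ≤ D * (3 * (1 / (6 * D))) := by
          gcongr; exact min_le_right _ _
      _ = 1 / 2 := by field_simp; norm_num
  have hcont : ContinuousAt T (X a, a.2) :=
    hT.smooth.continuousOn.continuousAt (hT.isOpen.mem_nhds hT.base_mem)
  have hev : ∀ᶠ w in 𝓝 (X a, a.2), w ∈ W ∧ |T w - a.1| ≤ ρ := by
    refine (hT.isOpen.eventually_mem hT.base_mem).and ?_
    have := hcont.eventually (Metric.closedBall_mem_nhds (T (X a, a.2)) hρ)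
    rw [hT.base_eq] at this
    exact this
  obtain ⟨r₄, hr₄, h₄⟩ := Metric.nhds_basis_closedBall.mem_iff.1 hev
  refine ⟨D * (1 + 2 * D) * (2 * D) + K₂ + K₃, min (min 1 ρ) (min (min r₁ r₂) (min r₃ r₄)),
    by positivity, by positivity, fun x θ hx hθ => ?_⟩
  simp only [le_min_iff] at hx hθ
  obtain ⟨⟨hx1, hxρ⟩, ⟨-, -⟩, -, hxr₄⟩ := hx
  obtain ⟨⟨hθ1, hθρ⟩, ⟨hθr₁, hθr₂⟩, hθr₃, hθr₄⟩ := hθ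
  obtain ⟨hW, hTρ⟩ := h₄ (mk_mem_closedBall hxr₄ hθr₄)
  have hball : ∀ τ, |τ - a.1| ≤ ρ → (τ, a.2 + θ) ∈ Metric.closedBall a ρ₀ := fun τ hτ =>
    mk_mem_closedBall (x₀ := a.1) (ψ := a.2) (by simpa using hτ.trans hρ₀') (hθρ.trans hρ₀')
  set z := x - X a with hzdef
  set ψ := a.2 + θ with hψ
  set d := |T (x, ψ) - a.1| with hd
  have hd0 : 0 ≤ d := abs_nonneg _
  set s := ‖z‖ + |θ| ^ (m + 2) with hs
  have hs0 : 0 ≤ s := by positivity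
  have hsub : ∀ τ ∈ uIcc a.1 (T (x, ψ)), |τ - a.1| ≤ d := fun τ hτ => abs_sub_left_of_mem_uIcc hτ
  have hpos0 : ‖x - X (a.1, ψ)‖ ≤ (1 + K₁) * s := by
    have e : x - X (a.1, ψ) = z - (X (a.1, ψ) - X a) := by rw [hzdef]; abel
    rw [e]
    refine (norm_sub_le _ _).trans ((add_le_add_right (h₁ θ hθr₁).1 _).trans ?_)
    have : 0 ≤ K₁ * ‖z‖ := by positivity
    have : 0 ≤ |θ| ^ (m + 2) := by positivity
    rw [hs]
    nlinarith
  have hpos : ∀ τ ∈ uIcc a.1 (T (x, ψ)), ‖x - X (τ, ψ)‖ ≤ (1 + K₁) * s + D₃ * d := by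
    intro τ hτ
    have hmv := Convex.norm_image_sub_le_of_norm_hasDerivWithin_le (f := fun τ => X (τ, ψ))
      (f' := fun τ => dtau X (τ, ψ)) (s := uIcc a.1 (T (x, ψ))) (x := a.1) (y := τ) (C := D₃)
      (fun t ht => (hasDerivAt_dtau h.isOpen h.smooth_X
        (hΩ₀ (hball t ((hsub t ht).trans hTρ)))).hasDerivWithinAt)
      (fun t ht => hXt _ (hball t ((hsub t ht).trans hTρ))) (convex_uIcc _ _) left_mem_uIcc hτ
    have e : x - X (τ, ψ) = (x - X (a.1, ψ)) - (X (τ, ψ) - X (a.1, ψ)) := by abel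
    rw [e]
    refine (norm_sub_le _ _).trans (add_le_add hpos0 (hmv.trans ?_))
    gcongr
    exact hsub τ hτ
  -- Since ⟨P, X_τ⟩ = 1, the function ⟨P, x - X⟩ + τ of τ has the small derivative ⟨P_τ, x - X⟩. Its
  -- value at τ = `T (x, ψ)` is `T (x, ψ)` by the defining equation, so comparison with τ = τ* is
  -- one Newton step.
  have hmain : |T (x, ψ) - a.1 - inner ℝ (P (a.1, ψ)) (x - X (a.1, ψ))| ≤ D * (s + d) * d := by
    have hder : ∀ τ ∈ uIcc a.1 (T (x, ψ)), HasDerivWithinAt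
        (fun τ => inner ℝ (P (τ, ψ)) (x - X (τ, ψ)) + τ)
        (inner ℝ (dtau P (τ, ψ)) (x - X (τ, ψ))) (uIcc a.1 (T (x, ψ))) τ := by
      intro τ hτ
      have hτΩ := hΩ₀ (hball τ ((hsub τ hτ).trans hTρ))
      have d1 := (hasDerivAt_dtau h.isOpen h.smooth_P hτΩ).inner ℝ
        ((hasDerivAt_dtau h.isOpen h.smooth_X hτΩ).const_sub x)
      refine (d1.fun_add (hasDerivAt_id' τ)).hasDerivWithinAt.congr_deriv ?_
      rw [inner_neg_right, h.inner_dtau hτΩ]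
      ring
    have hbd : ∀ τ ∈ uIcc a.1 (T (x, ψ)), ‖(inner ℝ (dtau P (τ, ψ)) (x - X (τ, ψ)) : ℝ)‖ ≤
        D * (s + d) := by
      intro τ hτ
      refine (norm_inner_le_norm _ _).trans ?_
      calc _ ≤ D₂ * ((1 + K₁) * s + D₃ * d) :=
            mul_le_mul (hPt _ (hball τ ((hsub τ hτ).trans hTρ))) (hpos τ hτ) (norm_nonneg _) hD₂
        _ = D₂ * (1 + K₁) * s + D₂ * D₃ * d := by ring
        _ ≤ D * s + D * d := by gcongr
        _ = _ := by ring
    have := Convex.norm_image_sub_le_of_norm_hasDerivWithin_le hder hbd (convex_uIcc _ _)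
      left_mem_uIcc right_mem_uIcc
    rw [hT.eqn _ hW, Real.norm_eq_abs, Real.norm_eq_abs] at this
    refine le_of_eq_of_le ?_ this
    congr 1
    ring
  have hg : |inner ℝ (P (a.1, ψ)) (x - X (a.1, ψ))| ≤ D * s := by
    refine (abs_real_inner_le_norm _ _).trans ?_
    calc _ ≤ D₁ * ((1 + K₁) * s) :=
          mul_le_mul (hP _ (hball a.1 (by simpa using hρ.le))) hpos0 (norm_nonneg _) hD₁
      _ = D₁ * (1 + K₁) * s := by ring
      _ ≤ _ := by gcongr
  have hθm : |θ| ^ (m + 2) ≤ ρ :=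
    (pow_le_of_le_one (abs_nonneg θ) hθ1 (by omega)).trans hθρ
  -- Here d ≤ D s + d/2.
  have hds : d ≤ 2 * (D * s) := by
    have h5 : D * (s + d) ≤ 1 / 2 := by
      refine le_trans ?_ hρD
      gcongr
      rw [hs]
      linarith
    have h6 := abs_sub_abs_le_abs_sub (T (x, ψ) - a.1) (inner ℝ (P (a.1, ψ)) (x - X (a.1, ψ)))
    have h7 : D * (s + d) * d ≤ 1 / 2 * d := by gcongr
    linarith
  have hA : |T (x, ψ) - a.1 - inner ℝ (P (a.1, ψ)) (x - X (a.1, ψ))| ≤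
      D * (1 + 2 * D) * (2 * D) * s ^ 2 := by
    refine hmain.trans ?_
    calc D * (s + d) * d ≤ D * (s + 2 * (D * s)) * (2 * (D * s)) := by gcongr
      _ = _ := by ring
  have hB := h₂ θ hθr₂
  rw [← hψ] at hB
  simp only [Finset.sum_range_succ, Finset.sum_range_zero, pow_zero, Nat.factorial_zero,
    Nat.cast_one, div_one, one_smul, Function.iterate_zero, id, pow_one, zero_add,
    Nat.factorial_one, Function.iterate_one] at hB
  have hB' : |inner ℝ (P (a.1, ψ) - (P a + θ • dlast P a)) z| ≤ K₂ * (‖z‖ * θ ^ 2) := by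
    refine (abs_real_inner_le_norm _ _).trans ?_
    calc _ ≤ K₂ * |θ| ^ 2 * ‖z‖ := by gcongr
      _ = _ := by rw [sq_abs]; ring
  have hC := h₃ θ hθr₃
  rw [← hψ] at hC
  have e : T (x, ψ) - (a.1 + inner ℝ (P a) z + inner ℝ (dpsi P a) z * θ -
        inner ℝ (dpsi P a) (dlast^[m + 2] X a) * θ ^ (m + 3) / (m + 3).factorial) =
      (T (x, ψ) - a.1 - inner ℝ (P (a.1, ψ)) (x - X (a.1, ψ))) +
      inner ℝ (P (a.1, ψ) - (P a + θ • dlast P a)) z +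
      (inner ℝ (P (a.1, ψ)) (X a - X (a.1, ψ)) +
        inner ℝ (dpsi P a) (dlast^[m + 2] X a) * θ ^ (m + 3) / (m + 3).factorial) := by
    have e1 : x - X (a.1, ψ) = z + (X a - X (a.1, ψ)) := by rw [hzdef]; abel
    rw [e1, inner_add_right, inner_sub_left, inner_add_left, real_inner_smul_left, dpsi_eq_dlast]
    ring
  rw [e]
  refine (abs_add_le _ _).trans ((add_le_add ((abs_add_le _ _).trans (add_le_add hA hB')) hC).trans ?_)
  exact mul_add_mul_add_mul_le (by positivity) hK₂ hK₃ (by positivity) (by positivity)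
    (by positivity)

/-! ### The integral of the singular chart. -/

/-- The amplitude of the integral of the singular chart. -/
noncomputable def chartAmplitude (P : ℝ × ℝ → Plane) (T : Plane × ℝ → ℝ) (A : ℝ × ℝ → ℂ)
    (w : Plane × ℝ) : ℂ :=
  A (T w, w.2) * (√|det2 (P (T w, w.2)) (dpsi P (T w, w.2))| : ℝ)

theorem singularIntegrand_eq (P : ℝ × ℝ → Plane) (T : Plane × ℝ → ℝ) (A : ℝ × ℝ → ℂ) (h : ℝ)
    (x : Plane) (ψ : ℝ) : singularIntegrand P T A h x ψ =
      Complex.exp (Complex.I / h * T (x, ψ)) * chartAmplitude P T A (x, ψ) := by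
  rw [singularIntegrand, chartAmplitude, mul_assoc]

/-- The root of |det(P, P_ψ)| is smooth only away from zeros of the determinant, so the
neighbourhood avoids them. It is chosen before the amplitude. -/
theorem exists_isOpen_contDiffOn_chartAmplitude {L : Set (Plane × Plane)} {Ω : Set (ℝ × ℝ)}
    {X P : ℝ × ℝ → Plane} (h : IsEikonalCoordinateSystem L Ω X P) {a : ℝ × ℝ}
    (hdet : det2 (P a) (dpsi P a) ≠ 0) {W : Set (Plane × ℝ)} {T : Plane × ℝ → ℝ}
    (hT : IsPhaseFunction Ω X P a W T) :
    ∃ U : Set (Plane × ℝ), IsOpen U ∧ U ⊆ W ∧ (X a, a.2) ∈ U ∧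
      ∀ A : ℝ × ℝ → ℂ, ContDiff ℝ ∞ A → ContDiffOn ℝ ∞ (chartAmplitude P T A) U := by
  have hQ : ContDiffOn ℝ ∞ (fun w => (T w, w.2)) W := hT.smooth.prodMk contDiff_snd.contDiffOn
  have hPT : ContDiffOn ℝ ∞ (fun w => P (T w, w.2)) W := h.smooth_P.comp hQ hT.maps
  have hPT' : ContDiffOn ℝ ∞ (fun w => dpsi P (T w, w.2)) W :=
    (contDiffOn_dlast h.isOpen h.smooth_P).comp hQ hT.maps
  have hcoord : ∀ {f : Plane × ℝ → Plane}, ContDiffOn ℝ ∞ f W → ∀ i,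
      ContDiffOn ℝ ∞ (fun w => f w i) W := fun hf i =>
    (contDiffOn_piLp 2).1 hf i
  have hd : ContDiffOn ℝ ∞ (fun w => det2 (P (T w, w.2)) (dpsi P (T w, w.2))) W := by
    simp only [det2]
    exact ((hcoord hPT 0).mul (hcoord hPT' 1)).sub ((hcoord hPT 1).mul (hcoord hPT' 0))
  refine ⟨W ∩ (fun w => det2 (P (T w, w.2)) (dpsi P (T w, w.2))) ⁻¹' {0}ᶜ,
    hd.continuousOn.isOpen_inter_preimage hT.isOpen isOpen_compl_singleton, inter_subset_left,
    ⟨hT.base_mem, ?_⟩, fun A hA w hw => ?_⟩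
  · simpa [hT.base_eq] using hdet
  · have hw0 : det2 (P (T w, w.2)) (dpsi P (T w, w.2)) ≠ 0 := hw.2
    have hW := hT.isOpen.mem_nhds hw.1
    have h1 : ContDiffAt ℝ ∞ (fun w => √|det2 (P (T w, w.2)) (dpsi P (T w, w.2))|) w :=
      ((hd.contDiffAt hW).abs hw0).sqrt (abs_ne_zero.2 hw0)
    have h2 : ContDiffAt ℝ ∞ (fun w => A (T w, w.2)) w :=
      hA.contDiffAt.comp w (hQ.contDiffAt hW)
    exact (h2.mul (Complex.ofRealCLM.contDiff.contDiffAt.comp w h1)).contDiffWithinAt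

/-- The two halves of an integral over `[-δ, δ]` after rescaling. -/
theorem integral_eq_add_scaled (G : ℝ → ℂ) {μ ε δ : ℝ} (hμ : 0 < μ) (hε : 0 < ε)
    (hG1 : IntervalIntegrable G volume (-δ) 0) (hG2 : IntervalIntegrable G volume 0 δ) :
    ∫ θ in (-δ)..δ, G θ = ((μ * ε : ℝ) : ℂ) * ((∫ η in (0 : ℝ)..(δ / (|μ| * ε)), G (μ * ε * η)) +
      ∫ η in (0 : ℝ)..(δ / (|-μ| * ε)), G (-μ * ε * η)) := by
  have h1 : μ * ε ≠ 0 := by positivity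
  have h2 : -μ * ε ≠ 0 := by rw [neg_mul]; exact neg_ne_zero.2 h1
  rw [intervalIntegral.integral_comp_mul_left G h1, intervalIntegral.integral_comp_mul_left G h2,
    abs_neg, abs_of_pos hμ, mul_zero, mul_zero]
  have e1 : μ * ε * (δ / (μ * ε)) = δ := by field_simp
  have e2 : -μ * ε * (δ / (μ * ε)) = -δ := by field_simp
  rw [e1, e2, ← intervalIntegral.integral_add_adjacent_intervals hG1 hG2,
    intervalIntegral.integral_symm (-δ) 0]
  simp only [Complex.real_smul]
  have h1' : (μ : ℂ) ≠ 0 := by exact_mod_cast hμ.ne'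
  have h1'' : (ε : ℂ) ≠ 0 := by exact_mod_cast hε.ne'
  push_cast
  field_simp
  ring

set_option maxHeartbeats 1000000 in
/-- The integral of the singular chart at a focal point of order `m` in terms of the half-line
model integrals. -/
theorem exists_norm_integral_singularIntegrand_sub_le {L : Set (Plane × Plane)} {Ω : Set (ℝ × ℝ)}
    {X P : ℝ × ℝ → Plane} (h : IsEikonalCoordinateSystem L Ω X P) {a : ℝ × ℝ} (ha : a ∈ Ω) (m : ℕ)
    (hz : ∀ k, 1 ≤ k → k ≤ m + 1 → dlast^[k] X a = 0) {c : ℝ}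
    (hcdef : inner ℝ (dpsi P a) (dlast^[m + 2] X a) = c) (hc : c ≠ 0)
    (horth : inner ℝ (P a) (dpsi P a) = 0) (hP1 : dpsi P a ≠ 0) {W : Set (Plane × ℝ)}
    {T : Plane × ℝ → ℝ} (hT : IsPhaseFunction Ω X P a W T) {μ : ℝ} (hμ : 0 < μ) :
    ∃ N ∈ 𝓝 a, ∀ A : ℝ × ℝ → ℂ, ContDiff ℝ ∞ A → tsupport A ⊆ N → ∀ C ≥ 0,
      ∃ K ε₀ : ℝ, 0 < ε₀ ∧ ∀ (ε : ℝ) (x : Plane), 0 < ε → ε < ε₀ →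
        ‖x - X a‖ ≤ C * ε ^ (m + 2) →
        IntegrableOn (singularIntegrand P T A (ε ^ (m + 3)) x) {ψ : ℝ | (x, ψ) ∈ W} ∧
        ∀ (v : ℝ) (J₁ J₂ : ℂ), |v| ≤ C * ε →
          Tendsto (halfTrunc m (μ * (inner ℝ (dpsi P a) (x - X a) / ε ^ (m + 2))) v
            (-c * μ ^ (m + 3) / (m + 3).factorial)) atTop (𝓝 J₁) →
          Tendsto (halfTrunc m (-μ * (inner ℝ (dpsi P a) (x - X a) / ε ^ (m + 2))) v
            (-c * (-μ) ^ (m + 3) / (m + 3).factorial)) atTop (𝓝 J₂) →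
          ‖(∫ ψ in {ψ : ℝ | (x, ψ) ∈ W}, singularIntegrand P T A (ε ^ (m + 3)) x ψ) -
            ((μ * ε : ℝ) : ℂ) * Complex.exp (Complex.I / ((ε ^ (m + 3) : ℝ) : ℂ) *
              (a.1 + inner ℝ (P a) (x - X a) : ℝ)) *
            (A a * (√(‖P a‖ * ‖dpsi P a‖) : ℝ)) * (J₁ + J₂)‖ ≤ K * ε ^ 2 := by
  have hP0 := h.ne_zero ha
  have habsdet := abs_det2_of_inner_eq_zero horth
  have hdet : det2 (P a) (dpsi P a) ≠ 0 := by
    rw [← abs_pos, habsdet]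
    positivity
  obtain ⟨U, hU, hUW, hbase, hamp⟩ := exists_isOpen_contDiffOn_chartAmplitude h hdet hT
  obtain ⟨K₁, r₁, hK₁, hr₁, hphase⟩ := exists_abs_phase_sub_le h ha m hz hT
  rw [hcdef] at hphase
  obtain ⟨r₂, hr₂, hr₂1, hr₂U⟩ := exists_closedBall_subset hU hbase
  obtain ⟨r, hr, hrr₁, hrU⟩ : ∃ r : ℝ, 0 < r ∧ r ≤ r₁ ∧
      Metric.closedBall (X a, a.2) r ⊆ U :=
    ⟨min r₁ r₂, by positivity, min_le_left _ _,
      (Metric.closedBall_subset_closedBall (min_le_right _ _)).trans hr₂U⟩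
  have hTU : ContDiffOn ℝ ∞ T U := hT.smooth.mono hUW
  obtain ⟨D, hD, hDb⟩ := exists_norm_le_on_closedBall (contDiffOn_iterate_dlast hU hTU (m + 4)) hrU
  obtain ⟨δ₁, hδ₁, hcore₁⟩ := exists_norm_half_integral_sub_le m hc hμ.ne' hr hD
  -- The half θ < 0 is treated as the half η > 0 with -μ in place of μ.
  obtain ⟨δ₂, hδ₂, hcore₂⟩ := exists_norm_half_integral_sub_le m hc (neg_ne_zero.2 hμ.ne') hr hD
  obtain ⟨δ, hδ, hδδ₁, hδδ₂, hδr⟩ : ∃ δ : ℝ, 0 < δ ∧ δ ≤ δ₁ ∧ δ ≤ δ₂ ∧ δ ≤ r :=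
    ⟨min δ₁ (min δ₂ r), by positivity, min_le_left _ _,
      (min_le_right _ _).trans (min_le_left _ _), (min_le_right _ _).trans (min_le_right _ _)⟩
  -- Restricting ψ already makes the amplitude vanish for |θ| ≥ δ/2, whatever the value of τ(x, ψ).
  refine ⟨Metric.ball a (δ / 2), Metric.ball_mem_nhds _ (by positivity), ?_⟩
  intro A hA hsupp C hC
  have hA0 : ∀ w : Plane × ℝ, δ / 2 ≤ |w.2 - a.2| → chartAmplitude P T A w = 0 := by
    intro w hw
    have : A (T w, w.2) = 0 := by
      by_contra h0
      have h1 := hsupp (subset_tsupport A h0)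
      rw [mem_ball_iff_norm, Prod.norm_def] at h1
      have h2 := (le_max_right _ _).trans_lt h1
      simp only [Prod.snd_sub, Real.norm_eq_abs] at h2
      linarith
    rw [chartAmplitude, this, zero_mul]
  have hAU := hamp A hA
  obtain ⟨D₁, hD₁, hD₁b⟩ := exists_norm_le_on_closedBall (contDiffOn_iterate_dlast hU hAU 1) hrU
  obtain ⟨D₂, hD₂, hD₂b⟩ := exists_norm_le_on_closedBall (contDiffOn_iterate_dlast hU hAU 2) hrU
  obtain ⟨Λ, hΛ⟩ := (hAU.mono hrU).exists_lipschitzOnWith (by simp)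
    (convex_closedBall (X a, a.2) r) (isCompact_closedBall (X a, a.2) r)
  obtain ⟨a₀, ha₀⟩ : ∃ a₀, chartAmplitude P T A (X a, a.2) = a₀ := ⟨_, rfl⟩
  obtain ⟨C', hC', hC1, hC2, hC3, hC4, hC5, hC6, hC7⟩ : ∃ C' : ℝ, 0 ≤ C' ∧ C ≤ C' ∧
      Λ * (C + 1) ≤ C' ∧ D₁ ≤ C' ∧ D₂ ≤ C' ∧ ‖a₀‖ ≤ C' ∧
      K₁ * ((C + μ ^ (m + 2)) ^ 2 + C * μ ^ 2 + μ ^ (m + 4)) ≤ C' ∧ ‖dpsi P a‖ * C ≤ C' := by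
    have p1 : 0 ≤ Λ * (C + 1) := mul_nonneg Λ.2 (by linarith)
    have p2 : 0 ≤ ‖dpsi P a‖ * C := by positivity
    have p3 : 0 ≤ K₁ * ((C + μ ^ (m + 2)) ^ 2 + C * μ ^ 2 + μ ^ (m + 4)) := by positivity
    have p4 := norm_nonneg a₀
    refine ⟨C + Λ * (C + 1) + D₁ + D₂ + ‖a₀‖ +
      K₁ * ((C + μ ^ (m + 2)) ^ 2 + C * μ ^ 2 + μ ^ (m + 4)) + ‖dpsi P a‖ * C, by positivity,
      ?_, ?_, ?_, ?_, ?_, ?_, ?_⟩ <;> linarith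
  obtain ⟨M₁, ε₁, hε₁, hm₁⟩ := hcore₁ δ hδ hδδ₁ C' hC'
  obtain ⟨M₂, ε₂, hε₂, hm₂⟩ := hcore₂ δ hδ hδδ₂ C' hC'
  refine ⟨μ * (M₁ + M₂), min (min 1 (r / (C + 1 + μ))) (min ε₁ ε₂), by positivity, ?_⟩
  intro ε x hε hεlt hx
  simp only [lt_min_iff] at hεlt
  obtain ⟨⟨hε1, hεr⟩, hεε₁, hεε₂⟩ := hεlt
  set z := x - X a with hzdef
  have hzε : ‖z‖ ≤ C * ε := hx.trans
    (mul_le_mul_of_nonneg_left (pow_le_of_le_one hε.le hε1.le (by omega)) hC)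
  have hzr : ‖z‖ ≤ r := by
    rw [lt_div_iff₀ (by linarith)] at hεr
    have : 0 ≤ ε * μ := by positivity
    linarith
  have hμr : μ * ε ≤ r := by
    rw [lt_div_iff₀ (by linarith)] at hεr
    have : 0 ≤ ε * C := by positivity
    linarith
  have hball : ∀ θ ∈ Icc (-r) r, (x, a.2 + θ) ∈ Metric.closedBall (X a, a.2) r := fun θ hθ =>
    mk_mem_closedBall hzr (abs_le.2 hθ)
  have hεm : 0 < ε ^ (m + 3) := by positivity
  set g : ℝ → ℂ := singularIntegrand P T A (ε ^ (m + 3)) x with hg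
  have hgz : ∀ ψ : ℝ, δ / 2 ≤ |ψ - a.2| → g ψ = 0 := fun ψ hψ => by
    rw [hg, singularIntegrand_eq, hA0 (x, ψ) hψ, mul_zero]
  have hgc : ContinuousOn (fun θ => g (a.2 + θ)) (Icc (-r) r) := by
    have hpath : ContinuousOn (fun θ : ℝ => (x, a.2 + θ)) (Icc (-r) r) := by fun_prop
    have h1 := hTU.continuousOn.comp hpath fun θ hθ => hrU (hball θ hθ)
    have h2 := hAU.continuousOn.comp hpath fun θ hθ => hrU (hball θ hθ)
    have h3 : ContinuousOn (fun θ : ℝ => (T (x, a.2 + θ) : ℂ)) (Icc (-r) r) :=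
      Complex.continuous_ofReal.comp_continuousOn h1
    simp only [hg, singularIntegrand_eq]
    exact ((continuousOn_const.mul h3).cexp).mul h2
  have hgi : ∀ α ∈ Icc (-r) r, ∀ β ∈ Icc (-r) r,
      IntervalIntegrable (fun θ => g (a.2 + θ)) volume α β := fun α hα β hβ =>
    (hgc.mono ((ordConnected_Icc).uIcc_subset hα hβ)).intervalIntegrable
  have hSopen : IsOpen {ψ : ℝ | (x, ψ) ∈ W} := hT.isOpen.preimage (by fun_prop)
  have hIS : Ioc (a.2 - δ) (a.2 + δ) ⊆ {ψ : ℝ | (x, ψ) ∈ W} := by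
    intro ψ hψ
    have := hball (ψ - a.2) ⟨by linarith [hψ.1], by linarith [hψ.2]⟩
    rw [add_sub_cancel] at this
    exact hUW (hrU this)
  have hgz' : ∀ ψ ∈ {ψ : ℝ | (x, ψ) ∈ W} \ Ioc (a.2 - δ) (a.2 + δ), g ψ = 0 := by
    rintro ψ ⟨-, hψ⟩
    refine hgz ψ ?_
    by_contra hlt
    push Not at hlt
    rw [abs_lt] at hlt
    exact hψ ⟨by linarith [hlt.1], by linarith [hlt.2]⟩
  have hint : IntegrableOn g (Ioc (a.2 - δ) (a.2 + δ)) := by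
    have h1 : ContinuousOn g (Icc (a.2 - δ) (a.2 + δ)) := by
      have h2 : ContinuousOn (fun ψ => g (a.2 + (ψ - a.2))) (Icc (a.2 - δ) (a.2 + δ)) :=
        hgc.comp (by fun_prop) fun ψ hψ => ⟨by linarith [hψ.1], by linarith [hψ.2]⟩
      simpa using h2
    exact h1.integrableOn_Icc.mono_set Ioc_subset_Icc_self
  refine ⟨hint.of_forall_sdiff_eq_zero hSopen.measurableSet hgz', ?_⟩
  intro v J₁ J₂ hv hJ₁ hJ₂
  have hIntEq : ∫ ψ in {ψ : ℝ | (x, ψ) ∈ W}, g ψ = ∫ θ in (-δ)..δ, g (a.2 + θ) := by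
    rw [setIntegral_eq_of_subset_of_forall_sdiff_eq_zero hSopen.measurableSet hIS hgz',
      ← intervalIntegral.integral_of_le (by linarith),
      intervalIntegral.integral_comp_add_left (fun ψ => g ψ)]
    rfl
  set t := a.1 + inner ℝ (P a) z with ht
  set y := inner ℝ (dpsi P a) z / ε ^ (m + 2) with hy
  have hyε : y * ε ^ (m + 2) = inner ℝ (dpsi P a) z := by rw [hy]; field_simp
  have hyC : |y| ≤ C' := by
    rw [hy, abs_div, abs_of_pos (by positivity : 0 < ε ^ (m + 2)), div_le_iff₀ (by positivity)]
    refine (abs_real_inner_le_norm _ _).trans ?_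
    calc ‖dpsi P a‖ * ‖z‖ ≤ ‖dpsi P a‖ * (C * ε ^ (m + 2)) := by gcongr
      _ = ‖dpsi P a‖ * C * ε ^ (m + 2) := by ring
      _ ≤ _ := by gcongr
  have hvC : |v| ≤ C' * ε := hv.trans (by gcongr)
  have hfj : IsJet (fun k θ => dlast^[k] T (x, a.2 + θ)) (m + 4) (Icc (-r) r) :=
    isJet_iterate_dlast hU hTU (fun θ hθ => hrU (hball θ hθ)) _
  have haj : IsJet (fun k θ => dlast^[k] (chartAmplitude P T A) (x, a.2 + θ)) 3 (Icc (-r) r) :=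
    isJet_iterate_dlast hU hAU (fun θ hθ => hrU (hball θ hθ)) _
  have hampLip : ∀ θ ∈ Icc (-r) r, ‖chartAmplitude P T A (x, a.2 + θ) - a₀‖ ≤ C' * (ε + |θ|) := by
    intro θ hθ
    rw [← ha₀]
    refine (hΛ.norm_sub_le (hball θ hθ) (Metric.mem_closedBall_self hr.le)).trans ?_
    have hn : ‖(x, a.2 + θ) - (X a, a.2)‖ ≤ C * ε + |θ| := by
      rw [Prod.mk_sub_mk, add_sub_cancel_left, Prod.norm_def]
      refine max_le ?_ ?_
      · exact hzε.trans (le_add_of_nonneg_right (abs_nonneg θ))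
      · exact le_add_of_nonneg_left (by positivity)
    have hn' : C * ε + |θ| ≤ (C + 1) * (ε + |θ|) := by
      have : 0 ≤ C * |θ| := by positivity
      nlinarith
    calc (Λ : ℝ) * ‖(x, a.2 + θ) - (X a, a.2)‖ ≤ Λ * ((C + 1) * (ε + |θ|)) := by
          gcongr; exact hn.trans hn'
      _ = Λ * (C + 1) * (ε + |θ|) := by ring
      _ ≤ _ := by gcongr
  have hexp : ∀ θ, |θ| ≤ μ * ε → |T (x, a.2 + θ) - (t + y * ε ^ (m + 2) * θ -
      c * θ ^ (m + 3) / (m + 3).factorial)| ≤ C' * ε ^ (m + 4) := by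
    intro θ hθ
    have hθr : θ ∈ Icc (-r) r := abs_le.1 (hθ.trans hμr)
    rw [hyε]
    refine (hphase x θ (hzr.trans hrr₁) ((abs_le.2 hθr).trans hrr₁)).trans ?_
    have hθ2 : θ ^ 2 ≤ (μ * ε) ^ 2 := by rw [← sq_abs]; gcongr
    calc K₁ * ((‖z‖ + |θ| ^ (m + 2)) ^ 2 + ‖z‖ * θ ^ 2 + |θ| ^ (m + 4))
        ≤ K₁ * ((C * ε ^ (m + 2) + (μ * ε) ^ (m + 2)) ^ 2 + C * ε ^ (m + 2) * (μ * ε) ^ 2 +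
            (μ * ε) ^ (m + 4)) := by gcongr
      -- The square has order ε^(2m+4) = ε^m ε^(m+4), so it is within the error even for m = 0.
      _ = K₁ * ((C + μ ^ (m + 2)) ^ 2 * ε ^ m + C * μ ^ 2 + μ ^ (m + 4)) * ε ^ (m + 4) := by ring
      _ ≤ K₁ * ((C + μ ^ (m + 2)) ^ 2 * 1 + C * μ ^ 2 + μ ^ (m + 4)) * ε ^ (m + 4) := by
          gcongr
          exact pow_le_one₀ hε.le hε1.le
      _ ≤ _ := by rw [mul_one]; gcongr
  have hD' : ∀ θ ∈ Icc (-r) r, |dlast^[m + 4] T (x, a.2 + θ)| ≤ D := fun θ hθ =>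
    hDb _ (hball θ hθ)
  have ha1 : ∀ θ ∈ Icc (-r) r, ‖dlast^[1] (chartAmplitude P T A) (x, a.2 + θ)‖ ≤ C' := fun θ hθ =>
    (hD₁b _ (hball θ hθ)).trans hC3
  have ha2 : ∀ θ ∈ Icc (-r) r, ‖dlast^[2] (chartAmplitude P T A) (x, a.2 + θ)‖ ≤ C' := fun θ hθ =>
    (hD₂b _ (hball θ hθ)).trans hC4
  have has : ∀ θ ∈ Icc (-r) r, δ / 2 ≤ |θ| → chartAmplitude P T A (x, a.2 + θ) = 0 :=
    fun θ _ hθ => hA0 _ (by simpa using hθ)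
  have R₁ := hm₁ ε _ _ a₀ J₁ t y v hε hεε₁ hfj hD' haj hampLip ha1 ha2 hC5 has
    (fun θ hθ => hexp θ (by rwa [abs_of_pos hμ] at hθ)) hyC hvC hJ₁
  have R₂ := hm₂ ε _ _ a₀ J₂ t y v hε hεε₂ hfj hD' haj hampLip ha1 ha2 hC5 has
    (fun θ hθ => hexp θ (by rwa [abs_neg, abs_of_pos hμ] at hθ)) hyC hvC hJ₂
  simp only [Function.iterate_zero, id] at R₁ R₂
  set e₀ := Complex.exp (Complex.I / ((ε ^ (m + 3) : ℝ) : ℂ) * (t : ℝ)) with he₀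
  have hfac : ∀ ν β : ℝ, ∫ η in (0 : ℝ)..β, g (a.2 + ν * ε * η) = e₀ *
      ∫ η in (0 : ℝ)..β, Complex.exp (Complex.I *
        ((T (x, a.2 + ν * ε * η) - t) / ε ^ (m + 3) : ℝ)) *
          chartAmplitude P T A (x, a.2 + ν * ε * η) := by
    intro ν β
    rw [← intervalIntegral.integral_const_mul]
    refine intervalIntegral.integral_congr fun η _ => ?_
    simp only [hg, singularIntegrand_eq, he₀]
    rw [← mul_assoc, ← Complex.exp_add]
    congr 2
    push_cast
    ring
  have hδmem : δ ∈ Icc (-r) r := ⟨by linarith, hδr⟩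
  have hδmem' : -δ ∈ Icc (-r) r := ⟨by linarith, by linarith⟩
  have h0mem : (0 : ℝ) ∈ Icc (-r) r := ⟨by linarith, hr.le⟩
  have ha₀' : A a * (√(‖P a‖ * ‖dpsi P a‖) : ℝ) = a₀ := by
    rw [← ha₀, chartAmplitude, hT.base_eq, habsdet]
  rw [hIntEq, integral_eq_add_scaled (fun θ => g (a.2 + θ)) hμ hε (hgi _ hδmem' _ h0mem)
    (hgi _ h0mem _ hδmem), hfac, hfac, ha₀']
  have hnorm : ‖e₀‖ = 1 := by
    rw [he₀, show Complex.I / ((ε ^ (m + 3) : ℝ) : ℂ) * (t : ℝ) =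
      Complex.I * ((t / ε ^ (m + 3) : ℝ) : ℂ) by push_cast; ring]
    exact Complex.norm_exp_I_mul_ofReal _
  generalize (∫ η in (0 : ℝ)..(δ / (|μ| * ε)), Complex.exp (Complex.I *
    ((T (x, a.2 + μ * ε * η) - t) / ε ^ (m + 3) : ℝ)) *
      chartAmplitude P T A (x, a.2 + μ * ε * η)) = I₁ at R₁ ⊢
  generalize (∫ η in (0 : ℝ)..(δ / (|-μ| * ε)), Complex.exp (Complex.I *
    ((T (x, a.2 + -μ * ε * η) - t) / ε ^ (m + 3) : ℝ)) *
      chartAmplitude P T A (x, a.2 + -μ * ε * η)) = I₂ at R₂ ⊢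
  have eq : ((μ * ε : ℝ) : ℂ) * (e₀ * I₁ + e₀ * I₂) - ((μ * ε : ℝ) : ℂ) * e₀ * a₀ * (J₁ + J₂) =
      ((μ * ε : ℝ) : ℂ) * (e₀ * ((I₁ - a₀ * J₁) + (I₂ - a₀ * J₂))) := by ring
  rw [eq, norm_mul, norm_mul, hnorm, one_mul, Complex.norm_real, Real.norm_eq_abs,
    abs_of_pos (by positivity : 0 < μ * ε)]
  calc μ * ε * ‖I₁ - a₀ * J₁ + (I₂ - a₀ * J₂)‖ ≤ μ * ε * (M₁ * ε + M₂ * ε) := by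
        gcongr
        exact (norm_add_le _ _).trans (add_le_add R₁ R₂)
    _ = _ := by ring

/-! ### The Airy and Pearcey integrals as sums of half-line integrals. -/

theorem cpow_half_eq {r : ℝ} (hr : 0 < r) : (Complex.I / (r : ℂ)) ^ (1 / 2 : ℂ) =
    Complex.exp (Complex.I * (Real.pi / 4)) * ((√r)⁻¹ : ℝ) := by
  have e : Complex.I / (r : ℂ) = ((r⁻¹ : ℝ) : ℂ) * Complex.I := by push_cast; ring
  have hr' : (0:ℝ) < r⁻¹ := by positivity
  have e2 : (((√r)⁻¹ : ℝ) : ℂ) = Complex.exp ((Real.log r⁻¹ : ℝ) / 2) := by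
    rw [← Real.sqrt_inv, show ((Real.log r⁻¹ : ℝ) : ℂ) / 2 = ((Real.log r⁻¹ / 2 : ℝ) : ℂ) by push_cast; ring,
      ← Complex.ofReal_exp, Real.exp_half, Real.exp_log hr']
  rw [e, Complex.cpow_def_of_ne_zero (by simp [hr.ne']), Complex.log_ofReal_mul hr' Complex.I_ne_zero,
    Complex.log_I, e2, ← Complex.exp_add]
  congr 1
  ring

/-- Reversing the sign of the whole real phase conjugates the integral; for the odd Airy phase this
identifies the negative half-line with the conjugate of the positive one. -/
theorem halfTrunc_neg (m : ℕ) (y v σ R : ℝ) :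
    halfTrunc m (-y) (-v) (-σ) R = (starRingEnd ℂ) (halfTrunc m y v σ R) := by
  simp only [halfTrunc, intervalIntegral, map_sub, ← integral_conj, ← Complex.exp_conj, map_mul,
    Complex.conj_I, Complex.conj_ofReal]
  congr 2 <;> (ext η; congr 1; push_cast; ring)

theorem intervalIntegrable_halfTrunc (m : ℕ) (y v σ α β : ℝ) :
    IntervalIntegrable (fun η : ℝ => Complex.exp (Complex.I *
      (y * η + v * η ^ 2 + σ * η ^ (m + 3) : ℝ))) volume α β := by
  apply Continuous.intervalIntegrable
  fun_prop

theorem airyTrunc_eq (y R : ℝ) : airyTrunc y R = 1 / Real.pi * (halfTrunc 0 y 0 (1 / 3) R).re := by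
  have := intervalIntegral.intervalIntegral_re (𝕜 := ℂ)
    (intervalIntegrable_halfTrunc 0 y 0 (1 / 3) 0 R)
  rw [airyTrunc, halfTrunc]
  refine congrArg _ (Eq.trans ?_ this)
  refine intervalIntegral.integral_congr fun η _ => ?_
  have e : Complex.I * ((y * η + 0 * η ^ 2 + 1 / 3 * η ^ (0 + 3) : ℝ) : ℂ) =
      ((η ^ 3 / 3 + y * η : ℝ) : ℂ) * Complex.I := by push_cast; ring
  change Real.cos (η ^ 3 / 3 + y * η) = (Complex.exp _).re
  rw [e, Complex.exp_ofReal_mul_I_re]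

/-- The Airy integral converges, and the whole-line integral is the sum of two conjugate halves. -/
theorem exists_tendsto_airy (y : ℝ) : ∃ J₁ J₂ : ℂ,
    Tendsto (halfTrunc 0 y 0 (1 / 3)) atTop (𝓝 J₁) ∧
    Tendsto (halfTrunc 0 (-y) 0 (-(1 / 3))) atTop (𝓝 J₂) ∧
    Tendsto (airyTrunc y) atTop (𝓝 (airyAi y)) ∧ J₁ + J₂ = (2 * Real.pi * airyAi y : ℝ) := by
  obtain ⟨J, hJ⟩ := exists_tendsto_halfTrunc 0 y 0 (by norm_num : (1 / 3 : ℝ) ≠ 0)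
  have h1 : Tendsto (airyTrunc y) atTop (𝓝 (1 / Real.pi * J.re)) :=
    (((Complex.continuous_re.tendsto J).comp hJ).const_mul _).congr fun R =>
      (airyTrunc_eq y R).symm
  have h2 : airyAi y = 1 / Real.pi * J.re := h1.limUnder_eq
  refine ⟨J, (starRingEnd ℂ) J, hJ, ?_, h2 ▸ h1, ?_⟩
  · refine ((Complex.continuous_conj.tendsto J).comp hJ).congr fun R => ?_
    rw [Function.comp_apply, ← halfTrunc_neg, neg_zero]
  · rw [Complex.add_conj, h2]
    congr 1
    field_simp

/-- Reflecting η on the negative half-line changes only the sign of y, the other powers being even.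
The two ends of integration remain independent. -/
theorem pearceyTrunc_eq (s y v : ℝ) (R : ℝ × ℝ) : pearceyTrunc s y v R =
    1 / (2 * Real.pi) * (halfTrunc 1 y v s R.2 + halfTrunc 1 (-y) v s (-R.1)) := by
  have hi := intervalIntegrable_halfTrunc 1 y v s
  have e1 : halfTrunc 1 (-y) v s (-R.1) = ∫ η in R.1..0, Complex.exp (Complex.I *
      (y * η + v * η ^ 2 + s * η ^ (1 + 3) : ℝ)) := by
    have := intervalIntegral.integral_comp_neg (a := 0) (b := -R.1)
      (fun η : ℝ => Complex.exp (Complex.I * (y * η + v * η ^ 2 + s * η ^ (1 + 3) : ℝ)))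
    rw [neg_neg, neg_zero] at this
    rw [← this, halfTrunc]
    refine intervalIntegral.integral_congr fun η _ => ?_
    congr 3
    ring
  rw [pearceyTrunc, e1, halfTrunc, add_comm,
    intervalIntegral.integral_add_adjacent_intervals (hi _ _) (hi _ _)]

theorem exists_tendsto_pearcey {s : ℝ} (hs : s ≠ 0) (y v : ℝ) : ∃ J₁ J₂ : ℂ,
    Tendsto (halfTrunc 1 y v s) atTop (𝓝 J₁) ∧ Tendsto (halfTrunc 1 (-y) v s) atTop (𝓝 J₂) ∧
    Tendsto (pearceyTrunc s y v) (atBot ×ˢ atTop) (𝓝 (pearcey s y v)) ∧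
    J₁ + J₂ = 2 * Real.pi * pearcey s y v := by
  obtain ⟨J₁, h₁⟩ := exists_tendsto_halfTrunc 1 y v hs
  obtain ⟨J₂, h₂⟩ := exists_tendsto_halfTrunc 1 (-y) v hs
  have ht : Tendsto (pearceyTrunc s y v) (atBot ×ˢ atTop)
      (𝓝 (1 / (2 * Real.pi) * (J₁ + J₂))) := by
    have t1 := h₁.comp (tendsto_snd (f := (atBot : Filter ℝ)) (g := (atTop : Filter ℝ)))
    have t2 := h₂.comp (tendsto_neg_atBot_atTop.comp
      (tendsto_fst (f := (atBot : Filter ℝ)) (g := (atTop : Filter ℝ))))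
    exact ((t1.add t2).const_mul _).congr fun R => (pearceyTrunc_eq s y v R).symm
  have h3 : pearcey s y v = 1 / (2 * Real.pi) * (J₁ + J₂) := ht.limUnder_eq
  refine ⟨J₁, J₂, h₁, h₂, h3 ▸ ht, ?_⟩
  have : (Real.pi : ℂ) ≠ 0 := by exact_mod_cast Real.pi_ne_zero
  rw [h3]
  field_simp

/-! ### Leading terms at a fold and at a cusp. -/

/-- Reduction of the caustic asymptotics to an identity for the leading term. -/
theorem hasCausticAsymptotics_of_main_eq {L : Set (Plane × Plane)} {Ω : Set (ℝ × ℝ)}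
    {X P : ℝ × ℝ → Plane} (h : IsEikonalCoordinateSystem L Ω X P) {a : ℝ × ℝ} (ha : a ∈ Ω) {m : ℕ}
    (hm : m ≤ 1) (hz : ∀ k, 1 ≤ k → k ≤ m + 1 → dlast^[k] X a = 0) {c : ℝ}
    (hcdef : inner ℝ (dpsi P a) (dlast^[m + 2] X a) = c) (hc : c ≠ 0)
    (horth : inner ℝ (P a) (dpsi P a) = 0) (hP1 : dpsi P a ≠ 0) {W : Set (Plane × ℝ)}
    {T : Plane × ℝ → ℝ} (hT : IsPhaseFunction Ω X P a W T) {μ : ℝ} (hμ : 0 < μ)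
    {main : ℂ → ℝ → Plane → ℂ} {r Cv : ℝ} (hr : r = 2 / (m + 3) - 1 / 2) (hCv : 0 ≤ Cv)
    (hmain : ∀ (A₀ : ℂ) (ε : ℝ) (z : Plane), 0 < ε → ∃ (v : ℝ) (J₁ J₂ : ℂ),
      |v| * ε ^ (m + 1) ≤ Cv * ‖z‖ ∧
      Tendsto (halfTrunc m (μ * (inner ℝ (dpsi P a) z / ε ^ (m + 2))) v
            (-c * μ ^ (m + 3) / (m + 3).factorial)) atTop (𝓝 J₁) ∧
      Tendsto (halfTrunc m (-μ * (inner ℝ (dpsi P a) z / ε ^ (m + 2))) v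
            (-c * (-μ) ^ (m + 3) / (m + 3).factorial)) atTop (𝓝 J₂) ∧
      main A₀ (ε ^ (m + 3)) z =
        Complex.exp (Complex.I * (Real.pi / 4)) * ((√(2 * Real.pi * ε ^ (m + 3)))⁻¹ : ℝ) *
        (((μ * ε : ℝ) : ℂ) * Complex.exp (Complex.I / ((ε ^ (m + 3) : ℝ) : ℂ) *
          (a.1 + inner ℝ (P a) z : ℝ)) * (A₀ * (√(‖P a‖ * ‖dpsi P a‖) : ℝ)) * (J₁ + J₂))) :
    HasCausticAsymptotics X P a W T main r := by
  obtain ⟨N, hN, hmainN⟩ := exists_norm_integral_singularIntegrand_sub_le h ha m hz hcdef hc horth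
    hP1 hT hμ
  refine ⟨N, hN, fun A hA _ hsupp C hC => ?_⟩
  obtain ⟨K, ε₀, hε₀, hK⟩ := hmainN A hA hsupp (C + Cv * C) (by positivity)
  refine ⟨(√(2 * Real.pi))⁻¹ * K, min 1 (ε₀ ^ (m + 3)), by positivity, fun η hη hηlt x hx => ?_⟩
  obtain ⟨hη1, hη0⟩ := lt_min_iff.1 hηlt
  -- The semiclassical parameter h is called η here, and ε = h^(1/(m+3)).
  obtain ⟨ε, hεdef⟩ : ∃ ε : ℝ, ε = η ^ (((m + 3 : ℕ) : ℝ)⁻¹) := ⟨_, rfl⟩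
  have hε : 0 < ε := hεdef ▸ Real.rpow_pos_of_pos hη _
  have hεη : ε ^ (m + 3) = η := by rw [hεdef]; exact Real.rpow_inv_natCast_pow hη.le (by omega)
  have hεlt : ε < ε₀ := lt_of_pow_lt_pow_left₀ (m + 3) hε₀.le (hεη ▸ hη0)
  have hpow : ∀ j : ℕ, ε ^ j = η ^ ((j : ℝ) / (m + 3)) := by
    intro j
    rw [hεdef, ← Real.rpow_natCast, ← Real.rpow_mul hη.le]
    congr 1
    push_cast
    field_simp
  -- For m ≤ 1 the exponent (m+2)/(m+3) is at most 3/4 < 5/6, and h < 1.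
  have h56 : η ^ (5 / 6 : ℝ) ≤ ε ^ (m + 2) := by
    rw [hpow]
    refine Real.rpow_le_rpow_of_exponent_ge hη hη1.le ?_
    have : (m : ℝ) ≤ 1 := by exact_mod_cast hm
    rw [div_le_div_iff₀ (by positivity) (by norm_num)]
    push_cast
    linarith
  have hx' : ‖x - X a‖ ≤ C * ε ^ (m + 2) := hx.trans (by gcongr)
  have hx'' : ‖x - X a‖ ≤ (C + Cv * C) * ε ^ (m + 2) := by
    refine hx'.trans ?_
    gcongr
    have : 0 ≤ Cv * C := by positivity
    linarith
  obtain ⟨hint, hest⟩ := hK ε x hε hεlt hx''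
  obtain ⟨v, J₁, J₂, hv, hJ₁, hJ₂, hmeq⟩ := hmain (A a) ε (x - X a) hε
  have hv' : |v| ≤ (C + Cv * C) * ε := by
    have h1 : |v| * ε ^ (m + 1) ≤ (Cv * C * ε) * ε ^ (m + 1) := by
      calc |v| * ε ^ (m + 1) ≤ Cv * ‖x - X a‖ := hv
        _ ≤ Cv * (C * ε ^ (m + 2)) := by gcongr
        _ = _ := by ring
    have h2 := le_of_mul_le_mul_right h1 (by positivity)
    have h3 : 0 ≤ C * ε := by positivity
    linarith
  have hest' := hest v J₁ J₂ hv' hJ₁ hJ₂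
  rw [hεη] at hint hest' hmeq
  refine ⟨hint, ?_⟩
  have h2π : (0 : ℝ) < 2 * Real.pi * η := by positivity
  rw [hmeq, singularIntegral, cpow_half_eq h2π, ← mul_sub, norm_mul, norm_mul, Complex.norm_real,
    Real.norm_eq_abs, abs_of_pos (by positivity)]
  have hone : ‖Complex.exp (Complex.I * (Real.pi / 4))‖ = 1 := by
    rw [show (Real.pi / 4 : ℂ) = ((Real.pi / 4 : ℝ) : ℂ) by push_cast; ring]
    exact Complex.norm_exp_I_mul_ofReal _
  rw [hone, one_mul]
  refine (mul_le_mul_of_nonneg_left hest' (by positivity)).trans (le_of_eq ?_)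
  have hs : (√η)⁻¹ * ε ^ 2 = η ^ r := by
    rw [hpow, Real.sqrt_eq_rpow, ← Real.rpow_neg hη.le, ← Real.rpow_add hη, hr]
    congr 1
    push_cast
    ring
  rw [Real.sqrt_mul (by positivity), mul_inv, ← hs]
  ring

theorem sqrt_pow_three {ε : ℝ} (hε : 0 ≤ ε) : √(ε ^ 3) = ε * √ε := by
  rw [show ε ^ 3 = ε ^ 2 * ε by ring, Real.sqrt_mul (by positivity), Real.sqrt_sq hε]

theorem fold_coefficient_eq {c ε α : ℝ} (hc : c ≠ 0) (hε : 0 < ε) :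
    2 ^ (5 / 6 : ℝ) * √(Real.pi * α) / (|c| ^ (1 / 3 : ℝ) * (ε ^ 3) ^ (1 / 6 : ℝ)) =
      (√(2 * Real.pi * ε ^ 3))⁻¹ * ((2 / |c|) ^ (1 / 3 : ℝ) * ε) * √α * (2 * Real.pi) := by
  have hc' : 0 < |c| := abs_pos.2 hc
  have e1 : (2 : ℝ) ^ (5 / 6 : ℝ) = 2 ^ (1 / 3 : ℝ) * √2 := by
    rw [Real.sqrt_eq_rpow, ← Real.rpow_add two_pos]; norm_num
  have e2 : (ε ^ 3) ^ (1 / 6 : ℝ) = √ε := by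
    rw [Real.sqrt_eq_rpow, ← Real.rpow_natCast, ← Real.rpow_mul hε.le]; norm_num
  rw [e1, e2, Real.sqrt_mul Real.pi_pos.le, Real.sqrt_mul (by positivity),
    Real.sqrt_mul (by norm_num), sqrt_pow_three hε.le, Real.div_rpow two_pos.le hc'.le]
  have s1 : √Real.pi * √Real.pi = Real.pi := Real.mul_self_sqrt Real.pi_pos.le
  have s2 : √2 * √2 = (2 : ℝ) := Real.mul_self_sqrt two_pos.le
  have hp : 0 < √Real.pi := by positivity
  have hq : 0 < √ε := by positivity
  field_simp
  rw [pow_two, pow_two, s1, s2]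
  ring

theorem cusp_coefficient_eq {c ε α : ℝ} (hc : c ≠ 0) (hε : 0 < ε) :
    2 * √Real.pi * 6 ^ (1 / 4 : ℝ) * √α / (|c| ^ (1 / 4 : ℝ) * (ε ^ 4) ^ (1 / 4 : ℝ)) =
      (√(2 * Real.pi * ε ^ 4))⁻¹ * ((24 / |c|) ^ (1 / 4 : ℝ) * ε) * √α * (2 * Real.pi) := by
  have hc' : 0 < |c| := abs_pos.2 hc
  have e1 : (24 : ℝ) ^ (1 / 4 : ℝ) = 6 ^ (1 / 4 : ℝ) * √2 := by
    have h4 : (4 : ℝ) ^ (1 / 4 : ℝ) = √2 := by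
      rw [Real.sqrt_eq_rpow, show (4 : ℝ) = 2 ^ (2 : ℕ) by norm_num, ← Real.rpow_natCast,
        ← Real.rpow_mul two_pos.le]
      norm_num
    rw [← h4, ← Real.mul_rpow (by norm_num) (by norm_num)]
    norm_num
  have e2 : (ε ^ 4) ^ (1 / 4 : ℝ) = ε := by
    rw [← Real.rpow_natCast, ← Real.rpow_mul hε.le]; norm_num
  have e3 : √(ε ^ 4) = ε ^ 2 := by
    rw [show ε ^ 4 = (ε ^ 2) ^ 2 by ring, Real.sqrt_sq (by positivity)]
  rw [e2, Real.sqrt_mul (by positivity), Real.sqrt_mul (by norm_num), e3,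
    Real.div_rpow (by norm_num) hc'.le, e1]
  have s1 : √Real.pi * √Real.pi = Real.pi := Real.mul_self_sqrt Real.pi_pos.le
  have hp : 0 < √Real.pi := by positivity
  have hq : 0 < √(2 : ℝ) := by positivity
  field_simp
  rw [pow_two, s1, mul_comm]

/-- The real cube root separates into sign and modulus, the modulus giving the scaling factor μ of
the fold. -/
theorem airy_argument_eq {c ε s : ℝ} (hε : 0 < ε) :
    -(2 ^ (1 / 3 : ℝ) * s / ((ε ^ 3) ^ (2 / 3 : ℝ) * cbrt c)) =
      -(SignType.sign c : ℝ) * ((2 / |c|) ^ (1 / 3 : ℝ) * (s / ε ^ 2)) := by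
  have e2 : (ε ^ 3) ^ (2 / 3 : ℝ) = ε ^ 2 := by
    rw [← Real.rpow_natCast, ← Real.rpow_mul hε.le, ← Real.rpow_natCast]; norm_num
  rw [e2, cbrt, Real.div_rpow two_pos.le (abs_nonneg c)]
  rcases lt_trichotomy c 0 with hc | hc | hc
  · simp only [sign_neg hc, SignType.coe_neg_one]
    field_simp
  · simp [hc]
  · simp only [sign_pos hc, SignType.coe_one]
    field_simp

theorem fold_asymptotics {L : Set (Plane × Plane)} {Ω : Set (ℝ × ℝ)}
    {X P : ℝ × ℝ → Plane} (h : IsEikonalCoordinateSystem L Ω X P) {a : ℝ × ℝ} (ha : a ∈ Ω)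
    (hX1 : dpsi X a = 0) (hc : inner ℝ (dpsi P a) (dpsi (dpsi X) a) ≠ 0)
    (horth : inner ℝ (P a) (dpsi P a) = 0) (hP1 : dpsi P a ≠ 0) {W : Set (Plane × ℝ)}
    {T : Plane × ℝ → ℝ} (hT : IsPhaseFunction Ω X P a W T) :
    HasCausticAsymptotics X P a W T
        (foldTerm (P a) (dpsi P a) (inner ℝ (dpsi P a) (dpsi (dpsi X) a)) a.1) (1 / 6) := by
  generalize hcdef : inner ℝ (dpsi P a) (dpsi (dpsi X) a) = c at hc ⊢
  -- The scale μ is fixed by |c| μ³/3! = 1/3, the coefficient in the Airy phase.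
  have hc' : 0 < |c| := abs_pos.2 hc
  obtain ⟨μ, hμdef⟩ : ∃ μ : ℝ, μ = (2 / |c|) ^ (1 / 3 : ℝ) := ⟨_, rfl⟩
  have hμ : 0 < μ := by rw [hμdef]; positivity
  have hμ3 : μ ^ 3 = 2 / |c| := by
    rw [hμdef, ← Real.rpow_natCast, ← Real.rpow_mul (by positivity)]; norm_num
  refine hasCausticAsymptotics_of_main_eq h ha (m := 0) (by norm_num)
    (fun k h1 h2 => by obtain rfl : k = 1 := by omega
                       exact hX1) hcdef hc horth hP1 hT hμ (by norm_num) le_rfl ?_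
  intro A₀ ε z hε
  have key : ∀ J₁ J₂ : ℂ, J₁ + J₂ = (2 * Real.pi * airyAi (-(SignType.sign c : ℝ) *
      (μ * (inner ℝ (dpsi P a) z / ε ^ 2))) : ℝ) →
      foldTerm (P a) (dpsi P a) c a.1 A₀ (ε ^ (0 + 3)) z =
        Complex.exp (Complex.I * (Real.pi / 4)) * ((√(2 * Real.pi * ε ^ (0 + 3)))⁻¹ : ℝ) *
        (((μ * ε : ℝ) : ℂ) * Complex.exp (Complex.I / ((ε ^ (0 + 3) : ℝ) : ℂ) *
          (a.1 + inner ℝ (P a) z : ℝ)) * (A₀ * (√(‖P a‖ * ‖dpsi P a‖) : ℝ)) * (J₁ + J₂)) := by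
    intro J₁ J₂ hJ
    rw [hJ, foldTerm, airy_argument_eq hε, zero_add, ← hμdef, mul_assoc Real.pi,
      fold_coefficient_eq hc hε, ← hμdef]
    push_cast
    ring
  have hσ : ∀ ν : ℝ, ν ^ 3 = 2 / c → -c * ν ^ (0 + 3) / ((0 + 3 : ℕ).factorial : ℝ) = -(1 / 3) := by
    intro ν hν
    rw [zero_add, hν]
    norm_num [Nat.factorial]
    field_simp
    norm_num
  have hσ' : ∀ ν : ℝ, ν ^ 3 = -(2 / c) →
      -c * ν ^ (0 + 3) / ((0 + 3 : ℕ).factorial : ℝ) = 1 / 3 := by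
    intro ν hν
    rw [zero_add, hν]
    norm_num [Nat.factorial]
    field_simp
    norm_num
  have hneg : (-μ) ^ 3 = -μ ^ 3 := by ring
  rcases lt_or_gt_of_ne hc with hcn | hcp
  · obtain ⟨J₁, J₂, h₁, h₂, -, hJ⟩ := exists_tendsto_airy (μ * (inner ℝ (dpsi P a) z / ε ^ 2))
    rw [abs_of_neg hcn] at hμ3
    refine ⟨0, J₁, J₂, by simp, ?_, ?_, key J₁ J₂ ?_⟩
    · rwa [hσ' μ (by rw [hμ3, div_neg])]
    · rwa [hσ (-μ) (by rw [hneg, hμ3, div_neg, neg_neg]), neg_mul]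
    · rw [hJ, sign_neg hcn]
      simp
  -- For c > 0 the cubic coefficient on the half θ > 0 is -1/3, so the two halves exchange roles and
  -- the Airy argument changes sign.
  · obtain ⟨J₁, J₂, h₁, h₂, -, hJ⟩ := exists_tendsto_airy (-(μ * (inner ℝ (dpsi P a) z / ε ^ 2)))
    rw [abs_of_pos hcp] at hμ3
    rw [neg_neg] at h₂
    refine ⟨0, J₂, J₁, by simp, ?_, ?_, key J₂ J₁ ?_⟩
    · rwa [hσ μ hμ3]
    · rwa [hσ' (-μ) (by rw [hneg, hμ3]), neg_mul]
    · rw [add_comm, hJ, sign_pos hcp]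
      simp

theorem cusp_asymptotics {L : Set (Plane × Plane)} {Ω : Set (ℝ × ℝ)}
    {X P : ℝ × ℝ → Plane} (h : IsEikonalCoordinateSystem L Ω X P) {a : ℝ × ℝ} (ha : a ∈ Ω)
    (hX1 : dpsi X a = 0) (hX2 : dpsi (dpsi X) a = 0)
    (hc : inner ℝ (dpsi P a) (dpsi (dpsi (dpsi X)) a) ≠ 0)
    (horth : inner ℝ (P a) (dpsi P a) = 0) (hP1 : dpsi P a ≠ 0) {W : Set (Plane × ℝ)}
    {T : Plane × ℝ → ℝ} (hT : IsPhaseFunction Ω X P a W T) :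
    HasCausticAsymptotics X P a W T
        (cuspTerm (P a) (dpsi P a) (dpsi (dpsi P) a)
          (inner ℝ (dpsi P a) (dpsi (dpsi (dpsi X)) a)) a.1) 0 := by
  generalize hcdef : inner ℝ (dpsi P a) (dpsi (dpsi (dpsi X)) a) = c at hc ⊢
  -- The scale μ is fixed by |c| μ⁴/4! = 1.
  have hc' : 0 < |c| := abs_pos.2 hc
  obtain ⟨μ, hμdef⟩ : ∃ μ : ℝ, μ = (24 / |c|) ^ (1 / 4 : ℝ) := ⟨_, rfl⟩
  have hμ : 0 < μ := by rw [hμdef]; positivity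
  have hμ4 : μ ^ 4 = 24 / |c| := by
    rw [hμdef, ← Real.rpow_natCast, ← Real.rpow_mul (by positivity)]; norm_num
  refine hasCausticAsymptotics_of_main_eq h ha (m := 1) (by norm_num)
    (fun k h1 h2 => by
      obtain rfl | rfl : k = 1 ∨ k = 2 := by omega
      exacts [hX1, hX2]) hcdef hc horth hP1 hT hμ (Cv := √(6 / |c|) * ‖dpsi (dpsi P) a‖)
    (by norm_num) (by positivity) ?_
  intro A₀ ε z hε
  -- The power is even, so both halves have the same quartic coefficient, minus the sign of c.
  have hσ : ∀ ν : ℝ, ν ^ 4 = μ ^ 4 →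
      -c * ν ^ (1 + 3) / ((1 + 3 : ℕ).factorial : ℝ) = if 0 < c then -1 else 1 := by
    intro ν hν
    rw [show 1 + 3 = 4 by norm_num, hν, hμ4]
    norm_num [Nat.factorial]
    split_ifs with hpos
    · rw [abs_of_pos hpos]
      field_simp
    · rw [abs_of_neg (lt_of_le_of_ne (not_lt.1 hpos) hc)]
      field_simp
  have hs : (if 0 < c then -1 else 1 : ℝ) ≠ 0 := by split_ifs <;> norm_num
  obtain ⟨J₁, J₂, h₁, h₂, -, hJ⟩ := exists_tendsto_pearcey hs
    (μ * (inner ℝ (dpsi P a) z / ε ^ 3)) (√(6 / (ε ^ 4 * |c|)) * inner ℝ (dpsi (dpsi P) a) z)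
  have hsq : √(6 / (ε ^ 4 * |c|)) = √(6 / |c|) / ε ^ 2 := by
    rw [show 6 / (ε ^ 4 * |c|) = 6 / |c| / (ε ^ 2) ^ 2 by field_simp,
      Real.sqrt_div (by positivity), Real.sqrt_sq (by positivity)]
  refine ⟨√(6 / (ε ^ 4 * |c|)) * inner ℝ (dpsi (dpsi P) a) z, J₁, J₂, ?_, ?_, ?_, ?_⟩
  · rw [hsq, abs_mul, abs_of_nonneg (by positivity)]
    have h3 := abs_real_inner_le_norm (dpsi (dpsi P) a) z
    calc √(6 / |c|) / ε ^ 2 * |inner ℝ (dpsi (dpsi P) a) z| * ε ^ (1 + 1)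
        = √(6 / |c|) * |inner ℝ (dpsi (dpsi P) a) z| := by field_simp; ring
      _ ≤ √(6 / |c|) * (‖dpsi (dpsi P) a‖ * ‖z‖) := by gcongr
      _ = _ := by ring
  · rwa [hσ μ rfl]
  · rwa [hσ (-μ) (by ring), neg_mul]
  · have e3 : (24 / ((ε ^ 4) ^ 3 * |c|)) ^ (1 / 4 : ℝ) = μ / ε ^ 3 := by
      rw [show 24 / ((ε ^ 4) ^ 3 * |c|) = 24 / |c| / (ε ^ 3) ^ (4 : ℕ) by field_simp,
        Real.div_rpow (by positivity) (by positivity), ← hμdef]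
      congr 1
      rw [← Real.rpow_natCast, ← Real.rpow_mul (by positivity)]
      norm_num
    have e4 : (24 / ((ε ^ 4) ^ 3 * |c|)) ^ (1 / 4 : ℝ) * inner ℝ (dpsi P a) z =
        μ * (inner ℝ (dpsi P a) z / ε ^ 3) := by rw [e3]; ring
    rw [hJ, show 1 + 3 = 4 by norm_num, cuspTerm, e4, cusp_coefficient_eq hc hε, ← hμdef]
    push_cast
    ring

end Caustic

theorem theorem5 (L : Set (Plane × Plane)) (hL : IsLagrangianSurface L)
    -- the manifold lies in a level set of a Hamiltonian `F(x, |p|)`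
    (D : Set (Plane × ℝ)) (hD : IsOpen D) (F : Plane × ℝ → ℝ) (hF : ContDiffOn ℝ ∞ F D) (E : ℝ)
    (hlevel : ∀ q ∈ L, (q.1, ‖q.2‖) ∈ D ∧ F (q.1, ‖q.2‖) = E)
    -- eikonal coordinates `(τ, ψ)` near the focal point `a = (τ*, ψ*)`
    (Ω : Set (ℝ × ℝ)) (X P : ℝ × ℝ → Plane) (hXP : IsEikonalCoordinateSystem L Ω X P)
    (a : ℝ × ℝ) (ha : a ∈ Ω) (hfocal : IsFocal X a)
    -- the Hamiltonian genuinely depends on `|p|` there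
    (hreg : deriv (fun r => F (X a, r)) ‖P a‖ ≠ 0)
    -- the phase function `τ(x, ψ)` of the singular chart
    (W : Set (Plane × ℝ)) (T : Plane × ℝ → ℝ) (hT : IsPhaseFunction Ω X P a W T) :
    -- fold
    (dpsi (dpsi X) a ≠ 0 →
      (∀ y : ℝ, Tendsto (airyTrunc y) atTop (𝓝 (airyAi y))) ∧
      HasCausticAsymptotics X P a W T
        (foldTerm (P a) (dpsi P a) (inner ℝ (dpsi P a) (dpsi (dpsi X) a)) a.1) (1 / 6)) ∧
    -- cusp
    (dpsi (dpsi X) a = 0 → dpsi (dpsi (dpsi X)) a ≠ 0 →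
      (∀ s y v : ℝ, s = 1 ∨ s = -1 →
        Tendsto (pearceyTrunc s y v) (atBot ×ˢ atTop) (𝓝 (pearcey s y v))) ∧
      HasCausticAsymptotics X P a W T
        (cuspTerm (P a) (dpsi P a) (dpsi (dpsi P) a)
          (inner ℝ (dpsi P a) (dpsi (dpsi (dpsi X)) a)) a.1) 0) := by
  have hX1 := hXP.dpsi_eq_zero ha hfocal
  have hP1 := hXP.dpsi_momentum_ne_zero ha hfocal
  have horth := hXP.inner_dpsi_momentum ha hfocal hD hF hlevel hreg
  have hP0 := hXP.ne_zero ha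
  refine ⟨fun hX2 => ⟨fun y => (exists_tendsto_airy y).choose_spec.choose_spec.2.2.1, ?_⟩,
    fun hX2 hX3 => ⟨fun s y v hs => ?_, ?_⟩⟩
  -- If c were zero, X_ψψ would be orthogonal to both P and P_ψ, which span the plane.
  · refine fold_asymptotics hXP ha hX1 (fun h0 => hX2 ?_) horth hP1 hT
    have h1 := hXP.inner_dpsi_dpsi_add ha
    rw [hX1, inner_zero_right, add_zero] at h1
    exact eq_zero_of_inner_eq_zero hP0 hP1 horth h1 h0
  · have hs0 : s ≠ 0 := by rcases hs with rfl | rfl <;> norm_num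
    exact (exists_tendsto_pearcey hs0 y v).choose_spec.choose_spec.2.2.1
  · refine cusp_asymptotics hXP ha hX1 hX2 (fun h0 => hX3 ?_) horth hP1 hT
    have h1 := hXP.inner_dpsi_dpsi_dpsi_add ha
    rw [hX1, hX2, inner_zero_right, inner_zero_right, add_zero, add_zero, add_zero] at h1
    exact eq_zero_of_inner_eq_zero hP0 hP1 horth h1 h0
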